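/- Let $n\ge 2$. Write $\Sigma^n=\mathbb R^n\times\mathbb S^{n-1}$, let $\mathcal P^n$ be the set of nonempty convex polytopes in $\mathbb R^n$, $\mathcal B(\Sigma^n)$ the Borel sets of $\Sigma^n$, and $\mathbb T^p$ the real vector space of symmetric $p$-tensors (symmetric $p$-linear functionals) on $\mathbb R^n$. Vectors are identified with linear functionals via the scalar product, products and powers of tensors are symmetric tensor products, and $Q(x,y)=\langle x,y\rangle$ is the metric tensor; for a linear subspace $L$ let $Q_L(x,y)=\langle \pi_Lx,\pi_Ly\rangle$, with $\pi_L$ the orthogonal projection to $L$. For $P\in\mathcal P^n$ let $\mathcal F_k(P)$ be the set of its $k$-dimensional faces, $L(F)$ the direction space of a face $F$, $\nu(P,F)\subset\mathbb S^{n-1}$ the set of outer unit normal vectors of $P$ at $F$, and $\mathrm{Nor}\,P\subset\Sigma^n$ the set of pairs $(x,u)$ with $x$ a boundary point of $P$ and $u$ an outer unit normal vector of $P$ at $x$. Let $\omega_d=2\pi^{d/2}/\Gamma(d/2)$, where here $\Gamma$ denotes the Gamma function. For $k\in\{0,\dots,n-1\}$ and $s,j\in\mathbb N_0$ put $$\phi_k^{0,s,j}(P,\eta)=\frac{1}{s!\,\omega_{n-k+s}}\sum_{F\in\mathcal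 F_k(P)}Q_{L(F)}^{\,j}\int_F\int_{\nu(P,F)}\mathbf 1_\eta(x,u)\,u^s\,\mathcal H^{n-k-1}(\mathrm du)\,\mathcal H^k(\mathrm dx).$$ For $n=3$ put $$\widetilde\phi^{0,s,j}(P,\eta)=\sum_{F\in\mathcal F_1(P)}Q_{L(F)}^{\,j}\,v_F\int_F\int_{\nu(P,F)}\mathbf 1_\eta(x,u)\,(v_F\times u)\,u^s\,\mathcal H^1(\mathrm du)\,\mathcal H^1(\mathrm dx),$$ where $v_F\in L(F)$ is a unit vector (the choice of its sign does not matter). For $n=2$ and $k\in\{0,1\}$ put $$\widetilde\phi_k^{0,s}(P,\eta)=\sum_{F\in\mathcal F_k(P)}\int_F\int_{\nu(P,F)}\mathbf 1_\eta(x,u)\,\overline u\,u^s\,\mathcal H^{1-k}(\mathrm du)\,\mathcal H^k(\mathrm dx),$$ where $(u,\overline u)$ is the positively oriented orthonormal basis of $\mathbb R^2$ with first vector $u$. **Theorem.** Let $p\in\mathbb N_0$ and let $\Gamma:\mathcal P^n\times\mathcal B(\Sigma^n)\to\mathbb T^p$ be a mapping with the following properties. (a) $\Gamma(P,\cdot)$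 is a $\mathbb T^p$-valued (countably additive) measure, for each $P\in\mathcal P^n$. (b) $\Gamma$ is translation invariant, $\Gamma(P+t,\eta+t)=\Gamma(P,\eta)$ for $t\in\mathbb R^n$, where $\eta+t=\{(x+t,u):(x,u)\in\eta\}$; and $\mathrm{SO}(n)$ covariant, $\Gamma(\vartheta P,\vartheta\eta)=\vartheta\,\Gamma(P,\eta)$ for $\vartheta\in\mathrm{SO}(n)$, where $\vartheta\eta=\{(\vartheta x,\vartheta u):(x,u)\in\eta\}$ and $(\vartheta T)(x_1,\dots,x_p)=T(\vartheta^{-1}x_1,\dots,\vartheta^{-1}x_p)$. (c) $\Gamma$ is locally defined: if $\eta\cap\mathrm{Nor}\,P=\eta'\cap\mathrm{Nor}\,P'$, then $\Gamma(P,\eta)=\Gamma(P',\eta')$. Then $\Gamma$ is a linear combination, with constant coefficients, of the mappings $Q^m\phi_k^{0,s,j}$, where $m,s,j\in\mathbb N_0$ satisfy $2m+2j+s=p$, where $k\in\{0,\dots,n-1\}$, and where $j=0$ if $k\in\{0,n-1\}$, together with - if $n\ge4$, no more mappings; - if $n=3$, the mappings $Q^m\widetilde\phi^{0,s,j}$,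 where $m,s,j\in\mathbb N_0$ satisfy $2m+2j+s+2=p$; - if $n=2$, the mappings $Q^m\widetilde\phi_k^{0,s}$, where $m,s\in\mathbb N_0$ satisfy $2m+s+1=p$ and $k\in\{0,1\}$. -/

import Mathlib

noncomputable section

namespace LocalTensor

open MeasureTheory
open scoped RealInnerProductSpace

/-! ### Symmetric tensors -/

/-- Euclidean space `ℝⁿ`. -/
abbrev Euc (n : ℕ) : Type := EuclideanSpace ℝ (Fin n)

/-- The space `𝕋ᵖ` of symmetric `p`-tensors on `ℝⁿ`: symmetric `p`-linear functionals (continuity is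
automatic in finite dimension; bundling it provides the canonical norm topology). -/
def symTensorSubmodule (n p : ℕ) :
    Submodule ℝ (ContinuousMultilinearMap ℝ (fun _ : Fin p => Euc n) ℝ) where
  carrier := {T | ∀ (σ : Equiv.Perm (Fin p)) (x : Fin p → Euc n), T (fun i => x (σ i)) = T x}
  add_mem' := by
    intro S T hS hT σ x
    rw [add_apply, add_apply, hS, hT]
  zero_mem' := by
    intro σ x
    rfl
  smul_mem' := by
    intro c T hT σ x
    rw [smul_apply, smul_apply, hT]

/-- The type of symmetric `p`-tensors on `ℝⁿ`. -/
abbrev SymTensor (n p : ℕ) : Type := symTensorSubmodule n p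

instance SymTensor.finiteDimensional (n p : ℕ) :
    FiniteDimensional ℝ (SymTensor n p) := by
  let f : SymTensor n p →ₗ[ℝ] MultilinearMap ℝ (fun _ : Fin p => Euc n) ℝ :=
    { toFun := fun T => T.1.toMultilinearMap
      map_add' := fun _ _ => rfl
      map_smul' := fun _ _ => rfl }
  refine FiniteDimensional.of_injective f ?_
  intro S T h
  apply Subtype.ext
  exact ContinuousMultilinearMap.toMultilinearMap_injective h

instance SymTensor.completeSpace (n p : ℕ) : CompleteSpace (SymTensor n p) :=
  (symTensorSubmodule n p).complete_of_finiteDimensional.completeSpace_coe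

variable {n p q : ℕ}

/-- `T(f x₁, …, f x_p)`. -/
def SymTensor.comp (T : SymTensor n p) (f : Euc n →L[ℝ] Euc n) : SymTensor n p :=
  ⟨T.1.compContinuousLinearMap (fun _ => f), fun σ x => T.2 σ (fun i => f (x i))⟩

/-- A `p`-tensor regarded as a `q`-tensor when `p = q`. -/
def SymTensor.cast (h : p = q) (T : SymTensor n p) : SymTensor n q :=
  ⟨T.1.domDomCongr (finCongr h), fun σ x => by subst h; exact T.2 σ x⟩

theorem tensorMul_left {V : Type} [DecidableEq (Fin (p + q))] (m : Fin (p + q) → V) (i : Fin p)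
    (x : V) : (fun j => Function.update m (Fin.castAdd q i) x (Fin.castAdd q j)) =
      Function.update (fun j => m (Fin.castAdd q j)) i x := by
  funext j
  by_cases h : j = i
  · subst h; simp
  · simp [Function.update_of_ne, h]

theorem tensorMul_left_right {V : Type} [DecidableEq (Fin (p + q))] (m : Fin (p + q) → V)
    (i : Fin p) (x : V) :
    (fun j => Function.update m (Fin.castAdd q i) x (Fin.natAdd p j)) =
      fun j => m (Fin.natAdd p j) := by
  funext j
  refine Function.update_of_ne (fun h => ?_) _ _
  have := congrArg Fin.val h
  simp at this
  omega

theorem tensorMul_right {V : Type} [DecidableEq (Fin (p + q))] (m : Fin (p + q) → V) (i : Fin q)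
    (x : V) : (fun j => Function.update m (Fin.natAdd p i) x (Fin.natAdd p j)) =
      Function.update (fun j => m (Fin.natAdd p j)) i x := by
  funext j
  by_cases h : j = i
  · subst h; simp
  · simp [Function.update_of_ne, h]

theorem tensorMul_right_left {V : Type} [DecidableEq (Fin (p + q))] (m : Fin (p + q) → V)
    (i : Fin q) (x : V) :
    (fun j => Function.update m (Fin.natAdd p i) x (Fin.castAdd q j)) =
      fun j => m (Fin.castAdd q j) := by
  funext j
  refine Function.update_of_ne (fun h => ?_) _ _
  have := congrArg Fin.val h
  simp at this
  omega

/-- The (unsymmetrized) tensor product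
`(x₁, …, x_{p+q}) ↦ a(x₁, …, x_p) b(x_{p+1}, …, x_{p+q})`. -/
def tensorMul (a : ContinuousMultilinearMap ℝ (fun _ : Fin p => Euc n) ℝ)
    (b : ContinuousMultilinearMap ℝ (fun _ : Fin q => Euc n) ℝ) :
    ContinuousMultilinearMap ℝ (fun _ : Fin (p + q) => Euc n) ℝ where
  toFun x := a (fun i => x (Fin.castAdd q i)) * b (fun i => x (Fin.natAdd p i))
  map_update_add' := by
    intro _ m i x y
    rcases finSumFinEquiv.surjective i with ⟨i | i, rfl⟩
    · simp only [finSumFinEquiv_apply_left, tensorMul_left, tensorMul_left_right, a.map_update_add]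
      ring
    · simp only [finSumFinEquiv_apply_right, tensorMul_right, tensorMul_right_left,
        b.map_update_add]
      ring
  map_update_smul' := by
    intro _ m i c x
    rcases finSumFinEquiv.surjective i with ⟨i | i, rfl⟩
    · simp only [finSumFinEquiv_apply_left, tensorMul_left, tensorMul_left_right,
        a.map_update_smul, smul_eq_mul]
      ring
    · simp only [finSumFinEquiv_apply_right, tensorMul_right, tensorMul_right_left,
        b.map_update_smul, smul_eq_mul]
      ring
  cont := by fun_prop

/-- The symmetric tensor product
`(a b)(x₁, …, x_{p+q}) = (1/(p+q)!) ∑_σ a(x_{σ(1)}, …, x_{σ(p)}) b(x_{σ(p+1)}, …, x_{σ(p+q)})`. -/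
def SymTensor.mul (a : SymTensor n p) (b : SymTensor n q) : SymTensor n (p + q) :=
  ⟨((p + q).factorial : ℝ)⁻¹ • ∑ σ : Equiv.Perm (Fin (p + q)),
      (tensorMul a.1 b.1).domDomCongr σ, by
    intro τ x
    simp only [smul_apply, sum_apply,
      ContinuousMultilinearMap.domDomCongr_apply]
    congr 1
    exact Equiv.sum_comp (Equiv.mulLeft τ)
      (fun σ : Equiv.Perm (Fin (p + q)) => tensorMul a.1 b.1 (fun i => x (σ i)))⟩

/-- `x^r`, the `r`-fold symmetric tensor product of the vector `x` with itself, where vectors are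
identified with linear functionals: `x^r(y₁, …, y_r) = ⟨x, y₁⟩ ⋯ ⟨x, y_r⟩`. -/
def vecPow (x : Euc n) (r : ℕ) : SymTensor n r :=
  ⟨(ContinuousMultilinearMap.mkPiAlgebra ℝ (Fin r) ℝ).compContinuousLinearMap
      (fun _ => innerSL ℝ x), by
    intro σ y
    simp only [ContinuousMultilinearMap.compContinuousLinearMap_apply,
      ContinuousMultilinearMap.mkPiAlgebra_apply]
    exact Equiv.prod_comp σ (fun i => innerSL ℝ x (y i))⟩

/-- A vector regarded as a tensor of rank one. -/
def vec (x : Euc n) : SymTensor n 1 := vecPow x 1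

/-- The constant `1` as a tensor of rank zero. -/
def SymTensor.one : SymTensor n 0 := ⟨ContinuousMultilinearMap.constOfIsEmpty ℝ _ 1, by
  intro σ x
  rfl⟩

/-- The `m`-fold symmetric tensor power of a symmetric tensor. -/
def SymTensor.pow (a : SymTensor n p) : (m : ℕ) → SymTensor n (p * m)
  | 0 => SymTensor.one
  | m + 1 => (SymTensor.pow a m).mul a

/-- The metric tensor `Q(x, y) = ⟨x, y⟩`. -/
def metricTensor (n : ℕ) : SymTensor n 2 :=
  ⟨{ toFun := fun x => ⟪x 0, x 1⟫
     map_update_add' := by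
       intro _ m i x y
       fin_cases i <;> simp [inner_add_left, inner_add_right]
     map_update_smul' := by
       intro _ m i c x
       fin_cases i <;> simp [inner_smul_left, inner_smul_right]
     cont := by fun_prop }, by
    intro σ x
    change ⟪x (σ 0), x (σ 1)⟫ = ⟪x 0, x 1⟫
    fin_cases σ
    · rfl
    · exact real_inner_comm _ _⟩

/-- The tensor `Q_L(x, y) = ⟨π_L x, π_L y⟩`, with `π_L` the orthogonal projection to `L`. -/
def metricTensorOf (L : Submodule ℝ (Euc n)) : SymTensor n 2 :=
  (metricTensor n).comp L.starProjection

/-! ### Polytopes, faces and normals -/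

/-- The unit sphere of `ℝⁿ`. -/
abbrev Sph (n : ℕ) : Type := Metric.sphere (0 : Euc n) 1

/-- `Σⁿ = ℝⁿ × 𝕊ⁿ⁻¹`. -/
abbrev Sig (n : ℕ) : Type := Euc n × Sph n

/-- `P` is a (convex, nonempty) polytope. -/
def IsPolytope (P : Set (Euc n)) : Prop :=
  ∃ s : Set (Euc n), s.Finite ∧ s.Nonempty ∧ P = convexHull ℝ s

/-- The set `𝒫ⁿ` of polytopes in `ℝⁿ`. -/
abbrev Polytope (n : ℕ) : Type := {P : Set (Euc n) // IsPolytope P}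

/-- The Borel sets of `Σⁿ`. -/
abbrev BorelSet (n : ℕ) : Type := {η : Set (Sig n) // MeasurableSet η}

/-- The direction space `L(F)` of `F`. -/
def dirSpace (F : Set (Euc n)) : Submodule ℝ (Euc n) := (affineSpan ℝ F).direction

/-- The set `ℱ_k(P)` of `k`-dimensional faces of `P` (the polytope `P` is a face of itself). -/
def faces (k : ℕ) (P : Set (Euc n)) : Set (Set (Euc n)) :=
  {F | F.Nonempty ∧ IsExposed ℝ P F ∧ Module.finrank ℝ (dirSpace F) = k}

/-- A polytope has only finitely many `k`-dimensional faces. -/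
theorem faces_finite (k : ℕ) {P : Set (Euc n)} (hP : IsPolytope P) : (faces k P).Finite := by
  obtain ⟨s, hs, -, rfl⟩ := hP
  have hinj : Set.InjOn (fun F : Set (Euc n) => F ∩ s) (faces k (convexHull ℝ s)) := by
    have key : ∀ F ∈ faces k (convexHull ℝ s), F = convexHull ℝ (F.extremePoints ℝ) ∧
        F.extremePoints ℝ ⊆ F ∩ s ∧ Convex ℝ F := by
      rintro F ⟨hne, hexp, -⟩
      have hcomp : IsCompact (convexHull ℝ s) := hs.isCompact_convexHull ℝ
      have hF : IsCompact F := hexp.isCompact hcomp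
      have hFc : Convex ℝ F := hexp.convex (convex_convexHull ℝ s)
      have hsub : F.extremePoints ℝ ⊆ F ∩ s := fun x hx =>
        ⟨hx.1, extremePoints_convexHull_subset (hexp.isExtreme.extremePoints_subset_extremePoints hx)⟩
      have hfin : (F.extremePoints ℝ).Finite := hs.subset (hsub.trans Set.inter_subset_right)
      refine ⟨?_, hsub, hFc⟩
      rw [← (hfin.isCompact_convexHull ℝ).isClosed.closure_eq]
      exact (closure_convexHull_extremePoints hF hFc).symm
    intro F hF G hG h
    have aux : ∀ F ∈ faces k (convexHull ℝ s), F = convexHull ℝ (F ∩ s) := by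
      intro F hF
      obtain ⟨h1, h2, h3⟩ := key F hF
      refine Set.Subset.antisymm ?_ (convexHull_min Set.inter_subset_left h3)
      exact h1.subset.trans (convexHull_mono h2)
    rw [aux F hF, aux G hG]
    exact congrArg _ h
  refine Set.Finite.of_finite_image (hs.finite_subsets.subset ?_) hinj
  rintro _ ⟨F, -, rfl⟩
  exact Set.inter_subset_right

/-- The set `ν(P, F)` of outer unit normal vectors of `P` at its face `F`. -/
def unitNormals (P F : Set (Euc n)) : Set (Sph n) :=
  {u | ∀ x ∈ F, ∀ y ∈ P, ⟪y - x, (u : Euc n)⟫ ≤ 0}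

/-- The generalized normal bundle `Nor P`: all pairs `(x, u)` of a boundary point `x` of `P` and an
outer unit normal vector `u` of `P` at `x`. -/
def normalBundle (P : Set (Euc n)) : Set (Sig n) :=
  {z | z.1 ∈ P ∧ z.1 ∈ frontier P ∧ ∀ y ∈ P, ⟪y - z.1, (z.2 : Euc n)⟫ ≤ 0}

/-! ### Tensor-valued mappings and their properties -/

/-- Mappings `Γ : 𝒫ⁿ × ℬ(Σⁿ) → 𝕋ᵖ`. -/
abbrev LocalMap (n p : ℕ) : Type := Polytope n → BorelSet n → SymTensor n p

/-- `P + t`. -/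
def Polytope.translate (P : Polytope n) (t : Euc n) : Polytope n :=
  ⟨(fun x => x + t) '' P.1, by
    obtain ⟨s, hs, hne, h⟩ := P.2
    refine ⟨(fun x => x + t) '' s, hs.image _, hne.image _, ?_⟩
    rw [h]
    exact (AffineEquiv.vaddConst ℝ t).toAffineMap.image_convexHull s⟩

/-- `η + t = {(x + t, u) : (x, u) ∈ η}`. -/
def BorelSet.translate (η : BorelSet n) (t : Euc n) : BorelSet n :=
  ⟨(fun z : Sig n => (z.1 + t, z.2)) '' η.1,
    (((Homeomorph.addRight t).prodCongr (Homeomorph.refl (Sph n))).measurableEmbedding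
      ).measurableSet_image' η.2⟩

/-- A linear isometry acting on the unit sphere. -/
def sphMap (θ : Euc n ≃ₗᵢ[ℝ] Euc n) (u : Sph n) : Sph n :=
  ⟨θ u.1, by simp⟩

/-- `ϑP`. -/
def Polytope.rotate (P : Polytope n) (θ : Euc n ≃ₗᵢ[ℝ] Euc n) : Polytope n :=
  ⟨θ '' P.1, by
    obtain ⟨s, hs, hne, h⟩ := P.2
    refine ⟨θ '' s, hs.image _, hne.image _, ?_⟩
    rw [h]
    exact (θ.toLinearEquiv : Euc n →ₗ[ℝ] Euc n).image_convexHull s⟩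

/-- `ϑη = {(ϑx, ϑu) : (x, u) ∈ η}`. -/
def BorelSet.rotate (η : BorelSet n) (θ : Euc n ≃ₗᵢ[ℝ] Euc n) : BorelSet n :=
  ⟨(fun z : Sig n => (θ z.1, sphMap θ z.2)) '' η.1, by
    let e : Sph n ≃ₜ Sph n :=
      { toFun := sphMap θ
        invFun := sphMap θ.symm
        left_inv := fun u => Subtype.ext (θ.symm_apply_apply u.1)
        right_inv := fun u => Subtype.ext (θ.apply_symm_apply u.1)
        continuous_toFun := (θ.continuous.comp continuous_subtype_val).subtype_mk _
        continuous_invFun := (θ.symm.continuous.comp continuous_subtype_val).subtype_mk _ }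
    exact ((θ.toHomeomorph.prodCongr e).measurableEmbedding).measurableSet_image' η.2⟩

/-- `(ϑT)(x₁, …, x_p) = T(ϑ⁻¹x₁, …, ϑ⁻¹x_p)`. -/
def SymTensor.rotate (T : SymTensor n p) (θ : Euc n ≃ₗᵢ[ℝ] Euc n) : SymTensor n p :=
  T.comp (θ.symm.toContinuousLinearEquiv : Euc n →L[ℝ] Euc n)

/-- `ϑ` is a proper rotation, that is, an element of `SO(n)`. -/
def IsRotation (θ : Euc n ≃ₗᵢ[ℝ] Euc n) : Prop :=
  LinearMap.det (θ.toLinearEquiv : Euc n →ₗ[ℝ] Euc n) = 1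

/-- `Γ(P, ·)` is a `𝕋ᵖ`-valued (countably additive) measure, for each polytope `P`. -/
def IsMeasureValued (Γ : LocalMap n p) : Prop :=
  ∀ P : Polytope n, ∃ μ : VectorMeasure (Sig n) (SymTensor n p),
    ∀ η : BorelSet n, Γ P η = μ η.1

/-- `Γ` is translation invariant. -/
def IsTranslationInvariant (Γ : LocalMap n p) : Prop :=
  ∀ (P : Polytope n) (η : BorelSet n) (t : Euc n), Γ (P.translate t) (η.translate t) = Γ P η

/-- `Γ` is `SO(n)` covariant. -/
def IsSOCovariant (Γ : LocalMap n p) : Prop :=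
  ∀ (P : Polytope n) (η : BorelSet n) (θ : Euc n ≃ₗᵢ[ℝ] Euc n), IsRotation θ →
    Γ (P.rotate θ) (η.rotate θ) = (Γ P η).rotate θ

/-- `Γ` is locally defined. -/
def IsLocallyDefined (Γ : LocalMap n p) : Prop :=
  ∀ (P P' : Polytope n) (η η' : BorelSet n),
    η.1 ∩ normalBundle P.1 = η'.1 ∩ normalBundle P'.1 → Γ P η = Γ P' η'

/-! ### The local tensor valuations -/

/-- `ω_d = ℋ^{d-1}(𝕊^{d-1}) = 2 π^{d/2} / Γ(d/2)`. -/
def sphereArea (d : ℕ) : ℝ := 2 * Real.pi ^ ((d : ℝ) / 2) / Real.Gamma ((d : ℝ) / 2)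

/-- The integral `∫_F ∫_{ν(P,F)} 1_η(x,u) f(x,u) ℋ^{n-k-1}(du) ℋ^k(dx)`. -/
def faceIntegral (k : ℕ) (P F : Set (Euc n)) (η : Set (Sig n))
    (f : Euc n → Euc n → SymTensor n p) : SymTensor n p :=
  ∫ x in F, ∫ u in unitNormals P F,
    η.indicator (fun z : Sig n => f z.1 z.2) (x, u) ∂μHE[n - k - 1] ∂μHE[k]

/-- The generalized local Minkowski tensors
`φ_k^{r,s,j}(P, η) = (r! s! ω_{n-k+s})⁻¹
  ∑_{F ∈ ℱ_k(P)} Q_{L(F)}^j ∫_F ∫_{ν(P,F)} 1_η(x,u) x^r u^s ℋ^{n-k-1}(du) ℋ^k(dx)`. -/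
def phi (n k r s j : ℕ) : LocalMap n (2 * j + (r + s)) := fun P η =>
  ((r.factorial : ℝ) * (s.factorial : ℝ) * sphereArea (n - k + s))⁻¹ •
    ∑ᶠ F ∈ faces k P.1, ((metricTensorOf (dirSpace F)).pow j).mul
      (faceIntegral k P.1 F η.1 (fun x u => (vecPow x r).mul (vecPow u s)))

/-- A choice of a unit vector `v_F ∈ L(F)` for an edge `F`. -/
def edgeVec (F : Set (Euc n)) : Euc n :=
  Classical.epsilon (fun v : Euc n => v ∈ dirSpace F ∧ ‖v‖ = 1)

/-- The vector product in `ℝ³`. -/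
def cross3 (v u : Euc 3) : Euc 3 := WithLp.toLp 2 (crossProduct v.ofLp u.ofLp)

/-- For `n = 3`:
`φ̃^{r,s,j}(P, η) =
  ∑_{F ∈ ℱ_1(P)} Q_{L(F)}^j v_F ∫_F ∫_{ν(P,F)} 1_η(x,u) x^r (v_F × u) u^s ℋ¹(du) ℋ¹(dx)`. -/
def phiTilde3 (r s j : ℕ) : LocalMap 3 (2 * j + 1 + (r + (1 + s))) := fun P η =>
  ∑ᶠ F ∈ faces 1 P.1,
    (((metricTensorOf (dirSpace F)).pow j).mul (vec (edgeVec F))).mul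
      (faceIntegral 1 P.1 F η.1
        (fun x u => (vecPow x r).mul ((vec (cross3 (edgeVec F) u)).mul (vecPow u s))))

/-- The vector `ū` such that `(u, ū)` is a positively oriented orthonormal basis of `ℝ²`, for a unit
vector `u`. -/
def rot2 (u : Euc 2) : Euc 2 := !₂[-u 1, u 0]

/-- For `n = 2`:
`φ̃_k^{r,s}(P, η) = ∑_{F ∈ ℱ_k(P)} ∫_F ∫_{ν(P,F)} 1_η(x,u) x^r ū u^s ℋ^{1-k}(du) ℋ^k(dx)`. -/
def phiTilde2 (k r s : ℕ) : LocalMap 2 (r + (1 + s)) := fun P η =>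
  ∑ᶠ F ∈ faces k P.1,
    faceIntegral k P.1 F η.1 (fun x u => (vecPow x r).mul ((vec (rot2 u)).mul (vecPow u s)))

/-- The mapping `Q^m Γ`, of rank `p' = 2m + p`. -/
def metricPowMul {p p' : ℕ} (m : ℕ) (h : 2 * m + p = p') (Γ : LocalMap n p) : LocalMap n p' :=
  fun P η => (((metricTensor n).pow m).mul (Γ P η)).cast h

/-- The mappings `Q^m φ_k^{0,s,j}` with `2m + 2j + s = p`, `k ∈ {0, …, n-1}`, and `j = 0` if
`k ∈ {0, n-1}`. -/
def standardMaps (n p : ℕ) : Set (LocalMap n p) :=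
  {Γ | ∃ (k m s j : ℕ) (h : 2 * m + (2 * j + (0 + s)) = p),
    k < n ∧ (k = 0 ∨ k = n - 1 → j = 0) ∧ Γ = metricPowMul m h (phi n k 0 s j)}

/-- The additional mappings: for `n = 3` the `Q^m φ̃^{0,s,j}` with `2m + 2j + s + 2 = p`, for
`n = 2` the `Q^m φ̃_k^{0,s}` with `2m + s + 1 = p` and `k ∈ {0, 1}`, and none otherwise. -/
def additionalMaps : (n p : ℕ) → Set (LocalMap n p)
  | 3, p => {Γ | ∃ (m s j : ℕ) (h : 2 * m + (2 * j + 1 + (0 + (1 + s))) = p),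
      Γ = metricPowMul m h (phiTilde3 0 s j)}
  | 2, p => {Γ | ∃ (k m s : ℕ) (h : 2 * m + (0 + (1 + s)) = p),
      k < 2 ∧ Γ = metricPowMul m h (phiTilde2 k 0 s)}
  | _, _ => ∅

end LocalTensor

end

noncomputable section

namespace LocalTensor

open MeasureTheory
open scoped RealInnerProductSpace

variable {n p q : ℕ}

/-! ### The diagonal of a symmetric tensor -/

/-! The normal bundle of a polytope `P` is the finite disjoint union of the cells `relInt F ×ˢ
unitNormals P F` over the faces `F` of dimension `k < n`. Each cell also lies in the normal bundle
of `F` itself, so locality gives `Γ(P, ·) = Γ(F, ·)` on it (`LocalMap.eq_sum_faces`). It remains to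
determine the measure `Γ(F, ·)` on `relInt F` times the unit sphere of `L(F)ᗮ`.

Evaluate `Γ(F, ·)` on the product of a relative ball about `x` and a spherical cap about `u`, both
of radius `r`. By translation invariance, covariance and locality this tensor depends only on
`(L(F), u, r)` and is carried along by rotations (`LocalMap.eval_ball_transport`). In particular it
is fixed by the stabilizer of `(L(F), u)` in `SO(n)`. Symmetric tensors are identified with their
diagonal polynomials. If `L` or `(L + ℝu)ᗮ` has dimension at least two, an invariant polynomial
depends only on the norms of the components of its argument in these spaces and on `⟪u, x⟫`, hence
is a combination of the `Q^m Q_L^j u^s`. Otherwise `n = 2`, or `n = 3` and `k = 1`, and the smaller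
stabilizer admits the additional kernels (`IsStabilizerInvariant.mem_span_kernels`). So the value is
a combination of finitely many kernels with coefficients depending only on `r` and `k`.

To let `r → 0` no differentiation of measures is used. For a measure `ν` on the bundle and the
uniform measure `m`, the integrals `V(r)⁻¹ ∫ φ(z) ν(B(z, r)) dm(z)` tend to `∫ φ dν`
(`tendsto_integral_ball_average`), where `V(r)` is the common `m`-measure of the balls. For small
`r` the approximants are combinations of the integrals of `φ` against the kernels. As functions on
the set of all faces, components and test functions, these combinations form a finite-dimensional,
hence closed, space. The limit therefore lies in it, which yields constants valid for all faces at
once (`exists_test_coefficients`), together with absolute continuity. Cutoffs near the relative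
boundary and uniqueness of measures pass from test functions to Borel sets (`exists_coefficients`),
and summing over faces gives the theorem. -/

/-- The polynomial `x ↦ T(x, …, x)`. -/
def SymTensor.diag : SymTensor n p →ₗ[ℝ] (Euc n → ℝ) where
  toFun T x := T.1 (fun _ => x)
  map_add' _ _ := rfl
  map_smul' _ _ := rfl

open SymTensor

theorem diag_apply (T : SymTensor n p) (x : Euc n) : diag T x = T.1 (fun _ => x) := rfl

/-- Polarization: the `p`-th derivative of `x ↦ T(x, …, x)` is the sum of all permutations of `T`,
which is `p! • T` by symmetry. -/
theorem diag_injective : Function.Injective (diag : SymTensor n p →ₗ[ℝ] (Euc n → ℝ)) := by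
  refine (injective_iff_map_eq_zero _).2 fun T hT => ?_
  apply Subtype.ext
  ext v
  have h := T.1.iteratedFDeriv_comp_diagonal 0 v
  have h0 : (fun x : Euc n => T.1 (fun _ => x)) = fun _ => 0 := hT
  rw [h0, iteratedFDeriv_fun_zero, Finset.sum_congr rfl (fun σ _ => T.2 σ v)] at h
  simpa [Fintype.card_perm, Nat.factorial_ne_zero] using h.symm

theorem diag_ext {S T : SymTensor n p} (h : ∀ x, diag S x = diag T x) : S = T :=
  diag_injective (funext h)

theorem isClosedEmbedding_of_injective_linearMap {E F : Type*} [AddCommGroup E] [Module ℝ E]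
    [TopologicalSpace E] [IsTopologicalAddGroup E] [ContinuousSMul ℝ E] [T2Space E]
    [FiniteDimensional ℝ E] [AddCommGroup F] [Module ℝ F] [TopologicalSpace F]
    [IsTopologicalAddGroup F] [ContinuousSMul ℝ F] [T2Space F] (f : E →ₗ[ℝ] F)
    (hf : Function.Injective f) : Topology.IsClosedEmbedding f :=
  LinearMap.isClosedEmbedding_of_injective (LinearMap.ker_eq_bot.2 hf)

theorem isClosedEmbedding_diag :
    Topology.IsClosedEmbedding (diag : SymTensor n p →ₗ[ℝ] (Euc n → ℝ)) :=
  isClosedEmbedding_of_injective_linearMap (E := SymTensor n p) (F := Euc n → ℝ) diag diag_injective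

/-- An injective linear map from a finite-dimensional space is an embedding, so continuity of a
tensor-valued map may be tested on each value of the diagonal. -/
theorem continuous_of_diag {X : Type*} [TopologicalSpace X] {f : X → SymTensor n p}
    (h : ∀ x, Continuous fun z => diag (f z) x) : Continuous f :=
  isClosedEmbedding_diag.isEmbedding.continuous_iff.2 (continuous_pi h)

theorem diag_cast (h : p = q) (T : SymTensor n p) (x : Euc n) : diag (T.cast h) x = diag T x := rfl

theorem diag_mul (a : SymTensor n p) (b : SymTensor n q) (x : Euc n) :
    diag (a.mul b) x = diag a x * diag b x := by
  have h : diag (a.mul b) x = ((p + q).factorial : ℝ)⁻¹ *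
      ∑ _σ : Equiv.Perm (Fin (p + q)), diag a x * diag b x := by
    simp only [diag_apply, SymTensor.mul, smul_apply, sum_apply, smul_eq_mul]
    rfl
  rw [h, Finset.sum_const, Finset.card_univ, Fintype.card_perm, Fintype.card_fin, nsmul_eq_mul,
    inv_mul_cancel_left₀ (Nat.cast_ne_zero.2 (Nat.factorial_ne_zero _))]

theorem diag_pow (a : SymTensor n p) (m : ℕ) (x : Euc n) : diag (a.pow m) x = diag a x ^ m := by
  induction m with
  | zero => rfl
  | succ m ih => rw [SymTensor.pow, diag_mul, ih, pow_succ]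

theorem diag_vecPow (u : Euc n) (r : ℕ) (x : Euc n) : diag (vecPow u r) x = ⟪u, x⟫ ^ r := by
  simp [diag_apply, vecPow]

theorem diag_vec (u x : Euc n) : diag (vec u) x = ⟪u, x⟫ := by
  rw [vec, diag_vecPow, pow_one]

theorem diag_metricTensor (x : Euc n) : diag (metricTensor n) x = ‖x‖ ^ 2 :=
  real_inner_self_eq_norm_sq x

theorem diag_metricTensorOf (L : Submodule ℝ (Euc n)) (x : Euc n) :
    diag (metricTensorOf L) x = ‖L.starProjection x‖ ^ 2 :=
  diag_metricTensor (L.starProjection x)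

theorem diag_rotate (T : SymTensor n p) (θ : Euc n ≃ₗᵢ[ℝ] Euc n) (x : Euc n) :
    diag (T.rotate θ) x = diag T (θ.symm x) := rfl

/-- Evaluation of the diagonal as a continuous linear functional. -/
def diagCLM (x : Euc n) : SymTensor n p →L[ℝ] ℝ where
  toFun T := diag T x
  map_add' _ _ := rfl
  map_smul' _ _ := rfl
  cont := (continuous_apply x).comp isClosedEmbedding_diag.continuous

/-! ### Reflections and rotations -/

/-- The reflection in the hyperplane orthogonal to `w`. -/
def mirror (w : Euc n) : Euc n ≃ₗᵢ[ℝ] Euc n := (ℝ ∙ w)ᗮ.reflection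

theorem mirror_eq_self {w x : Euc n} (h : ⟪w, x⟫ = 0) : mirror w x = x :=
  Submodule.reflection_mem_subspace_eq_self (Submodule.mem_orthogonal_singleton_iff_inner_right.2 h)

theorem mirror_apply (w x : Euc n) : mirror w x = x - (2 * (⟪w, x⟫ / ‖w‖ ^ 2)) • w := by
  rw [mirror, Submodule.reflection_orthogonal_apply, Submodule.reflection_singleton_apply]
  simp only [RCLike.ofReal_real_eq_id, id, two_smul, mul_smul, neg_sub]

theorem mirror_sub {v w : Euc n} (h : ‖v‖ = ‖w‖) : mirror (v - w) v = w :=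
  Submodule.reflection_sub h

theorem mirror_self (w : Euc n) : mirror w w = -w :=
  Submodule.reflection_orthogonalComplement_singleton_eq_neg w

theorem mirror_mem {L : Submodule ℝ (Euc n)} {w x : Euc n} (hw : w ∈ L) (hx : x ∈ L) :
    mirror w x ∈ L := by
  rw [mirror_apply]
  exact L.sub_mem hx (L.smul_mem _ hw)

theorem mirror_mem_of_orthogonal {L : Submodule ℝ (Euc n)} {w x : Euc n} (hw : w ∈ Lᗮ)
    (hx : x ∈ L) : mirror w x ∈ L := by
  rwa [mirror_eq_self (Submodule.inner_left_of_mem_orthogonal hx hw)]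

theorem mirror_det {w : Euc n} (hw : w ≠ 0) :
    LinearMap.det ((mirror w).toLinearEquiv : Euc n →ₗ[ℝ] Euc n) = -1 := by
  have h := (ℝ ∙ w)ᗮ.det_reflection
  rw [Submodule.orthogonal_orthogonal, finrank_span_singleton hw, pow_one] at h
  exact h

theorem det_trans (θ φ : Euc n ≃ₗᵢ[ℝ] Euc n) :
    LinearMap.det ((θ.trans φ).toLinearEquiv : Euc n →ₗ[ℝ] Euc n) =
      LinearMap.det (φ.toLinearEquiv : Euc n →ₗ[ℝ] Euc n) *
        LinearMap.det (θ.toLinearEquiv : Euc n →ₗ[ℝ] Euc n) := by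
  rw [← LinearMap.det_comp]
  rfl

theorem det_isometry (θ : Euc n ≃ₗᵢ[ℝ] Euc n) :
    LinearMap.det (θ.toLinearEquiv : Euc n →ₗ[ℝ] Euc n) = 1 ∨
      LinearMap.det (θ.toLinearEquiv : Euc n →ₗ[ℝ] Euc n) = -1 := by
  have h := LinearMap.normDet_eq_abs_det (θ.toLinearEquiv : Euc n →ₗ[ℝ] Euc n)
  have h1 : (θ.toLinearEquiv : Euc n →ₗ[ℝ] Euc n).normDet = 1 :=
    LinearIsometry.normDet_eq_one θ.toLinearIsometry
  rw [h1] at h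
  exact eq_or_eq_neg_of_abs_eq h.symm

/-- A reflection flips the determinant. Choosing `w` so that its mirror respects the data at hand
turns statements about isometries into statements about rotations. -/
theorem isRotation_or_mirror (θ : Euc n ≃ₗᵢ[ℝ] Euc n) {w : Euc n} (hw : w ≠ 0) :
    IsRotation θ ∨ IsRotation (θ.trans (mirror w)) := by
  rcases det_isometry θ with h | h
  · exact Or.inl h
  · refine Or.inr ?_
    rw [IsRotation, det_trans, mirror_det hw, h]
    norm_num

theorem map_eq_of_mem {L L' : Submodule ℝ (Euc n)}
    (h : Module.finrank ℝ L = Module.finrank ℝ L') (θ : Euc n ≃ₗᵢ[ℝ] Euc n)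
    (hθ : ∀ x ∈ L, θ x ∈ L') : L.map (θ.toLinearEquiv : Euc n →ₗ[ℝ] Euc n) = L' := by
  refine Submodule.eq_of_le_of_finrank_eq ?_ ?_
  · rintro _ ⟨x, hx, rfl⟩
    exact hθ x hx
  · rw [← h]
    exact LinearEquiv.finrank_map_eq θ.toLinearEquiv L

theorem exists_ne_zero_of_finrank_pos {L : Submodule ℝ (Euc n)} (h : 0 < Module.finrank ℝ L) :
    ∃ w ∈ L, w ≠ 0 :=
  L.ne_bot_iff.1 fun h' => by rw [h', finrank_bot] at h; exact h.false

theorem exists_isometry {L L' : Submodule ℝ (Euc n)}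
    (h : Module.finrank ℝ L = Module.finrank ℝ L') :
    ∃ θ : Euc n ≃ₗᵢ[ℝ] Euc n, ∀ x ∈ L, θ x ∈ L' := by
  let e : L ≃ₗᵢ[ℝ] L' :=
    (stdOrthonormalBasis ℝ L).equiv (stdOrthonormalBasis ℝ L') (finCongr h)
  let f : L →ₗᵢ[ℝ] Euc n := L'.subtypeₗᵢ.comp e.toLinearIsometry
  refine ⟨f.extend.toLinearIsometryEquiv rfl, fun x hx => ?_⟩
  have : f.extend x = f ⟨x, hx⟩ := f.extend_apply ⟨x, hx⟩
  change f.extend x ∈ L'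
  rw [this]
  exact (e ⟨x, hx⟩).2

/-- The orthogonal complement of `L` and `u` is nonzero unless `L` is a hyperplane. -/
theorem exists_orthogonal_ne_zero {L : Submodule ℝ (Euc n)} {u : Euc n}
    (h : Module.finrank ℝ L + 1 < n) : ∃ w ∈ Lᗮ, ⟪w, u⟫ = 0 ∧ w ≠ 0 := by
  have hpos : 0 < Module.finrank ℝ (L ⊔ ℝ ∙ u : Submodule ℝ (Euc n))ᗮ := by
    have h1 := (L ⊔ ℝ ∙ u : Submodule ℝ (Euc n)).finrank_add_finrank_orthogonal
    have h2 := Submodule.finrank_add_le_finrank_add_finrank L (ℝ ∙ u)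
    have h3 : Module.finrank ℝ (ℝ ∙ u) ≤ 1 := by
      simpa using finrank_span_le_card (R := ℝ) ({u} : Set (Euc n))
    rw [finrank_euclideanSpace_fin] at h1
    omega
  obtain ⟨w, hw, hw0⟩ := exists_ne_zero_of_finrank_pos hpos
  rw [← Submodule.inf_orthogonal] at hw
  exact ⟨w, hw.1, Submodule.mem_orthogonal_singleton_iff_inner_left.1 hw.2, hw0⟩

/-- Transitivity of `SO(n)` on pairs of a subspace and a unit normal. An isometry takes `L` to `L'`,
a reflection along a vector of `L'ᗮ` then moves the image of `u` to `u'` without disturbing `L'`,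
and a last mirror corrects the determinant if needed. -/
theorem exists_rotation (hn : 2 ≤ n) {L L' : Submodule ℝ (Euc n)}
    (hk : Module.finrank ℝ L < n) (h : Module.finrank ℝ L = Module.finrank ℝ L') {u u' : Euc n}
    (hu : u ∈ Lᗮ) (hu' : u' ∈ L'ᗮ) (hun : ‖u‖ = 1) (hun' : ‖u'‖ = 1) :
    ∃ θ : Euc n ≃ₗᵢ[ℝ] Euc n, IsRotation θ ∧
      L.map (θ.toLinearEquiv : Euc n →ₗ[ℝ] Euc n) = L' ∧ θ u = u' := by
  obtain ⟨θ₁, h₁⟩ := exists_isometry h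
  have hperp : θ₁ u ∈ L'ᗮ := by
    intro y hy
    rw [← map_eq_of_mem h θ₁ h₁] at hy
    obtain ⟨x, hx, rfl⟩ := hy
    exact (θ₁.inner_map_map x u).trans (hu x hx)
  obtain ⟨θ₂, hθ₂⟩ : ∃ θ₂, θ₂ = θ₁.trans (mirror (θ₁ u - u')) := ⟨_, rfl⟩
  have h₂ : ∀ x ∈ L, θ₂ x ∈ L' := fun x hx => by
    rw [hθ₂, LinearIsometryEquiv.trans_apply]
    exact mirror_mem_of_orthogonal (L'ᗮ.sub_mem hperp hu') (h₁ x hx)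
  have h₂u : θ₂ u = u' := by
    rw [hθ₂, LinearIsometryEquiv.trans_apply]
    exact mirror_sub (by rw [θ₁.norm_map, hun, hun'])
  -- A mirror that fixes `u'` and preserves `L'`: take `w` in `L'` if possible. If `L' = 0`, the
  -- bound `2 ≤ n` leaves room for some `w` orthogonal to `u'`.
  have key : ∃ w : Euc n, w ≠ 0 ∧ ⟪w, u'⟫ = 0 ∧ ∀ x ∈ L', mirror w x ∈ L' := by
    by_cases h0 : 0 < Module.finrank ℝ L'
    · obtain ⟨w, hw, hw0⟩ := exists_ne_zero_of_finrank_pos h0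
      exact ⟨w, hw0, hu' w hw, fun x hx => mirror_mem hw hx⟩
    · obtain ⟨w, hw, hwu, hw0⟩ := exists_orthogonal_ne_zero (L := L') (u := u') (by omega)
      exact ⟨w, hw0, hwu, fun x hx => mirror_mem_of_orthogonal hw hx⟩
  obtain ⟨w, hw0, hwu, hwL⟩ := key
  rcases isRotation_or_mirror θ₂ hw0 with hr | hr
  · exact ⟨θ₂, hr, map_eq_of_mem h _ h₂, h₂u⟩
  · refine ⟨_, hr, map_eq_of_mem h _ fun x hx => ?_, ?_⟩
    · rw [LinearIsometryEquiv.trans_apply]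
      exact hwL _ (h₂ x hx)
    rw [LinearIsometryEquiv.trans_apply, h₂u, mirror_eq_self hwu]

/-! ### Kernels -/

/-- The kernel `Q^m Q_L^j u^s`. -/
def stdKernel (m j s : ℕ) (h : 2 * m + (2 * j + (0 + s)) = p) (L : Submodule ℝ (Euc n))
    (u : Euc n) : SymTensor n p :=
  (((metricTensor n).pow m).mul
    -- The scalar `vecPow 0 0` stands for the factor `x ^ 0` in `phi`, so that the ranks have the
    -- same form.
    (((metricTensorOf L).pow j).mul ((vecPow 0 0).mul (vecPow u s)))).cast h

/-- A choice of a unit vector in `L`. -/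
def unitVec (L : Submodule ℝ (Euc n)) : Euc n :=
  Classical.epsilon (fun v : Euc n => v ∈ L ∧ ‖v‖ = 1)

/-- The kernel `Q^m Q_L^j v (v × u) u^s` with `v` a unit vector of `L`. -/
def edgeKernel (m j s : ℕ) (h : 2 * m + (2 * j + 1 + (0 + (1 + s))) = p)
    (L : Submodule ℝ (Euc 3)) (u : Euc 3) : SymTensor 3 p :=
  (((metricTensor 3).pow m).mul ((((metricTensorOf L).pow j).mul (vec (unitVec L))).mul
    ((vecPow 0 0).mul ((vec (cross3 (unitVec L) u)).mul (vecPow u s))))).cast h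

/-- The kernel `Q^m ū u^s`. -/
def planeKernel (m s : ℕ) (h : 2 * m + (0 + (1 + s)) = p) (_ : Submodule ℝ (Euc 2))
    (u : Euc 2) : SymTensor 2 p :=
  (((metricTensor 2).pow m).mul
    ((vecPow 0 0).mul ((vec (rot2 u)).mul (vecPow u s)))).cast h

open SymTensor

theorem diag_stdKernel (m j s : ℕ) (h : 2 * m + (2 * j + (0 + s)) = p)
    (L : Submodule ℝ (Euc n)) (u x : Euc n) :
    diag (stdKernel m j s h L u) x =
      (‖x‖ ^ 2) ^ m * (‖L.starProjection x‖ ^ 2) ^ j * ⟪u, x⟫ ^ s := by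
  simp only [stdKernel, diag_cast, diag_mul, diag_pow, diag_vecPow, diag_metricTensor,
    diag_metricTensorOf, pow_zero, one_mul, mul_assoc]

theorem diag_edgeKernel (m j s : ℕ) (h : 2 * m + (2 * j + 1 + (0 + (1 + s))) = p)
    (L : Submodule ℝ (Euc 3)) (u x : Euc 3) :
    diag (edgeKernel m j s h L u) x =
      (⟪unitVec L, x⟫ * ⟪cross3 (unitVec L) u, x⟫) *
        ((‖x‖ ^ 2) ^ m * (‖L.starProjection x‖ ^ 2) ^ j * ⟪u, x⟫ ^ s) := by
  simp only [edgeKernel, diag_cast, diag_mul, diag_pow, diag_vecPow, diag_metricTensor,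
    diag_metricTensorOf, diag_vec, pow_zero, one_mul]
  ring

theorem diag_planeKernel (m s : ℕ) (h : 2 * m + (0 + (1 + s)) = p)
    (L : Submodule ℝ (Euc 2)) (u x : Euc 2) :
    diag (planeKernel m s h L u) x =
      ⟪rot2 u, x⟫ * ((‖x‖ ^ 2) ^ m * ⟪u, x⟫ ^ s) := by
  simp only [planeKernel, diag_cast, diag_mul, diag_pow, diag_vecPow, diag_metricTensor,
    diag_vec, pow_zero, one_mul]
  ring

/-- The kernels of the standard mappings supported by `k`-faces. -/
def stdKernels (n p k : ℕ) : Set (Submodule ℝ (Euc n) → Euc n → SymTensor n p) :=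
  {E | ∃ (m j s : ℕ) (h : 2 * m + (2 * j + (0 + s)) = p),
    (k = 0 ∨ k = n - 1 → j = 0) ∧ E = stdKernel m j s h}

/-- The kernels of the additional mappings supported by `k`-faces. -/
def addKernels : (n p _k : ℕ) → Set (Submodule ℝ (Euc n) → Euc n → SymTensor n p)
  | 3, p, k => {E | k = 1 ∧ ∃ (m j s : ℕ) (h : 2 * m + (2 * j + 1 + (0 + (1 + s))) = p),
      E = edgeKernel m j s h}
  | 2, p, _ => {E | ∃ (m s : ℕ) (h : 2 * m + (0 + (1 + s)) = p), E = planeKernel m s h}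
  | _, _, _ => ∅

/-- The kernels of all mappings supported by `k`-faces. -/
def kernels (n p k : ℕ) : Set (Submodule ℝ (Euc n) → Euc n → SymTensor n p) :=
  stdKernels n p k ∪ addKernels n p k

/-- The property `C` is quantified over the dimension, so that a statement about general `n` can be
specialized to `n = 3` and `n = 2`. -/
theorem addKernels_cases {n p k : ℕ} {C : ∀ n : ℕ, (Submodule ℝ (Euc n) → Euc n → SymTensor n p) →
      Prop} {E : Submodule ℝ (Euc n) → Euc n → SymTensor n p} (hE : E ∈ addKernels n p k)
    (h3 : k = 1 → ∀ m j s h, C 3 (edgeKernel m j s h))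
    (h2 : ∀ m s h, C 2 (planeKernel m s h)) : C n E := by
  match n, E, hE with
  | 0, _, hE => exact hE.elim
  | 1, _, hE => exact hE.elim
  | 2, _, hE =>
    obtain ⟨m, s, h, rfl⟩ := hE
    exact h2 m s h
  | 3, _, hE =>
    obtain ⟨hk, m, j, s, h, rfl⟩ := hE
    exact h3 hk m j s h
  | _ + 4, _, hE => exact hE.elim

theorem kernels_finite (n p k : ℕ) : (kernels n p k).Finite := by
  -- For fixed exponents the only remaining parameter is the proof of the rank identity, so at most
  -- one kernel arises.
  have hsub : ∀ {X : Type} {q q' : ℕ} (f : q = q' → X), {E | ∃ h : q = q', E = f h}.Finite := by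
    intro X q q' f
    refine Set.Subsingleton.finite ?_
    rintro _ ⟨_, rfl⟩ _ ⟨_, rfl⟩
    rfl
  refine Set.Finite.union ?_ ?_
  · refine Set.Finite.subset (Set.Finite.biUnion (Set.finite_Iic p) fun m _ =>
      Set.Finite.biUnion (Set.finite_Iic p) fun j _ =>
      Set.Finite.biUnion (Set.finite_Iic p) fun s _ => hsub (stdKernel (n := n) (p := p) m j s)) ?_
    rintro E ⟨m, j, s, h, -, rfl⟩
    simp only [Set.mem_iUnion, Set.mem_Iic]
    exact ⟨m, by omega, j, by omega, s, by omega, h, rfl⟩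
  · match n with
    | 0 => exact Set.finite_empty
    | 1 => exact Set.finite_empty
    | 2 =>
      refine Set.Finite.subset (Set.Finite.biUnion (Set.finite_Iic p) fun m _ =>
        Set.Finite.biUnion (Set.finite_Iic p) fun s _ => hsub (planeKernel (p := p) m s)) ?_
      rintro E ⟨m, s, h, rfl⟩
      simp only [Set.mem_iUnion, Set.mem_Iic]
      exact ⟨m, by omega, s, by omega, h, rfl⟩
    | 3 =>
      refine Set.Finite.subset (Set.Finite.biUnion (Set.finite_Iic p) fun m _ =>
        Set.Finite.biUnion (Set.finite_Iic p) fun j _ =>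
        Set.Finite.biUnion (Set.finite_Iic p) fun s _ => hsub (edgeKernel (p := p) m j s)) ?_
      rintro E ⟨-, m, j, s, h, rfl⟩
      simp only [Set.mem_iUnion, Set.mem_Iic]
      exact ⟨m, by omega, j, by omega, s, by omega, h, rfl⟩
    | _ + 4 => exact Set.finite_empty

/-! ### Continuity and rotation equivariance of the kernels -/

theorem inner_rot2 (u x : Euc 2) : ⟪rot2 u, x⟫ = u 0 * x 1 - u 1 * x 0 := by
  simp [rot2, PiLp.inner_apply, Fin.sum_univ_two]
  ring

theorem inner_cross3 (v u x : Euc 3) : ⟪cross3 v u, x⟫ =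
    (v 1 * u 2 - v 2 * u 1) * x 0 + (v 2 * u 0 - v 0 * u 2) * x 1 +
      (v 0 * u 1 - v 1 * u 0) * x 2 := by
  simp [cross3, crossProduct, PiLp.inner_apply, Fin.sum_univ_three]
  ring

theorem kernels_continuous {n p k : ℕ} {E : Submodule ℝ (Euc n) → Euc n → SymTensor n p}
    (hE : E ∈ kernels n p k) (L : Submodule ℝ (Euc n)) : Continuous (E L) := by
  rcases hE with ⟨m, j, s, h, -, rfl⟩ | hE
  · refine continuous_of_diag fun x => ?_
    simp only [diag_stdKernel]
    fun_prop
  · refine addKernels_cases (C := fun n E => ∀ L, Continuous (E L)) hE ?_ ?_ L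
    · refine fun _ m j s h L => continuous_of_diag fun x => ?_
      simp only [diag_edgeKernel, inner_cross3]
      fun_prop
    · refine fun m s h L => continuous_of_diag fun x => ?_
      simp only [diag_planeKernel, inner_rot2]
      fun_prop

/-- The pairing is the determinant of `(u, x)`, which a map of determinant one preserves. -/
theorem inner_rot2_rotate {θ : Euc 2 ≃ₗᵢ[ℝ] Euc 2} (hθ : IsRotation θ) (u x : Euc 2) :
    ⟪rot2 (θ u), θ x⟫ = ⟪rot2 u, x⟫ := by
  let b := (EuclideanSpace.basisFun (Fin 2) ℝ).toBasis
  have key : ∀ v w : Euc 2, b.det ![v, w] = ⟪rot2 v, w⟫ := by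
    intro v w
    rw [inner_rot2, Module.Basis.det_apply, Matrix.det_fin_two]
    simp [b, Module.Basis.toMatrix_apply]
    ring
  rw [← key, ← key]
  have h := b.det_comp (θ.toLinearEquiv : Euc 2 →ₗ[ℝ] Euc 2) ![u, x]
  rw [show LinearMap.det (θ.toLinearEquiv : Euc 2 →ₗ[ℝ] Euc 2) = 1 from hθ, one_mul] at h
  rw [← h]
  congr 1
  ext i
  fin_cases i <;> rfl

/-- The pairing is the determinant of `(v, u, x)`. -/
theorem inner_cross3_rotate {θ : Euc 3 ≃ₗᵢ[ℝ] Euc 3} (hθ : IsRotation θ) (v u x : Euc 3) :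
    ⟪cross3 (θ v) (θ u), θ x⟫ = ⟪cross3 v u, x⟫ := by
  let b := (EuclideanSpace.basisFun (Fin 3) ℝ).toBasis
  have key : ∀ v u w : Euc 3, b.det ![v, u, w] = ⟪cross3 v u, w⟫ := by
    intro v u w
    rw [inner_cross3, Module.Basis.det_apply, Matrix.det_fin_three]
    simp [b, Module.Basis.toMatrix_apply]
    ring
  rw [← key, ← key]
  have h := b.det_comp (θ.toLinearEquiv : Euc 3 →ₗ[ℝ] Euc 3) ![v, u, x]
  rw [show LinearMap.det (θ.toLinearEquiv : Euc 3 →ₗ[ℝ] Euc 3) = 1 from hθ, one_mul] at h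
  rw [← h]
  congr 1
  ext i
  fin_cases i <;> rfl

theorem norm_starProjection_map (L : Submodule ℝ (Euc n)) (θ : Euc n ≃ₗᵢ[ℝ] Euc n) (x : Euc n) :
    ‖(L.map (θ.toLinearEquiv : Euc n →ₗ[ℝ] Euc n)).starProjection x‖ =
      ‖L.starProjection (θ.symm x)‖ := by
  have h := Submodule.starProjection_map_apply θ L x
  exact (congrArg norm h).trans (θ.norm_map _)

theorem unitVec_spec {L : Submodule ℝ (Euc n)} (h : 0 < Module.finrank ℝ L) :
    unitVec L ∈ L ∧ ‖unitVec L‖ = 1 := by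
  refine Classical.epsilon_spec (p := fun v : Euc n => v ∈ L ∧ ‖v‖ = 1) ?_
  obtain ⟨w, hw, hw0⟩ := exists_ne_zero_of_finrank_pos h
  exact ⟨‖w‖⁻¹ • w, L.smul_mem _ hw, norm_smul_inv_norm (𝕜 := ℝ) hw0⟩

/-- In a line, every vector is its component along a unit vector. -/
theorem eq_inner_smul_of_finrank_eq_one {L : Submodule ℝ (Euc n)}
    (h : Module.finrank ℝ L = 1) {v x : Euc n} (hv : v ∈ L) (hv1 : ‖v‖ = 1) (hx : x ∈ L) :
    x = ⟪v, x⟫ • v := by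
  have hv0 : (⟨v, hv⟩ : L) ≠ 0 := by
    intro h0
    rw [show v = 0 from congrArg Subtype.val h0, norm_zero] at hv1
    exact zero_ne_one hv1
  obtain ⟨c, hc⟩ := (finrank_eq_one_iff_of_nonzero' _ hv0).1 h ⟨x, hx⟩
  have hc' : c • v = x := congrArg Subtype.val hc
  rw [← hc', inner_smul_right, real_inner_self_eq_norm_sq, hv1]
  simp

/-- The choice of `unitVec` is arbitrary, so it can be equivariant only up to sign. -/
theorem unitVec_map {L : Submodule ℝ (Euc n)} (h : Module.finrank ℝ L = 1)
    (θ : Euc n ≃ₗᵢ[ℝ] Euc n) :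
    unitVec (L.map (θ.toLinearEquiv : Euc n →ₗ[ℝ] Euc n)) = θ (unitVec L) ∨
      unitVec (L.map (θ.toLinearEquiv : Euc n →ₗ[ℝ] Euc n)) = -θ (unitVec L) := by
  obtain ⟨h1, h2⟩ := unitVec_spec (L := L) (by omega)
  have hf : Module.finrank ℝ (L.map (θ.toLinearEquiv : Euc n →ₗ[ℝ] Euc n)) = 1 :=
    (LinearEquiv.finrank_map_eq θ.toLinearEquiv L).trans h
  obtain ⟨h3, h4⟩ := unitVec_spec (L := L.map (θ.toLinearEquiv : Euc n →ₗ[ℝ] Euc n)) (by omega)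
  have h5 : ‖θ (unitVec L)‖ = 1 := by rw [θ.norm_map, h2]
  have h6 := eq_inner_smul_of_finrank_eq_one hf (v := θ (unitVec L)) ⟨_, h1, rfl⟩ h5 h3
  generalize ⟪θ (unitVec L), unitVec (L.map (θ.toLinearEquiv : Euc n →ₗ[ℝ] Euc n))⟫ = c at h6
  have h7 : |c| = 1 := by
    rw [h6, norm_smul, h5, mul_one] at h4
    exact h4
  rcases eq_or_eq_neg_of_abs_eq h7 with rfl | rfl
  · exact Or.inl (by simpa using h6)
  · exact Or.inr (by simpa using h6)

theorem kernels_equivariant {n p k : ℕ} {E : Submodule ℝ (Euc n) → Euc n → SymTensor n p}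
    (hE : E ∈ kernels n p k) {L : Submodule ℝ (Euc n)} (hL : Module.finrank ℝ L = k) (u : Euc n)
    {θ : Euc n ≃ₗᵢ[ℝ] Euc n} (hθ : IsRotation θ) :
    E (L.map (θ.toLinearEquiv : Euc n →ₗ[ℝ] Euc n)) (θ u) = (E L u).rotate θ := by
  have hin : ∀ {n : ℕ} (θ : Euc n ≃ₗᵢ[ℝ] Euc n) (u x : Euc n), ⟪θ u, x⟫ = ⟪u, θ.symm x⟫ := by
    intro n θ u x
    rw [← θ.inner_map_map u, θ.apply_symm_apply]
  rcases hE with ⟨m, j, s, h, -, rfl⟩ | hE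
  · refine diag_ext fun x => ?_
    rw [diag_rotate, diag_stdKernel, diag_stdKernel, norm_starProjection_map, hin,
      θ.symm.norm_map]
  · refine addKernels_cases (C := fun n E => ∀ (L : Submodule ℝ (Euc n)) (u : Euc n)
      (θ : Euc n ≃ₗᵢ[ℝ] Euc n), Module.finrank ℝ L = k → IsRotation θ →
      E (L.map (θ.toLinearEquiv : Euc n →ₗ[ℝ] Euc n)) (θ u) = (E L u).rotate θ)
      hE ?_ ?_ L u θ hL hθ
    · intro hk m j s h L u θ hL hθ
      refine diag_ext fun x => ?_
      obtain ⟨y, rfl⟩ := θ.surjective x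
      rw [diag_rotate, diag_edgeKernel, diag_edgeKernel, norm_starProjection_map, hin θ u,
        θ.norm_map, θ.symm_apply_apply]
      congr 1
      -- The unit vector enters the edge kernel twice, so its sign cancels.
      rcases unitVec_map (hL.trans hk) θ with h' | h'
      · rw [h', inner_cross3_rotate hθ, θ.inner_map_map]
      · rw [h', ← map_neg θ, inner_cross3_rotate hθ, θ.inner_map_map]
        simp only [inner_cross3, inner_neg_left, PiLp.neg_apply]
        ring
    · intro m s h L u θ _ hθ
      refine diag_ext fun x => ?_
      obtain ⟨y, rfl⟩ := θ.surjective x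
      rw [diag_rotate, diag_planeKernel, diag_planeKernel, hin θ u, θ.symm_apply_apply,
        θ.norm_map, inner_rot2_rotate hθ]

/-! ### Tensors invariant under the stabilizer of a subspace and a normal vector -/

open SymTensor

/-- The span of the monomials `A^m B^j t^s` of weight `2 * m + 2 * j + s = q`. -/
def monSpan (A B t : Euc n → ℝ) (q : ℕ) : Submodule ℝ (Euc n → ℝ) :=
  Submodule.span ℝ {f | ∃ m j s, 2 * m + 2 * j + s = q ∧ f = A ^ m * B ^ j * t ^ s}

/-- With `A`, `B`, `t` the squared norm, the squared norm of the projection to `L` and the product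
with `u`, the difference `A - B - t ^ 2` is the squared norm of the third component. Expanding its
powers removes that component. -/
theorem mul_sub_pow_mem_monSpan (A B t : Euc n → ℝ) {q : ℕ} (j : ℕ) {m i l : ℕ}
    (h : 2 * m + 2 * i + 2 * j + l = q) :
    A ^ m * B ^ i * (A - B - t ^ 2) ^ j * t ^ l ∈ monSpan A B t q := by
  induction j generalizing m i l with
  | zero => exact Submodule.subset_span ⟨m, i, l, by omega, by rw [pow_zero, mul_one]⟩
  | succ j ih =>
    have h1 := ih (m := m + 1) (i := i) (l := l) (by omega)
    have h2 := ih (m := m) (i := i + 1) (l := l) (by omega)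
    have h3 := ih (m := m) (i := i) (l := l + 2) (by omega)
    convert Submodule.sub_mem _ (Submodule.sub_mem _ h1 h2) h3 using 1
    ring

theorem exists_prod_eq_monomial {p : ℕ} (ρ : Fin p → Fin 3) :
    ∃ e : ℕ × ℕ × ℕ, e.1 + e.2.1 + e.2.2 = p ∧
      ∀ c : Fin 3 → ℝ, ∏ k, c (ρ k) = c 0 ^ e.1 * c 1 ^ e.2.1 * c 2 ^ e.2.2 := by
  induction p with
  | zero => exact ⟨(0, 0, 0), rfl, fun c => by simp⟩
  | succ p ih =>
    obtain ⟨⟨a, b, l⟩, h, he⟩ := ih (fun k => ρ k.succ)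
    simp only at h he
    simp only [Fin.prod_univ_succ, he]
    generalize ρ 0 = i
    fin_cases i
    · exact ⟨(a + 1, b, l), by simp only; omega, fun c => by simp [pow_succ]; ring⟩
    · exact ⟨(a, b + 1, l), by simp only; omega, fun c => by simp [pow_succ]; ring⟩
    · exact ⟨(a, b, l + 1), by simp only; omega, fun c => by simp [pow_succ]; ring⟩

/-- The diagonal of a symmetric tensor, restricted to a span of three vectors, is a homogeneous
polynomial in the coefficients. -/
theorem exists_diag_expansion (T : SymTensor n p) (y₀ y₁ y₂ : Euc n) :
    ∃ (C : (Fin p → Fin 3) → ℝ) (e : (Fin p → Fin 3) → ℕ × ℕ × ℕ),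
      (∀ ρ, (e ρ).1 + (e ρ).2.1 + (e ρ).2.2 = p) ∧
      ∀ a b c : ℝ, diag T (a • y₀ + b • y₁ + c • y₂) =
        ∑ ρ, C ρ * (a ^ (e ρ).1 * b ^ (e ρ).2.1 * c ^ (e ρ).2.2) := by
  choose e he he' using fun ρ : Fin p → Fin 3 => exists_prod_eq_monomial ρ
  refine ⟨fun ρ => T.1 (fun k => ![y₀, y₁, y₂] (ρ k)), e, he, fun a b c => ?_⟩
  have h : a • y₀ + b • y₁ + c • y₂ = ∑ i, ![a, b, c] i • ![y₀, y₁, y₂] i := by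
    rw [Fin.sum_univ_three]
    rfl
  rw [diag_apply, h, T.1.map_sum (fun _ i => ![a, b, c] i • ![y₀, y₁, y₂] i)]
  refine Finset.sum_congr rfl fun ρ _ => ?_
  rw [T.1.map_smul_univ (fun k => ![a, b, c] (ρ k)) (fun k => ![y₀, y₁, y₂] (ρ k)), he' ρ,
    smul_eq_mul, mul_comm]
  rfl

/-- `T` is invariant under the rotations that fix `L` and `u`. -/
def IsStabilizerInvariant (L : Submodule ℝ (Euc n)) (u : Euc n) (T : SymTensor n p) : Prop :=
  ∀ θ : Euc n ≃ₗᵢ[ℝ] Euc n, IsRotation θ →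
    L.map (θ.toLinearEquiv : Euc n →ₗ[ℝ] Euc n) = L → θ u = u → T.rotate θ = T

theorem IsStabilizerInvariant.diag_eq {L : Submodule ℝ (Euc n)} {u : Euc n} {T : SymTensor n p}
    (hT : IsStabilizerInvariant L u T) {θ : Euc n ≃ₗᵢ[ℝ] Euc n} (hθ : IsRotation θ)
    (hL : ∀ x ∈ L, θ x ∈ L) (hu : θ u = u) (x : Euc n) : diag T (θ x) = diag T x := by
  conv_lhs => rw [← hT θ hθ (map_eq_of_mem rfl θ hL) hu]
  rw [diag_rotate, θ.symm_apply_apply]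

/-- The orthogonal complement of `L` and `u`. -/
def perp (L : Submodule ℝ (Euc n)) (u : Euc n) : Submodule ℝ (Euc n) := Lᗮ ⊓ (ℝ ∙ u)ᗮ

theorem mem_perp {L : Submodule ℝ (Euc n)} {u x : Euc n} :
    x ∈ perp L u ↔ x ∈ Lᗮ ∧ ⟪x, u⟫ = 0 := by
  rw [perp, Submodule.mem_inf, Submodule.mem_orthogonal_singleton_iff_inner_left]

theorem finrank_perp {L : Submodule ℝ (Euc n)} {u : Euc n} (hu : u ∈ Lᗮ) (hu1 : ‖u‖ = 1) :
    Module.finrank ℝ L + 1 + Module.finrank ℝ (perp L u) = n := by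
  have hu0 : u ≠ 0 := by
    rintro rfl
    simp at hu1
  have h1 := (L ⊔ ℝ ∙ u : Submodule ℝ (Euc n)).finrank_add_finrank_orthogonal
  have h2 := Submodule.finrank_sup_add_finrank_inf_eq L (ℝ ∙ u)
  have h3 : L ⊓ ℝ ∙ u = ⊥ := by
    refine (Submodule.isOrtho_iff_le.2 ?_).disjoint.eq_bot
    intro x hx
    rw [Submodule.mem_orthogonal_singleton_iff_inner_right]
    exact Submodule.inner_left_of_mem_orthogonal hx hu
  rw [h3, finrank_bot, finrank_span_singleton hu0] at h2
  rw [finrank_euclideanSpace_fin, ← Submodule.inf_orthogonal] at h1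
  rw [perp]
  omega

theorem exists_orthogonal_mem {N : Submodule ℝ (Euc n)} (hN : 2 ≤ Module.finrank ℝ N)
    (y : Euc n) : ∃ w ∈ N, w ≠ 0 ∧ ⟪w, y⟫ = 0 := by
  let f : N →ₗ[ℝ] ℝ := (innerₛₗ ℝ y).comp N.subtype
  have hf : LinearMap.ker f ≠ ⊥ := LinearMap.ker_ne_bot_of_finrank_lt (by
    rw [Module.finrank_self]; omega)
  obtain ⟨w, hw, hw0⟩ := (Submodule.ne_bot_iff _).1 hf
  refine ⟨w, w.2, fun h => hw0 (Subtype.ext h), ?_⟩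
  rw [real_inner_comm]
  exact hw

/-- A space of dimension at least two contains some `w ≠ 0` orthogonal to `θ x`. The mirror of `w`
fixes `θ x`, `u` and the space `L`, so it corrects the determinant of `θ` without changing the value
at `x`. -/
theorem IsStabilizerInvariant.diag_eq_of_isometry {L : Submodule ℝ (Euc n)} {u : Euc n}
    (hu : u ∈ Lᗮ) {T : SymTensor n p} (hT : IsStabilizerInvariant L u T)
    (hdim : 2 ≤ Module.finrank ℝ L ∨ 2 ≤ Module.finrank ℝ (perp L u)) {θ : Euc n ≃ₗᵢ[ℝ] Euc n}
    (hL : ∀ x ∈ L, θ x ∈ L) (hθu : θ u = u) (x : Euc n) : diag T (θ x) = diag T x := by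
  obtain ⟨w, hw0, hwx, hwu, hwL⟩ : ∃ w : Euc n, w ≠ 0 ∧ ⟪w, θ x⟫ = 0 ∧ ⟪w, u⟫ = 0 ∧
      ∀ x ∈ L, mirror w x ∈ L := by
    rcases hdim with h | h
    · obtain ⟨w, hw, hw0, hwx⟩ := exists_orthogonal_mem h (θ x)
      exact ⟨w, hw0, hwx, hu w hw, fun x hx => mirror_mem hw hx⟩
    · obtain ⟨w, hw, hw0, hwx⟩ := exists_orthogonal_mem h (θ x)
      rw [mem_perp] at hw
      exact ⟨w, hw0, hwx, hw.2, fun x hx => mirror_mem_of_orthogonal hw.1 hx⟩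
  rcases isRotation_or_mirror θ hw0 with h | h
  · exact hT.diag_eq h hL hθu x
  · have h' := hT.diag_eq h (fun x hx => by
      rw [LinearIsometryEquiv.trans_apply]; exact hwL _ (hL x hx))
      (by rw [LinearIsometryEquiv.trans_apply, hθu, mirror_eq_self hwu]) x
    rwa [LinearIsometryEquiv.trans_apply, mirror_eq_self hwx] at h'

/-- The reflection along `a - a'` takes `a` to `a'` and the one along `b - b'` takes `b` to `b'`;
each fixes the other components. -/
theorem IsStabilizerInvariant.diag_add_eq {L : Submodule ℝ (Euc n)} {u : Euc n}
    (hu : u ∈ Lᗮ) {T : SymTensor n p} (hT : IsStabilizerInvariant L u T)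
    (hdim : 2 ≤ Module.finrank ℝ L ∨ 2 ≤ Module.finrank ℝ (perp L u)) {a a' b b' : Euc n}
    (ha : a ∈ L) (ha' : a' ∈ L) (hb : b ∈ perp L u) (hb' : b' ∈ perp L u)
    (haa : ‖a‖ = ‖a'‖) (hbb : ‖b‖ = ‖b'‖) (t : ℝ) :
    diag T (a + b + t • u) = diag T (a' + b' + t • u) := by
  have hw : a - a' ∈ L := L.sub_mem ha ha'
  have hw' : b - b' ∈ perp L u := Submodule.sub_mem _ hb hb'
  have hwu : ⟪a - a', u⟫ = 0 := hu _ hw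
  have h1 := hT.diag_eq_of_isometry hu hdim (θ := mirror (a - a'))
    (fun x hx => mirror_mem hw hx) (mirror_eq_self hwu) (a + b + t • u)
  have h2 := hT.diag_eq_of_isometry hu hdim (θ := mirror (b - b'))
    (fun x hx => mirror_mem_of_orthogonal (mem_perp.1 hw').1 hx)
    (mirror_eq_self (mem_perp.1 hw').2) (a' + b + t • u)
  rw [← h1, map_add, map_add, map_smul, mirror_sub haa, mirror_eq_self hwu,
    mirror_eq_self ((mem_perp.1 hb).1 _ hw), ← h2, map_add, map_add, map_smul, mirror_sub hbb,
    mirror_eq_self (mem_perp.1 hw').2,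
    mirror_eq_self (Submodule.inner_left_of_mem_orthogonal ha' (mem_perp.1 hw').1)]

/-- A unit vector of `N`, or `0` if `N` is trivial. It allows every component in `N` to be replaced
by a multiple of one fixed vector. -/
theorem exists_norm_smul_eq (N : Submodule ℝ (Euc n)) :
    ∃ e ∈ N, ∀ a ∈ N, ‖‖a‖ • e‖ = ‖a‖ := by
  by_cases h : N = ⊥
  · refine ⟨0, N.zero_mem, fun a ha => ?_⟩
    rw [h, Submodule.mem_bot] at ha
    simp [ha]
  · obtain ⟨w, hw, hw0⟩ := N.ne_bot_iff.1 h
    refine ⟨‖w‖⁻¹ • w, N.smul_mem _ hw, fun a _ => ?_⟩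
    have h1 : ‖‖w‖⁻¹ • w‖ = 1 := norm_smul_inv_norm (𝕜 := ℝ) hw0
    rw [norm_smul, h1, norm_norm, mul_one]

theorem decomposition_mem_perp {L : Submodule ℝ (Euc n)} {u : Euc n} (hu : u ∈ Lᗮ)
    (hu1 : ‖u‖ = 1) (x : Euc n) : x - L.starProjection x - ⟪u, x⟫ • u ∈ perp L u := by
  rw [mem_perp]
  refine ⟨Submodule.sub_mem _ (L.sub_starProjection_mem_orthogonal x)
    (Submodule.smul_mem _ _ hu), ?_⟩
  rw [inner_sub_left, inner_sub_left, hu _ (L.starProjection_apply_mem x), inner_smul_left,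
    real_inner_self_eq_norm_sq, hu1, real_inner_comm]
  simp

theorem norm_decomposition {L : Submodule ℝ (Euc n)} {u : Euc n} (hu : u ∈ Lᗮ)
    (hu1 : ‖u‖ = 1) (x : Euc n) : ‖x - L.starProjection x - ⟪u, x⟫ • u‖ ^ 2 =
      ‖x‖ ^ 2 - ‖L.starProjection x‖ ^ 2 - ⟪u, x⟫ ^ 2 := by
  have h := decomposition_mem_perp hu hu1 x
  rw [mem_perp] at h
  have ha := L.starProjection_apply_mem x
  have h1 := h.1 _ ha
  have h2 := hu _ ha
  generalize hb : x - L.starProjection x - ⟪u, x⟫ • u = b at *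
  have hx : x = L.starProjection x + b + ⟪u, x⟫ • u := by rw [← hb]; abel
  have h3 : ‖x‖ ^ 2 = ‖L.starProjection x + b + ⟪u, x⟫ • u‖ ^ 2 := by rw [← hx]
  rw [h3, norm_add_sq_real, norm_add_sq_real, inner_add_left, inner_smul_right, inner_smul_right,
    h1, h2, h.2, norm_smul, hu1]
  simp only [mul_zero, add_zero, mul_one, Real.norm_eq_abs, sq_abs]
  ring

theorem pow_add_neg_pow_of_odd {i : ℕ} (hi : Odd i) (a : ℝ) : a ^ i + (-a) ^ i = 0 := by
  rw [hi.neg_pow]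
  ring

/-! ### Invariant polynomials when `L` or `perp L u` has dimension at least two -/

section Span

variable {L : Submodule ℝ (Euc n)} {u : Euc n}

/-- The squared norm. -/
def normSqFun (n : ℕ) : Euc n → ℝ := fun x => ‖x‖ ^ 2

/-- The squared norm of the projection to `L`. -/
def projSqFun (L : Submodule ℝ (Euc n)) : Euc n → ℝ := fun x => ‖L.starProjection x‖ ^ 2

/-- The linear functional given by `u`. -/
def innerFun (u : Euc n) : Euc n → ℝ := fun x => ⟪u, x⟫

/-- The diagonals of linear combinations of the kernels at `(L, u)`. -/
def kernelSpan (p k : ℕ) (L : Submodule ℝ (Euc n)) (u : Euc n) : Submodule ℝ (Euc n → ℝ) :=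
  (Submodule.span ℝ ((fun E => E L u) '' kernels n p k)).map diag

theorem diag_mem_kernelSpan {k : ℕ} {E : Submodule ℝ (Euc n) → Euc n → SymTensor n p}
    (hE : E ∈ kernels n p k) : diag (E L u) ∈ kernelSpan p k L u :=
  ⟨E L u, Submodule.subset_span ⟨E, hE, rfl⟩, rfl⟩

/-- Taking `B = 0` leaves only the monomials with `j = 0`, whose kernels are admitted for every `k`.
-/
theorem monSpan_zero_le_kernelSpan (k : ℕ) :
    monSpan (normSqFun n) 0 (innerFun u) p ≤ kernelSpan p k L u := by
  refine Submodule.span_le.2 ?_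
  rintro _ ⟨m, j, s, h, rfl⟩
  rcases Nat.eq_zero_or_pos j with rfl | hj
  · have hE : stdKernel (n := n) (p := p) m 0 s (by omega) ∈ kernels n p k :=
      Or.inl ⟨m, 0, s, _, fun _ => rfl, rfl⟩
    refine (congrArg (· ∈ kernelSpan p k L u) ?_).mpr (diag_mem_kernelSpan (L := L) (u := u) hE)
    funext x
    rw [diag_stdKernel]
    rfl
  · rw [zero_pow hj.ne', mul_zero, zero_mul]
    exact Submodule.zero_mem _

theorem monSpan_le_kernelSpan {k : ℕ} (h0 : k ≠ 0) (h1 : k ≠ n - 1) :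
    monSpan (normSqFun n) (projSqFun L) (innerFun u) p ≤ kernelSpan p k L u := by
  refine Submodule.span_le.2 ?_
  rintro _ ⟨m, j, s, h, rfl⟩
  have hE : stdKernel (n := n) (p := p) m j s (by omega) ∈ kernels n p k :=
    Or.inl ⟨m, j, s, _, fun h => by tauto, rfl⟩
  refine (congrArg (· ∈ kernelSpan p k L u) ?_).mpr (diag_mem_kernelSpan (L := L) (u := u) hE)
  funext x
  rw [diag_stdKernel]
  rfl

/-- This explains the condition on `j`. For `k = 0` the form `Q_L` vanishes, and for `k = n - 1` the
space `perp L u` is trivial, so that `Q_L = Q - u ^ 2`. In both cases powers of `Q_L` are redundant;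
for other `k` all of them are available. -/
theorem evenMonomial_mem_kernelSpan {k : ℕ} (hL : Module.finrank ℝ L = k)
    (hu : u ∈ Lᗮ) (hu1 : ‖u‖ = 1) {i j l : ℕ} (h : 2 * i + 2 * j + l = p) :
    projSqFun L ^ i * (normSqFun n - projSqFun L - innerFun u ^ 2) ^ j * innerFun u ^ l ∈
      kernelSpan p k L u := by
  by_cases h0 : k = 0
  · have hB : projSqFun L = 0 := by
      have hbot : L = ⊥ := Submodule.finrank_eq_zero.1 (hL.trans h0)
      funext x
      simp [projSqFun, hbot]
    rw [hB]
    refine monSpan_zero_le_kernelSpan k ?_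
    have := mul_sub_pow_mem_monSpan (normSqFun n) 0 (innerFun u) (q := p) j (m := 0) (i := i)
      (l := l) (by omega)
    rwa [pow_zero, one_mul] at this
  by_cases h1 : k = n - 1
  · have hC : normSqFun n - projSqFun L - innerFun u ^ 2 = 0 := by
      have hbot : perp L u = ⊥ := by
        have := finrank_perp hu hu1
        exact Submodule.finrank_eq_zero.1 (by omega)
      funext x
      have hx := decomposition_mem_perp hu hu1 x
      rw [hbot, Submodule.mem_bot] at hx
      have := norm_decomposition hu hu1 x
      rw [hx, norm_zero] at this
      change ‖x‖ ^ 2 - ‖L.starProjection x‖ ^ 2 - ⟪u, x⟫ ^ 2 = 0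
      rw [← this]
      norm_num
    rcases Nat.eq_zero_or_pos j with rfl | hj
    · have hB : projSqFun L = normSqFun n - 0 - innerFun u ^ 2 := by
        linear_combination -hC
      rw [hB]
      refine monSpan_zero_le_kernelSpan k ?_
      have := mul_sub_pow_mem_monSpan (normSqFun n) 0 (innerFun u) (q := p) i (m := 0) (i := 0)
        (l := l) (by omega)
      rwa [pow_zero, pow_zero, one_mul, one_mul, ← mul_one (_ ^ i)] at this
    · rw [hC, zero_pow hj.ne', mul_zero, zero_mul]
      exact Submodule.zero_mem _
  · refine monSpan_le_kernelSpan h0 h1 ?_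
    have := mul_sub_pow_mem_monSpan (normSqFun n) (projSqFun L) (innerFun u) (q := p) j (m := 0)
      (i := i) (l := l) (by omega)
    rwa [pow_zero, one_mul] at this

/-- By invariance the value at `x` equals the value at a point with components `± ‖a‖ • e₁`, `± ‖b‖
• e₂` and `⟪u, x⟫ • u`, hence a polynomial in these three numbers. Averaging over the four choices
of signs leaves only even powers of the two norms. -/
theorem IsStabilizerInvariant.diag_mem_kernelSpan {k : ℕ} (hL : Module.finrank ℝ L = k)
    (hu : u ∈ Lᗮ) (hu1 : ‖u‖ = 1) {T : SymTensor n p} (hT : IsStabilizerInvariant L u T)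
    (hdim : 2 ≤ Module.finrank ℝ L ∨ 2 ≤ Module.finrank ℝ (perp L u)) :
    diag T ∈ kernelSpan p k L u := by
  obtain ⟨e₁, he₁, he₁'⟩ := exists_norm_smul_eq L
  obtain ⟨e₂, he₂, he₂'⟩ := exists_norm_smul_eq (perp L u)
  obtain ⟨C, e, he, hC⟩ := exists_diag_expansion T e₁ e₂ u
  have key : ∀ x (ε δ : ℝ), |ε| = 1 → |δ| = 1 → diag T x = ∑ ρ, C ρ *
      ((ε * ‖L.starProjection x‖) ^ (e ρ).1 *
        (δ * ‖x - L.starProjection x - ⟪u, x⟫ • u‖) ^ (e ρ).2.1 * ⟪u, x⟫ ^ (e ρ).2.2) := by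
    intro x ε δ hε hδ
    rw [← hC]
    have ha := L.starProjection_apply_mem x
    have hb := decomposition_mem_perp hu hu1 x
    rw [← hT.diag_add_eq hu hdim ha (L.smul_mem _ he₁) hb (Submodule.smul_mem _ _ he₂) ?_ ?_]
    · exact congrArg (diag T) (by abel)
    · rw [mul_smul, norm_smul ε, he₁' _ ha, Real.norm_eq_abs, hε, one_mul]
    · rw [mul_smul, norm_smul δ, he₂' _ hb, Real.norm_eq_abs, hδ, one_mul]
  have hsum : diag T = ∑ ρ, C ρ • fun x => (1 / 4 : ℝ) *
      ((‖L.starProjection x‖ ^ (e ρ).1 + (-‖L.starProjection x‖) ^ (e ρ).1) *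
        (‖x - L.starProjection x - ⟪u, x⟫ • u‖ ^ (e ρ).2.1 +
          (-‖x - L.starProjection x - ⟪u, x⟫ • u‖) ^ (e ρ).2.1) * ⟪u, x⟫ ^ (e ρ).2.2) := by
    funext x
    have h1 := key x 1 1 (by simp) (by simp)
    have h2 := key x 1 (-1) (by simp) (by simp)
    have h3 := key x (-1) 1 (by simp) (by simp)
    have h4 := key x (-1) (-1) (by simp) (by simp)
    have h5 := congrArg₂ (· + ·) (congrArg₂ (· + ·) h1 h2) (congrArg₂ (· + ·) h3 h4)
    simp only [← Finset.sum_add_distrib] at h5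
    have h6 : diag T x = (1 / 4 : ℝ) * (diag T x + diag T x + (diag T x + diag T x)) := by ring
    rw [h6, h5, Finset.mul_sum, Finset.sum_apply]
    refine Finset.sum_congr rfl fun ρ _ => ?_
    simp only [Pi.smul_apply, smul_eq_mul, one_mul, neg_one_mul]
    ring
  rw [hsum]
  refine Submodule.sum_mem _ fun ρ _ => Submodule.smul_mem _ _ ?_
  have hρ := he ρ
  generalize e ρ = v at hρ
  obtain ⟨i, j, l⟩ := v
  simp only at hρ ⊢
  rcases Nat.even_or_odd i with ⟨i, rfl⟩ | hi
  · rcases Nat.even_or_odd j with ⟨j, rfl⟩ | hj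
    · convert evenMonomial_mem_kernelSpan (p := p) (i := i) (j := j) (l := l) hL hu hu1
        (by omega) using 1
      funext x
      simp only [Pi.mul_apply, Pi.pow_apply, Pi.sub_apply, projSqFun, normSqFun, innerFun]
      rw [← norm_decomposition hu hu1 x]
      simp only [← two_mul, pow_mul, neg_sq]
      ring
    · simp only [pow_add_neg_pow_of_odd hj, mul_zero, zero_mul]
      exact Submodule.zero_mem _
  · simp only [pow_add_neg_pow_of_odd hi, mul_zero, zero_mul]
    exact Submodule.zero_mem _

end Span

/-! ### The exceptional dimensions -/

open SymTensor

theorem plane_decomposition {u : Euc 2} (hu1 : ‖u‖ = 1) (x : Euc 2) :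
    ⟪rot2 u, x⟫ • rot2 u + ⟪u, x⟫ • u = x := by
  have h : u 0 ^ 2 + u 1 ^ 2 = 1 := by
    have := EuclideanSpace.real_norm_sq_eq u
    rw [hu1, Fin.sum_univ_two] at this
    linarith
  have hi : ⟪u, x⟫ = u 0 * x 0 + u 1 * x 1 := by
    simp [PiLp.inner_apply, Fin.sum_univ_two, mul_comm]
  ext i
  rw [inner_rot2, hi]
  fin_cases i
  · simp [rot2]
    linear_combination x 0 * h
  · simp [rot2]
    linear_combination x 1 * h

/-- In the plane every tensor is admissible. Its diagonal is a polynomial in `⟪rot2 u, x⟫` and `⟪u,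
x⟫`; the square of the former is `‖x‖ ^ 2 - ⟪u, x⟫ ^ 2`, so it is needed at most to the first power.
-/
theorem diag_mem_kernelSpan_plane {k : ℕ} (L : Submodule ℝ (Euc 2)) {u : Euc 2} (hu1 : ‖u‖ = 1)
    (T : SymTensor 2 p) : diag T ∈ kernelSpan p k L u := by
  -- Two vectors span the plane; the third is set to `0`, so the terms with a positive first
  -- exponent vanish.
  obtain ⟨C, e, he, hC⟩ := exists_diag_expansion T 0 (rot2 u) u
  have hsq : innerFun (rot2 u) ^ 2 = normSqFun 2 - 0 - innerFun u ^ 2 := by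
    funext x
    have h : u 0 ^ 2 + u 1 ^ 2 = 1 := by
      have := EuclideanSpace.real_norm_sq_eq u
      rw [hu1, Fin.sum_univ_two] at this
      linarith
    simp only [Pi.pow_apply, Pi.sub_apply, Pi.zero_apply, innerFun, normSqFun, inner_rot2,
      EuclideanSpace.real_norm_sq_eq x, Fin.sum_univ_two]
    simp [PiLp.inner_apply, Fin.sum_univ_two]
    linear_combination (x 0 ^ 2 + x 1 ^ 2) * h
  have hsum : diag T = ∑ ρ, C ρ •
      (0 ^ (e ρ).1 * innerFun (rot2 u) ^ (e ρ).2.1 * innerFun u ^ (e ρ).2.2) := by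
    funext x
    conv_lhs => rw [← plane_decomposition hu1 x]
    have := hC 0 ⟪rot2 u, x⟫ ⟪u, x⟫
    rw [smul_zero, zero_add] at this
    rw [this, Finset.sum_apply]
    rfl
  rw [hsum]
  refine Submodule.sum_mem _ fun ρ _ => Submodule.smul_mem _ _ ?_
  have hρ := he ρ
  generalize e ρ = v at hρ
  obtain ⟨i, j, l⟩ := v
  simp only at hρ ⊢
  rcases Nat.eq_zero_or_pos i with rfl | hi
  · rw [pow_zero, one_mul]
    rcases Nat.even_or_odd j with ⟨j, rfl⟩ | ⟨j, rfl⟩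
    · refine monSpan_zero_le_kernelSpan k ?_
      have := mul_sub_pow_mem_monSpan (normSqFun 2) 0 (innerFun u) (q := p) j (m := 0) (i := 0)
        (l := l) (by omega)
      rwa [pow_zero, pow_zero, one_mul, one_mul, ← hsq, ← pow_mul, two_mul] at this
    -- For an odd power one factor `rot2 u` is split off. It turns each monomial of the expanded
    -- even part into a `planeKernel`.
    · have h1 := mul_sub_pow_mem_monSpan (normSqFun 2) 0 (innerFun u) (q := 2 * j + l) j (m := 0)
        (i := 0) (l := l) (by omega)
      rw [pow_zero, pow_zero, one_mul, one_mul, ← hsq, ← pow_mul] at h1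
      have h2 : monSpan (normSqFun 2) 0 (innerFun u) (2 * j + l) ≤
          (kernelSpan p k L u).comap (LinearMap.mulLeft ℝ (innerFun (rot2 u))) := by
        refine Submodule.span_le.2 ?_
        rintro _ ⟨m, i, s, h, rfl⟩
        change innerFun (rot2 u) * _ ∈ kernelSpan p k L u
        rcases Nat.eq_zero_or_pos i with rfl | hi
        · have hE : planeKernel (p := p) m s (by omega) ∈ kernels 2 p k :=
            Or.inr ⟨m, s, _, rfl⟩
          refine (congrArg (· ∈ kernelSpan p k L u) ?_).mpr
            (LocalTensor.diag_mem_kernelSpan (L := L) (u := u) hE)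
          funext x
          rw [diag_planeKernel, pow_zero, mul_one]
          rfl
        · rw [zero_pow hi.ne', mul_zero, zero_mul, mul_zero]
          exact Submodule.zero_mem _
      have h3 : innerFun (rot2 u) * _ ∈ kernelSpan p k L u := h2 h1
      rwa [← mul_assoc, ← pow_succ'] at h3
  · rw [zero_pow hi.ne', zero_mul, zero_mul]
    exact Submodule.zero_mem _

theorem norm_cross3 {v u : Euc 3} (hv1 : ‖v‖ = 1) (hu1 : ‖u‖ = 1) (huv : ⟪v, u⟫ = 0) :
    ‖cross3 v u‖ = 1 := by
  rw [← sq_eq_sq₀ (norm_nonneg _) zero_le_one, ← real_inner_self_eq_norm_sq]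
  have h1 := EuclideanSpace.real_norm_sq_eq v
  have h2 := EuclideanSpace.real_norm_sq_eq u
  rw [hv1, Fin.sum_univ_three] at h1
  rw [hu1, Fin.sum_univ_three] at h2
  simp only [PiLp.inner_apply, Fin.sum_univ_three, RCLike.inner_apply, conj_trivial] at huv
  rw [inner_cross3]
  simp [cross3, crossProduct]
  linear_combination (-(u 0 ^ 2 + u 1 ^ 2 + u 2 ^ 2)) * h1 - h2 -
    (u 0 * v 0 + u 1 * v 1 + u 2 * v 2) * huv

theorem space_decomposition {v u : Euc 3} (hv1 : ‖v‖ = 1) (hu1 : ‖u‖ = 1) (huv : ⟪v, u⟫ = 0)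
    (x : Euc 3) : ⟪v, x⟫ • v + ⟪cross3 v u, x⟫ • cross3 v u + ⟪u, x⟫ • u = x := by
  have hvw : ⟪cross3 v u, v⟫ = 0 := by rw [inner_cross3]; ring
  have huw : ⟪cross3 v u, u⟫ = 0 := by rw [inner_cross3]; ring
  have hw1 := norm_cross3 hv1 hu1 huv
  have hon : Orthonormal ℝ ![v, cross3 v u, u] := by
    rw [orthonormal_iff_ite]
    intro i j
    have hvw' : ⟪v, cross3 v u⟫ = 0 := by rw [real_inner_comm, hvw]
    have huw' : ⟪u, cross3 v u⟫ = 0 := by rw [real_inner_comm, huw]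
    have huv' : ⟪u, v⟫ = 0 := by rw [real_inner_comm, huv]
    fin_cases i <;> fin_cases j <;> simp [hv1, hu1, hw1, hvw, hvw', huw, huw', huv, huv']
  let b := basisOfOrthonormalOfCardEqFinrank hon (by simp)
  have hb : ⇑b = ![v, cross3 v u, u] := coe_basisOfOrthonormalOfCardEqFinrank hon (by simp)
  let ob := b.toOrthonormalBasis (by rw [hb]; exact hon)
  have h := ob.sum_repr' x
  have hob : ⇑ob = ![v, cross3 v u, u] := by rw [Module.Basis.coe_toOrthonormalBasis, hb]
  rw [Fin.sum_univ_three, hob] at h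
  exact h

/-- The half-turn about `u` negates the unit vector `v` of `L` and `w = v × u`. It forces the
exponents of `v` and `w` in the diagonal to have equal parity: even pairs give standard kernels, odd
pairs contain the factor `v w` of `edgeKernel`. -/
theorem IsStabilizerInvariant.diag_mem_kernelSpan_edge {L : Submodule ℝ (Euc 3)} {u : Euc 3}
    (hL : Module.finrank ℝ L = 1) (hu : u ∈ Lᗮ) (hu1 : ‖u‖ = 1) {T : SymTensor 3 p}
    (hT : IsStabilizerInvariant L u T) : diag T ∈ kernelSpan p 1 L u := by
  obtain ⟨hv, hv1⟩ := unitVec_spec (L := L) (by omega)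
  have huv : ⟪unitVec L, u⟫ = 0 := hu _ hv
  have hdec := space_decomposition hv1 hu1 huv
  have hB : projSqFun L = innerFun (unitVec L) ^ 2 := by
    funext x
    have h1 := eq_inner_smul_of_finrank_eq_one hL hv hv1 (L.starProjection_apply_mem x)
    have h2 : ⟪unitVec L, L.starProjection x⟫ = ⟪unitVec L, x⟫ := by
      have h3 := L.sub_starProjection_mem_orthogonal x _ hv
      rw [inner_sub_right, sub_eq_zero] at h3
      exact h3.symm
    rw [h2] at h1
    simp [projSqFun, innerFun, h1, norm_smul, hv1]
  have hvw : ⟪cross3 (unitVec L) u, unitVec L⟫ = 0 := by rw [inner_cross3]; ring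
  have huw : ⟪cross3 (unitVec L) u, u⟫ = 0 := by rw [inner_cross3]; ring
  have hw1 := norm_cross3 hv1 hu1 huv
  generalize hw : cross3 (unitVec L) u = w at hdec hvw huw hw1
  have hC' : normSqFun 3 - projSqFun L - innerFun u ^ 2 = innerFun w ^ 2 := by
    rw [hB]
    funext x
    have h1 : ‖x‖ ^ 2 = ⟪x, ⟪unitVec L, x⟫ • unitVec L + ⟪w, x⟫ • w + ⟪u, x⟫ • u⟫ := by
      rw [hdec, real_inner_self_eq_norm_sq]
    simp only [inner_add_right, inner_smul_right, real_inner_comm] at h1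
    simp only [Pi.pow_apply, Pi.sub_apply, innerFun, normSqFun, h1, real_inner_comm]
    ring
  obtain ⟨C, e, he, hC⟩ := exists_diag_expansion T (unitVec L) w u
  have hinv : ∀ a b c : ℝ, diag T ((-a) • unitVec L + (-b) • w + c • u) =
      diag T (a • unitVec L + b • w + c • u) := by
    intro a b c
    have hv0 : unitVec L ≠ 0 := fun h => by rw [h, norm_zero] at hv1; exact zero_ne_one hv1
    have hw0 : w ≠ 0 := fun h => by rw [h, norm_zero] at hw1; exact zero_ne_one hw1
    have hwv : ⟪unitVec L, w⟫ = 0 := by rw [real_inner_comm, hvw]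
    -- The half-turn is the product of the reflections along `v` and `w`.
    have hrot : IsRotation ((mirror (unitVec L)).trans (mirror w)) := by
      rw [IsRotation, det_trans, mirror_det hv0, mirror_det hw0]
      norm_num
    have hx : ∀ x, (mirror (unitVec L)).trans (mirror w) x = mirror w (mirror (unitVec L) x) :=
      fun _ => rfl
    have hθL : ∀ x ∈ L, (mirror (unitVec L)).trans (mirror w) x = -x := by
      intro x hxL
      rw [eq_inner_smul_of_finrank_eq_one hL hv hv1 hxL, hx, map_smul, map_smul, mirror_self,
        map_neg, mirror_eq_self hvw, smul_neg]
    have hθu : (mirror (unitVec L)).trans (mirror w) u = u := by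
      rw [hx, mirror_eq_self huv, mirror_eq_self huw]
    have hθw : (mirror (unitVec L)).trans (mirror w) w = -w := by
      rw [hx, mirror_eq_self hwv, mirror_self]
    have h := hT.diag_eq hrot (fun x hx => by rw [hθL x hx]; exact L.neg_mem hx) hθu
      (a • unitVec L + b • w + c • u)
    rw [← h, map_add, map_add, map_smul, map_smul, map_smul, hθL _ hv, hθu, hθw, neg_smul, neg_smul,
      smul_neg, smul_neg]
  have hsum : diag T = ∑ ρ, C ρ • ((1 / 2 : ℝ) •
      ((1 + (-1) ^ ((e ρ).1 + (e ρ).2.1) : ℝ) •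
        (innerFun (unitVec L) ^ (e ρ).1 * innerFun w ^ (e ρ).2.1 * innerFun u ^ (e ρ).2.2))) := by
    funext x
    have h1 := hC ⟪unitVec L, x⟫ ⟪w, x⟫ ⟪u, x⟫
    have h2 := hC (-⟪unitVec L, x⟫) (-⟪w, x⟫) ⟪u, x⟫
    rw [hdec] at h1
    rw [hinv, hdec] at h2
    have h5 := congrArg₂ (· + ·) h1 h2
    simp only [← Finset.sum_add_distrib] at h5
    have h6 : diag T x = (1 / 2 : ℝ) * (diag T x + diag T x) := by ring
    rw [h6, h5, Finset.mul_sum, Finset.sum_apply]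
    refine Finset.sum_congr rfl fun ρ _ => ?_
    simp only [Pi.smul_apply, Pi.mul_apply, Pi.pow_apply, smul_eq_mul, innerFun]
    rw [neg_pow ⟪unitVec L, x⟫, neg_pow ⟪w, x⟫, pow_add]
    ring
  rw [hsum]
  refine Submodule.sum_mem _ fun ρ _ => Submodule.smul_mem _ _ (Submodule.smul_mem _ _ ?_)
  have hρ := he ρ
  generalize e ρ = z at hρ
  obtain ⟨i, j, l⟩ := z
  simp only at hρ ⊢
  have hev : ∀ {i j l q : ℕ}, 2 * i + 2 * j + l = q →
      innerFun (unitVec L) ^ (2 * i) * innerFun w ^ (2 * j) * innerFun u ^ l ∈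
        monSpan (normSqFun 3) (projSqFun L) (innerFun u) q := by
    intro i j l q h
    have := mul_sub_pow_mem_monSpan (normSqFun 3) (projSqFun L) (innerFun u) (q := q) j (m := 0)
      (i := i) (l := l) (by omega)
    rw [pow_zero, one_mul, hC', ← pow_mul] at this
    rwa [pow_mul, ← hB]
  -- In the mixed cases the coefficient `1 + (-1) ^ (i + j)` is zero.
  rcases Nat.even_or_odd' i with ⟨i, rfl | rfl⟩ <;> rcases Nat.even_or_odd' j with ⟨j, rfl | rfl⟩
  · exact Submodule.smul_mem _ _ (monSpan_le_kernelSpan (by omega) (by omega) (hev (by omega)))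
  · rw [Odd.neg_one_pow ⟨i + j, by ring⟩, add_neg_cancel, zero_smul]
    exact Submodule.zero_mem _
  · rw [Odd.neg_one_pow ⟨i + j, by ring⟩, add_neg_cancel, zero_smul]
    exact Submodule.zero_mem _
  · refine Submodule.smul_mem _ _ ?_
    have h1 := hev (i := i) (j := j) (l := l) (q := 2 * i + 2 * j + l) rfl
    have h2 : monSpan (normSqFun 3) (projSqFun L) (innerFun u) (2 * i + 2 * j + l) ≤
        (kernelSpan p 1 L u).comap (LinearMap.mulLeft ℝ (innerFun (unitVec L) * innerFun w)) := by
      refine Submodule.span_le.2 ?_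
      rintro _ ⟨m, j, s, h, rfl⟩
      have hE : edgeKernel (p := p) m j s (by omega) ∈ kernels 3 p 1 :=
        Or.inr ⟨rfl, m, j, s, _, rfl⟩
      refine (congrArg (· ∈ kernelSpan p 1 L u) ?_).mpr
        (LocalTensor.diag_mem_kernelSpan (L := L) (u := u) hE)
      funext x
      rw [diag_edgeKernel, hw]
      rfl
    have h3 : innerFun (unitVec L) * innerFun w * _ ∈ kernelSpan p 1 L u := h2 h1
    refine (congrArg (· ∈ kernelSpan p 1 L u) ?_).mpr h3
    ring

theorem IsStabilizerInvariant.mem_span_kernels (hn : 2 ≤ n) {k : ℕ} (hk : k < n)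
    {L : Submodule ℝ (Euc n)} {u : Euc n} (hL : Module.finrank ℝ L = k) (hu : u ∈ Lᗮ)
    (hu1 : ‖u‖ = 1) {T : SymTensor n p} (hT : IsStabilizerInvariant L u T) :
    T ∈ Submodule.span ℝ ((fun E => E L u) '' kernels n p k) := by
  suffices h : diag T ∈ kernelSpan p k L u by
    obtain ⟨S, hS, hST⟩ := h
    rwa [← diag_injective hST]
  by_cases hdim : 2 ≤ Module.finrank ℝ L ∨ 2 ≤ Module.finrank ℝ (perp L u)
  · exact hT.diag_mem_kernelSpan hL hu hu1 hdim
  · have := finrank_perp hu hu1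
    -- The dimensions of `L` and `perp L u` add up to `n - 1`. If both are at most one, then `n ≤
    -- 3`, and for `n = 3` both equal one.
    have hn' : n = 2 ∨ n = 3 ∧ k = 1 := by omega
    rcases hn' with rfl | ⟨rfl, rfl⟩
    · exact diag_mem_kernelSpan_plane L hu1 T
    · exact hT.diag_mem_kernelSpan_edge hL hu hu1

/-! ### Polytopes, relative interiors and the normal bundle -/

/-- The relative interior of `F`. -/
def relInt (F : Set (Euc n)) : Set (Euc n) :=
  {x | ∃ r > 0, ∀ v ∈ dirSpace F, ‖v‖ < r → x + v ∈ F}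

theorem relInt_subset (F : Set (Euc n)) : relInt F ⊆ F := by
  rintro x ⟨r, hr, h⟩
  simpa using h 0 (Submodule.zero_mem _) (by simpa using hr)

theorem sub_mem_dirSpace {F : Set (Euc n)} {x y : Euc n} (hx : x ∈ F) (hy : y ∈ F) :
    y - x ∈ dirSpace F := by
  rw [dirSpace, direction_affineSpan]
  exact vsub_mem_vectorSpan ℝ hy hx

theorem dirSpace_mono {F G : Set (Euc n)} (h : F ⊆ G) : dirSpace F ≤ dirSpace G := by
  rw [dirSpace, dirSpace, direction_affineSpan, direction_affineSpan]
  exact vectorSpan_mono ℝ h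

/-- A linear functional that is constant on `F` vanishes on its direction space. -/
theorem dirSpace_le_ker {F : Set (Euc n)} {f : Euc n →ₗ[ℝ] ℝ}
    (h : ∀ x ∈ F, ∀ y ∈ F, f x = f y) : dirSpace F ≤ LinearMap.ker f := by
  rw [dirSpace, direction_affineSpan, vectorSpan_def]
  refine Submodule.span_le.2 ?_
  rintro _ ⟨x, hx, y, hy, rfl⟩
  change f (x - y) = 0
  rw [map_sub, h x hx y hy, sub_self]

/-- The frontier condition is automatic: from an interior point one could move a little in the
direction of the normal and stay in `P`. -/
theorem mem_normalBundle_iff {P : Set (Euc n)} {z : Sig n} :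
    z ∈ normalBundle P ↔ z.1 ∈ P ∧ ∀ y ∈ P, ⟪y - z.1, (z.2 : Euc n)⟫ ≤ 0 := by
  refine ⟨fun h => ⟨h.1, h.2.2⟩, fun h => ⟨h.1, ⟨subset_closure h.1, fun hint => ?_⟩, h.2⟩⟩
  obtain ⟨ε, hε, hball⟩ := Metric.mem_nhds_iff.1 (mem_interior_iff_mem_nhds.1 hint)
  have hu : ‖(z.2 : Euc n)‖ = 1 := by simp
  have h1 := h.2 (z.1 + (ε / 2) • (z.2 : Euc n)) (hball (by
    rw [mem_ball_iff_norm, add_sub_cancel_left, norm_smul, hu, mul_one, Real.norm_eq_abs,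
      abs_of_pos (half_pos hε)]
    linarith))
  rw [add_sub_cancel_left, inner_smul_left, real_inner_self_eq_norm_sq, hu] at h1
  simp at h1
  linarith

theorem IsPolytope.convex {P : Set (Euc n)} (hP : IsPolytope P) : Convex ℝ P := by
  obtain ⟨s, -, -, rfl⟩ := hP
  exact convex_convexHull ℝ s

theorem IsPolytope.isCompact {P : Set (Euc n)} (hP : IsPolytope P) : IsCompact P := by
  obtain ⟨s, hs, -, rfl⟩ := hP
  exact hs.isCompact_convexHull ℝ

theorem IsPolytope.nonempty {P : Set (Euc n)} (hP : IsPolytope P) : P.Nonempty := by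
  obtain ⟨s, -, hs, rfl⟩ := hP
  exact hs.convexHull

/-- Krein–Milman: the extreme points of `F` are extreme in the hull, hence belong to the finite set
`s`. -/
theorem exposed_eq_convexHull {s F : Set (Euc n)} (hs : s.Finite)
    (hF : IsExposed ℝ (convexHull ℝ s) F) : F = convexHull ℝ (F ∩ s) := by
  have hFk : IsCompact F := hF.isCompact (hs.isCompact_convexHull ℝ)
  have hFc : Convex ℝ F := hF.convex (convex_convexHull ℝ s)
  have hsub : F.extremePoints ℝ ⊆ F ∩ s := fun x hx =>
    ⟨hx.1, extremePoints_convexHull_subset (hF.isExtreme.extremePoints_subset_extremePoints hx)⟩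
  have hfin : (F.extremePoints ℝ).Finite := hs.subset (hsub.trans Set.inter_subset_right)
  refine Set.Subset.antisymm ?_ (convexHull_min Set.inter_subset_left hFc)
  refine Set.Subset.trans ?_ (convexHull_mono hsub)
  rw [← (hfin.isCompact_convexHull ℝ).isClosed.closure_eq]
  exact (closure_convexHull_extremePoints hFk hFc).symm.subset

theorem IsPolytope.of_isExposed {P F : Set (Euc n)} (hP : IsPolytope P) (hF : IsExposed ℝ P F)
    (hne : F.Nonempty) : IsPolytope F := by
  obtain ⟨s, hs, -, rfl⟩ := hP
  have h := exposed_eq_convexHull hs hF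
  refine ⟨F ∩ s, hs.subset Set.inter_subset_right, ?_, h⟩
  rw [h] at hne
  exact convexHull_nonempty_iff.1 hne

theorem IsPolytope.of_mem_faces {k : ℕ} {P F : Set (Euc n)} (hP : IsPolytope P)
    (hF : F ∈ faces k P) : IsPolytope F :=
  hP.of_isExposed hF.2.1 hF.1

/-- A face of a face of a polytope is a face of the polytope. -/
theorem IsPolytope.isExposed_trans {P F G : Set (Euc n)} (hP : IsPolytope P)
    (hF : IsExposed ℝ P F) (hG : IsExposed ℝ F G) : IsExposed ℝ P G := by
  rintro ⟨x, hxG⟩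
  obtain ⟨g, hg⟩ := hG ⟨x, hxG⟩
  have hxF : x ∈ F := by rw [hg] at hxG; exact hxG.1
  have hgx : ∀ y ∈ F, g y ≤ g x := by rw [hg] at hxG; exact hxG.2
  obtain ⟨l, hl⟩ := hF ⟨x, hxF⟩
  have hlx : ∀ y ∈ P, l y ≤ l x := by rw [hl] at hxF; exact hxF.2
  have hFP : F ⊆ P := by rw [hl]; exact fun y hy => hy.1
  have hlF : ∀ y ∈ F, l y = l x := fun y hy =>
    le_antisymm (hlx y (hFP hy)) (by rw [hl] at hy; exact hy.2 x (hFP hxF))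
  have hlF' : ∀ y ∈ P, l x ≤ l y → y ∈ F := fun y hy h => by
    rw [hl]
    exact ⟨hy, fun z hz => (hlx z hz).trans h⟩
  obtain ⟨s, hs, -, rfl⟩ := hP
  -- If `l` exposes `F` and `g` exposes `G` in `F`, then `N • l + g` exposes `G` for large `N`: at
  -- the finitely many points of `s` outside `F` the loss in `N • l` outweighs any gain in `g`.
  obtain ⟨N, hN0, hN⟩ : ∃ N : ℝ, 0 ≤ N ∧ ∀ v ∈ s, v ∉ F → g v - g x < N * (l x - l v) := by
    have : ∀ v ∈ s, ∃ N₀ : ℝ, ∀ N ≥ N₀, v ∉ F → g v - g x < N * (l x - l v) := by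
      intro v hv
      by_cases hvF : v ∈ F
      · exact ⟨0, fun _ _ h => absurd hvF h⟩
      · have hpos : 0 < l x - l v := by
          by_contra hle
          exact hvF (hlF' v (subset_convexHull ℝ s hv) (by linarith))
        refine ⟨(g v - g x) / (l x - l v) + 1, fun N hN _ => ?_⟩
        rw [← div_lt_iff₀ hpos]
        linarith
    choose! N₀ hN₀ using this
    obtain ⟨B, hB⟩ := (hs.image N₀).bddAbove
    refine ⟨max B 0, le_max_right _ _, fun v hv => hN₀ v hv _ ?_⟩
    exact (hB ⟨v, hv, rfl⟩).trans (le_max_left _ _)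
  have hle : ∀ v ∈ s, (N • l + g) v ≤ (N • l + g) x ∧
      ((N • l + g) v = (N • l + g) x → v ∈ G) := by
    intro v hv
    have hval : ∀ y, (N • l + g) y = N * l y + g y := fun y => rfl
    rw [hval, hval]
    by_cases hvF : v ∈ F
    · rw [hlF v hvF]
      refine ⟨by linarith [hgx v hvF], fun h => ?_⟩
      rw [hg]
      exact ⟨hvF, fun y hy => by linarith [hgx y hy]⟩
    · have := hN v hv hvF
      rw [mul_sub] at this
      exact ⟨by linarith, fun h => by linarith⟩
  have hmax : ∀ y ∈ convexHull ℝ s, (N • l + g) y ≤ (N • l + g) x := by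
    have hconv : Convex ℝ {y | (N • l + g) y ≤ (N • l + g) x} :=
      convex_halfSpace_le (N • l + g).toLinearMap.isLinear _
    exact convexHull_min (fun v hv => (hle v hv).1) hconv
  have hGF : G ⊆ F := by rw [hg]; exact fun y hy => hy.1
  have hGconv : Convex ℝ G := hG.convex (hF.convex (convex_convexHull ℝ s))
  refine ⟨N • l + g, Set.Subset.antisymm ?_ ?_⟩
  · intro y hy
    refine ⟨hFP (hGF hy), fun z hz => (hmax z hz).trans ?_⟩
    change N * l x + g x ≤ N * l y + g y
    rw [hlF y (hGF hy)]
    have : g x ≤ g y := by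
      rw [hg] at hy
      exact hy.2 x hxF
    linarith
  -- The set of maximizers is itself exposed, hence the hull of its points in `s`, and these lie in
  -- `G`.
  · have hexp : IsExposed ℝ (convexHull ℝ s)
        {y ∈ convexHull ℝ s | ∀ z ∈ convexHull ℝ s, (N • l + g) z ≤ (N • l + g) y} :=
      fun _ => ⟨N • l + g, rfl⟩
    rw [exposed_eq_convexHull hs hexp]
    refine convexHull_min ?_ hGconv
    rintro v ⟨⟨hv, hv'⟩, hvs⟩
    exact (hle v hvs).2 (le_antisymm (hle v hvs).1 (hv' x (hFP hxF)))

theorem relInt_nonempty {F : Set (Euc n)} (hF : Convex ℝ F) (hne : F.Nonempty) :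
    (relInt F).Nonempty := by
  obtain ⟨_, y, hy, rfl⟩ := hne.intrinsicInterior hF
  obtain ⟨r, hr, hball⟩ := Metric.mem_nhds_iff.1 (mem_interior_iff_mem_nhds.1 hy)
  refine ⟨y, r, hr, fun v hv hvr => ?_⟩
  have hmem : (y : Euc n) + v ∈ affineSpan ℝ F := by
    rw [add_comm]
    exact AffineSubspace.vadd_mem_of_mem_direction hv y.2
  have hd : (⟨y + v, hmem⟩ : affineSpan ℝ F) ∈ Metric.ball y r := by
    rw [Metric.mem_ball, Subtype.dist_eq, dist_eq_norm, add_sub_cancel_left]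
    exact hvr
  exact hball hd

/-- A convex set translated to its direction space. -/
def sectionAt (F : Set (Euc n)) (x : Euc n) : Set (dirSpace F) := {v | x + (v : Euc n) ∈ F}

theorem convex_sectionAt {F : Set (Euc n)} (hF : Convex ℝ F) (x : Euc n) :
    Convex ℝ (sectionAt F x) := by
  intro v hv w hw a b ha hb hab
  have := hF hv hw ha hb hab
  change x + ((a • v + b • w : dirSpace F) : Euc n) ∈ F
  convert this using 1
  rw [smul_add, smul_add, add_add_add_comm, ← add_smul, hab, one_smul]
  rfl

theorem mem_interior_sectionAt {F : Set (Euc n)} {x : Euc n} {v : dirSpace F} :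
    v ∈ interior (sectionAt F x) ↔ x + (v : Euc n) ∈ relInt F := by
  rw [mem_interior_iff_mem_nhds, Metric.mem_nhds_iff]
  constructor
  · rintro ⟨r, hr, h⟩
    refine ⟨r, hr, fun w hw hwr => ?_⟩
    have hd : v + ⟨w, hw⟩ ∈ Metric.ball v r := by
      rw [mem_ball_iff_norm, add_sub_cancel_left]
      exact hwr
    have h1 : x + ((v : Euc n) + w) ∈ F := h hd
    rwa [add_assoc]
  · rintro ⟨r, hr, h⟩
    refine ⟨r, hr, fun w hw => ?_⟩
    have h1 := h ((w : Euc n) - v) (Submodule.sub_mem _ w.2 v.2) (mem_ball_iff_norm.1 hw)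
    rw [add_add_sub_cancel] at h1
    exact h1

/-- A point outside the relative interior lies in a proper face. -/
theorem exists_exposed_of_not_mem_relInt {F : Set (Euc n)} (hF : Convex ℝ F) {x : Euc n}
    (hx : x ∈ F) (hx' : x ∉ relInt F) :
    ∃ G, IsExposed ℝ F G ∧ x ∈ G ∧
      Module.finrank ℝ (dirSpace G) < Module.finrank ℝ (dirSpace F) := by
  obtain ⟨z, hz⟩ := relInt_nonempty hF ⟨x, hx⟩
  have hzx : z - x ∈ dirSpace F := sub_mem_dirSpace hx (relInt_subset F hz)
  have hA := convex_sectionAt hF x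
  have hz' : (⟨z - x, hzx⟩ : dirSpace F) ∈ interior (sectionAt F x) := by
    rw [mem_interior_sectionAt]
    simpa using hz
  have h0 : (0 : dirSpace F) ∉ interior (sectionAt F x) := by
    rw [mem_interior_sectionAt]
    simpa using hx'
  -- A functional on the direction space that is negative on the interior of the section at `x`,
  -- hence nonpositive on the whole section.
  obtain ⟨f, hf⟩ := geometric_hahn_banach_open_point hA.interior isOpen_interior h0
  have hf' : ∀ v ∈ sectionAt F x, f v ≤ 0 := by
    intro v hv
    have hcl : v ∈ closure (interior (sectionAt F x)) := by
      rw [hA.closure_interior_eq_closure_of_nonempty_interior ⟨_, hz'⟩]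
      exact subset_closure hv
    have hclosed : IsClosed {v | f v ≤ 0} := isClosed_le f.continuous continuous_const
    exact closure_minimal (fun w hw => (by simpa using (hf w hw).le)) hclosed hcl
  let g : StrongDual ℝ (Euc n) := f.comp (dirSpace F).orthogonalProjectionOnto
  have hg : ∀ v : dirSpace F, g v = f v := fun v =>
    congrArg f (Submodule.orthogonalProjectionOnto_mem_subspace_eq_self v)
  have hgx : ∀ y ∈ F, g y ≤ g x := by
    intro y hy
    have h1 := hf' ⟨y - x, sub_mem_dirSpace hx hy⟩ (by
      change x + (y - x) ∈ F
      rwa [add_sub_cancel])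
    rw [← hg] at h1
    change g (y - x) ≤ 0 at h1
    rw [map_sub] at h1
    linarith
  refine ⟨{y ∈ F | ∀ w ∈ F, g w ≤ g y}, fun _ => ⟨g, rfl⟩, ⟨hx, hgx⟩, ?_⟩
  refine Submodule.finrank_lt_finrank_of_lt (lt_of_le_of_ne (dirSpace_mono fun y hy => hy.1) ?_)
  intro heq
  -- If the dimension did not drop, `g` would vanish on all of `dirSpace F`, whereas it is negative
  -- at `z - x`.
  have hker : dirSpace {y ∈ F | ∀ w ∈ F, g w ≤ g y} ≤ LinearMap.ker g.toLinearMap :=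
    dirSpace_le_ker fun y hy w hw => le_antisymm (hw.2 y hy.1) (hy.2 w hw.1)
  rw [heq] at hker
  have h1 : g (z - x) = 0 := hker hzx
  have h2 := hf _ hz'
  rw [← hg, map_zero] at h2
  exact h2.ne h1

/-- Descent on the dimension: a point outside the relative interior lies in a face of smaller
dimension, which is again a face of `P`. -/
theorem IsPolytope.exists_face_relInt {P : Set (Euc n)} (hP : IsPolytope P) {x : Euc n}
    (hx : x ∈ P) : ∃ F, IsExposed ℝ P F ∧ x ∈ relInt F := by
  have key : ∀ d : ℕ, ∀ F, IsExposed ℝ P F → x ∈ F → Module.finrank ℝ (dirSpace F) = d →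
      ∃ F, IsExposed ℝ P F ∧ x ∈ relInt F := by
    intro d
    induction d using Nat.strong_induction_on with
    | _ d ih =>
      intro F hF hxF hd
      by_cases h : x ∈ relInt F
      · exact ⟨F, hF, h⟩
      · obtain ⟨G, hG, hxG, hlt⟩ := exists_exposed_of_not_mem_relInt (hF.convex hP.convex) hxF h
        exact ih _ (hd ▸ hlt) G (hP.isExposed_trans hF hG) hxG rfl
  exact key _ P (IsExposed.refl P) hx rfl

theorem eq_of_mem_relInt {P F G : Set (Euc n)} (hF : IsExposed ℝ P F) (hG : IsExposed ℝ P G)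
    {x : Euc n} (hxF : x ∈ relInt F) (hxG : x ∈ relInt G) : F = G := by
  have key : ∀ {F G : Set (Euc n)}, IsExposed ℝ P F → IsExposed ℝ P G → x ∈ relInt F → x ∈ G →
      F ⊆ G := by
    intro F G hF hG hxF hxG y hy
    obtain ⟨l, hl⟩ := hG ⟨x, hxG⟩
    rw [hl] at hxG ⊢
    have hFP : F ⊆ P := hF.subset
    refine ⟨hFP hy, fun w hw => (hxG.2 w hw).trans ?_⟩
    obtain ⟨r, hr, h⟩ := hxF
    -- Since `x` is relatively interior to `F`, the segment from `y` can be prolonged beyond `x`. A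
    -- functional maximal at `x` is then not smaller at `y`.
    obtain ⟨ε, hε, hεr⟩ : ∃ ε : ℝ, 0 < ε ∧ ‖(-ε) • (y - x)‖ < r := by
      refine ⟨r / (2 * (‖y - x‖ + 1)), by positivity, ?_⟩
      rw [norm_smul, norm_neg, Real.norm_eq_abs, abs_of_pos (by positivity), div_mul_eq_mul_div,
        div_lt_iff₀ (by positivity)]
      nlinarith [norm_nonneg (y - x)]
    have hxF : x ∈ F := relInt_subset F ⟨r, hr, h⟩
    have h1 := hxG.2 _ (hFP (h _ (Submodule.smul_mem _ _ (sub_mem_dirSpace hxF hy)) hεr))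
    rw [map_add, map_smul, map_sub, smul_eq_mul] at h1
    nlinarith
  exact Set.Subset.antisymm (key hF hG hxF (relInt_subset G hxG))
    (key hG hF hxG (relInt_subset F hxF))

/-! ### Decomposition of a locally defined measure into the contributions of the faces -/

/-- A linear functional whose maximum over `P` is attained at a relative interior point of `F` is
constant on `F`. So a normal at one such point is a normal at the whole face. -/
theorem mem_unitNormals_of_mem_relInt {P F : Set (Euc n)} (hFP : F ⊆ P) {x : Euc n}
    (hx : x ∈ relInt F) {u : Sph n} (hu : ∀ y ∈ P, ⟪y - x, (u : Euc n)⟫ ≤ 0) :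
    u ∈ unitNormals P F := by
  have hxF := relInt_subset F hx
  obtain ⟨r, hr, h⟩ := hx
  have h0 : ∀ y ∈ F, ⟪y - x, (u : Euc n)⟫ = 0 := by
    intro y hy
    obtain ⟨ε, hε, hεr⟩ : ∃ ε : ℝ, 0 < ε ∧ ‖(-ε) • (y - x)‖ < r := by
      refine ⟨r / (2 * (‖y - x‖ + 1)), by positivity, ?_⟩
      rw [norm_smul, norm_neg, Real.norm_eq_abs, abs_of_pos (by positivity), div_mul_eq_mul_div,
        div_lt_iff₀ (by positivity)]
      nlinarith [norm_nonneg (y - x)]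
    have h1 := hu _ (hFP (h _ (Submodule.smul_mem _ _ (sub_mem_dirSpace hxF hy)) hεr))
    rw [add_sub_cancel_left, inner_smul_left] at h1
    simp only [conj_trivial] at h1
    have h2 := hu y (hFP hy)
    nlinarith
  intro y hy z hz
  have h1 := hu z hz
  have h2 : z - y = (z - x) - (y - x) := by abel
  rw [h2, inner_sub_left, h0 y hy]
  linarith

/-- The unit vectors orthogonal to `L`. -/
def normalSphere (L : Submodule ℝ (Euc n)) : Set (Sph n) := {u | (u : Euc n) ∈ Lᗮ}

theorem isClosed_normalSphere (L : Submodule ℝ (Euc n)) : IsClosed (normalSphere L) :=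
  Lᗮ.closed_of_finiteDimensional.preimage continuous_subtype_val

theorem unitNormals_subset_normalSphere {P F : Set (Euc n)} (hFP : F ⊆ P) :
    unitNormals P F ⊆ normalSphere (dirSpace F) := by
  intro u hu
  have hle : dirSpace F ≤ LinearMap.ker ((innerₛₗ ℝ (u : Euc n))) := by
    refine dirSpace_le_ker fun x hx y hy => ?_
    have h1 := hu x hx y (hFP hy)
    have h2 := hu y hy x (hFP hx)
    rw [inner_sub_left] at h1 h2
    change ⟪(u : Euc n), x⟫ = ⟪(u : Euc n), y⟫
    rw [real_inner_comm x, real_inner_comm y]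
    linarith
  intro w hw
  rw [real_inner_comm]
  exact hle hw

theorem isClosed_unitNormals (P F : Set (Euc n)) : IsClosed (unitNormals P F) := by
  have : unitNormals P F = ⋂ x ∈ F, ⋂ y ∈ P, {u : Sph n | ⟪y - x, (u : Euc n)⟫ ≤ 0} := by
    ext u
    simp [unitNormals]
  rw [this]
  refine isClosed_biInter fun x _ => isClosed_biInter fun y _ => isClosed_le ?_ continuous_const
  fun_prop

theorem measurableSet_relInt {F : Set (Euc n)} (hF : IsClosed F) : MeasurableSet (relInt F) := by
  have : relInt F = ⋃ m : ℕ, ⋂ v ∈ {v : Euc n | v ∈ dirSpace F ∧ ‖v‖ < 1 / ((m : ℝ) + 1)},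
      (fun x => x + v) ⁻¹' F := by
    ext x
    simp only [Set.mem_iUnion, Set.mem_iInter, Set.mem_preimage, Set.mem_ofPred_eq]
    constructor
    · rintro ⟨r, hr, h⟩
      obtain ⟨m, hm⟩ := exists_nat_one_div_lt hr
      exact ⟨m, fun v hv => h v hv.1 (hv.2.trans hm)⟩
    · rintro ⟨m, hm⟩
      exact ⟨1 / ((m : ℝ) + 1), Nat.one_div_pos_of_nat, fun v hv hvr => hm v ⟨hv, hvr⟩⟩
  rw [this]
  refine MeasurableSet.iUnion fun m => IsClosed.measurableSet ?_
  exact isClosed_biInter fun v _ => hF.preimage (continuous_add_const v)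

/-- The part of the normal bundle of `P` over the relative interior of the face `F`. -/
def cell (P F : Set (Euc n)) : Set (Sig n) := relInt F ×ˢ unitNormals P F

theorem measurableSet_cell {P F : Set (Euc n)} (hF : IsClosed F) : MeasurableSet (cell P F) :=
  (measurableSet_relInt hF).prod (isClosed_unitNormals P F).measurableSet

theorem finrank_lt_of_mem_normalSphere {L : Submodule ℝ (Euc n)} {u : Sph n}
    (hu : u ∈ normalSphere L) : Module.finrank ℝ L < n := by
  have := finrank_perp (L := L) hu (by simp)
  omega

/-- The first component determines the face with that point in its relative interior. Only
dimensions below `n` occur, because a full-dimensional face has no normals. -/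
theorem normalBundle_eq_iUnion {P : Set (Euc n)} (hP : IsPolytope P) :
    normalBundle P = ⋃ F ∈ (Finset.range n).biUnion (fun k => (faces_finite k hP).toFinset),
      cell P F := by
  ext ⟨x, u⟩
  simp only [Set.mem_iUnion, Finset.mem_biUnion, Finset.mem_range, Set.Finite.mem_toFinset,
    exists_prop]
  rw [mem_normalBundle_iff]
  constructor
  · rintro ⟨hx, hu⟩
    obtain ⟨F, hF, hxF⟩ := hP.exists_face_relInt hx
    have huF := mem_unitNormals_of_mem_relInt hF.subset hxF hu
    exact ⟨F, ⟨_, finrank_lt_of_mem_normalSphere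
      (unitNormals_subset_normalSphere hF.subset huF), ⟨x, relInt_subset F hxF⟩, hF, rfl⟩, hxF, huF⟩
  · rintro ⟨F, ⟨k, -, -, hF, -⟩, hx, hu⟩
    exact ⟨hF.subset (relInt_subset F hx), hu x (relInt_subset F hx)⟩

theorem faces_disjoint {k k' : ℕ} (h : k ≠ k') (P : Set (Euc n)) :
    Disjoint (faces k P) (faces k' P) :=
  Set.disjoint_left.2 fun _ hF hF' => h (hF.2.2.symm.trans hF'.2.2)

theorem cell_disjoint {P F G : Set (Euc n)} (hF : IsExposed ℝ P F) (hG : IsExposed ℝ P G)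
    (h : F ≠ G) : Disjoint (cell P F) (cell P G) :=
  Set.disjoint_left.2 fun _ hz hw => h (eq_of_mem_relInt hF hG hz.1 hw.1)

/-- Every face of a polytope spans its normal bundle on its own. -/
theorem prod_normalSphere_subset_normalBundle (F : Set (Euc n)) :
    F ×ˢ normalSphere (dirSpace F) ⊆ normalBundle F := by
  rintro ⟨x, u⟩ ⟨hx, hu⟩
  rw [mem_normalBundle_iff]
  exact ⟨hx, fun y hy => (hu _ (sub_mem_dirSpace hx hy)).le⟩

open Classical in
/-- The value of `Γ` at arbitrary sets, zero outside the domain of `Γ`. -/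
def LocalMap.eval (Γ : LocalMap n p) (P : Set (Euc n)) (η : Set (Sig n)) : SymTensor n p :=
  if h : IsPolytope P ∧ MeasurableSet η then Γ ⟨P, h.1⟩ ⟨η, h.2⟩ else 0

theorem LocalMap.eval_eq (Γ : LocalMap n p) {P : Set (Euc n)} {η : Set (Sig n)}
    (hP : IsPolytope P) (hη : MeasurableSet η) : Γ.eval P η = Γ ⟨P, hP⟩ ⟨η, hη⟩ :=
  dif_pos ⟨hP, hη⟩

theorem LocalMap.eval_congr {Γ : LocalMap n p} (hloc : IsLocallyDefined Γ) {P P' : Set (Euc n)}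
    {η : Set (Sig n)} (hP : IsPolytope P) (hP' : IsPolytope P') (h : η ⊆ normalBundle P)
    (h' : η ⊆ normalBundle P') : Γ.eval P η = Γ.eval P' η := by
  by_cases hη : MeasurableSet η
  · rw [Γ.eval_eq hP hη, Γ.eval_eq hP' hη]
    refine hloc _ _ _ _ ?_
    rw [Set.inter_eq_left.2 h, Set.inter_eq_left.2 h']
  · rw [eval, eval, dif_neg fun h => hη h.2, dif_neg fun h => hη h.2]

/-- The contribution of each face to `Γ(P, η)`. -/
theorem LocalMap.eq_sum_faces {Γ : LocalMap n p} (hmeas : IsMeasureValued Γ)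
    (hloc : IsLocallyDefined Γ) (P : Polytope n) (η : BorelSet n) :
    Γ P η = ∑ k ∈ Finset.range n, ∑ F ∈ (faces_finite k P.2).toFinset,
      Γ.eval F (η.1 ∩ cell P.1 F) := by
  classical
  obtain ⟨μ, hμ⟩ := hmeas P
  have hclosed : ∀ k, ∀ F ∈ faces k P.1, IsClosed F := fun k F hF =>
    (P.2.of_mem_faces hF).isCompact.isClosed
  have hcm : ∀ F ∈ (Finset.range n).biUnion (fun k => (faces_finite k P.2).toFinset),
      MeasurableSet (η.1 ∩ cell P.1 F) := by
    intro F hF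
    simp only [Finset.mem_biUnion, Set.Finite.mem_toFinset] at hF
    obtain ⟨k, -, hF⟩ := hF
    exact η.2.inter (measurableSet_cell (hclosed k F hF))
  have hN : MeasurableSet (η.1 ∩ normalBundle P.1) := by
    rw [normalBundle_eq_iUnion P.2, Set.inter_iUnion₂]
    exact Finset.measurableSet_biUnion _ hcm
  have h1 : Γ P η = μ (η.1 ∩ normalBundle P.1) := by
    rw [← hμ ⟨_, hN⟩]
    refine hloc _ _ _ _ ?_
    rw [Set.inter_assoc, Set.inter_self]
  rw [h1, normalBundle_eq_iUnion P.2, Set.inter_iUnion₂, VectorMeasure.of_biUnion_finset _ hcm,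
    Finset.sum_biUnion]
  · refine Finset.sum_congr rfl fun k _ => Finset.sum_congr rfl fun F hF => ?_
    rw [Set.Finite.mem_toFinset] at hF
    have hm : MeasurableSet (η.1 ∩ cell P.1 F) := η.2.inter (measurableSet_cell (hclosed k F hF))
    -- The part of `η` in the cell lies in the normal bundles of both `P` and `F`, so locality
    -- replaces `P` by `F`.
    rw [← hμ ⟨_, hm⟩, ← Γ.eval_eq P.2 hm]
    refine eval_congr hloc P.2 (P.2.of_mem_faces hF) ?_ ?_
    · rintro ⟨x, u⟩ ⟨-, hx, hu⟩
      rw [mem_normalBundle_iff]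
      exact ⟨hF.2.1.subset (relInt_subset F hx), hu x (relInt_subset F hx)⟩
    · rintro ⟨x, u⟩ ⟨-, hx, hu⟩
      exact prod_normalSphere_subset_normalBundle F
        ⟨relInt_subset F hx, unitNormals_subset_normalSphere hF.2.1.subset hu⟩
  · intro k _ k' _ hkk'
    rw [Function.onFun, Set.Finite.disjoint_toFinset]
    exact faces_disjoint hkk' _
  · intro F hF G hG hFG
    simp only [Finset.coe_biUnion, Set.Finite.coe_toFinset, Set.mem_iUnion] at hF hG
    obtain ⟨_, -, hF⟩ := hF
    obtain ⟨_, -, hG⟩ := hG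
    exact (cell_disjoint hF.2.1 hG.2.1 hFG).mono Set.inter_subset_right Set.inter_subset_right

/-! ### Relative balls and their transport by rigid motions -/

/-- The ball of radius `r` about `x` in `x + L`. -/
def relBall (L : Submodule ℝ (Euc n)) (x : Euc n) (r : ℝ) : Set (Euc n) :=
  {y | y - x ∈ L ∧ ‖y - x‖ < r}

/-- The spherical cap of radius `r` about `u` in the unit sphere of `Lᗮ`. -/
def cap (L : Submodule ℝ (Euc n)) (u : Sph n) (r : ℝ) : Set (Sph n) :=
  {v | v ∈ normalSphere L ∧ ‖(v : Euc n) - u‖ < r}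

/-- The points of `F` whose relative `r`-ball is contained in `F`. -/
def deep (F : Set (Euc n)) (r : ℝ) : Set (Euc n) :=
  {x | ∀ v ∈ dirSpace F, ‖v‖ < r → x + v ∈ F}

theorem measurableSet_relBall (L : Submodule ℝ (Euc n)) (x : Euc n) (r : ℝ) :
    MeasurableSet (relBall L x r) := by
  refine MeasurableSet.inter ?_ ?_
  · exact (L.closed_of_finiteDimensional.preimage (continuous_id.sub
      continuous_const)).measurableSet
  · exact (isOpen_lt (f := fun y : Euc n => ‖y - x‖) (by fun_prop) continuous_const).measurableSet

theorem measurableSet_cap (L : Submodule ℝ (Euc n)) (u : Sph n) (r : ℝ) :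
    MeasurableSet (cap L u r) := by
  refine (isClosed_normalSphere L).measurableSet.inter ?_
  exact (isOpen_lt (f := fun v : Sph n => ‖(v : Euc n) - u‖) (by fun_prop)
    continuous_const).measurableSet

theorem image_relBall (L : Submodule ℝ (Euc n)) (x y : Euc n) (r : ℝ) (θ : Euc n ≃ₗᵢ[ℝ] Euc n) :
    (fun z => θ z + (y - θ x)) '' relBall L x r =
      relBall (L.map (θ.toLinearEquiv : Euc n →ₗ[ℝ] Euc n)) y r := by
  ext z
  constructor
  · rintro ⟨w, ⟨hw, hwr⟩, rfl⟩
    have h : θ w + (y - θ x) - y = θ (w - x) := by rw [map_sub]; abel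
    refine ⟨?_, ?_⟩
    · rw [h]
      exact ⟨w - x, hw, rfl⟩
    · rwa [h, θ.norm_map]
  · rintro ⟨⟨v, hv, hvz⟩, hzr⟩
    have hvz' : θ v = z - y := hvz
    refine ⟨x + v, ⟨by simpa using hv, ?_⟩, ?_⟩
    · rw [add_sub_cancel_left, ← θ.norm_map, hvz']
      exact hzr
    · change θ (x + v) + (y - θ x) = z
      rw [map_add, hvz']
      abel

theorem image_cap (L : Submodule ℝ (Euc n)) (u : Sph n) (r : ℝ) (θ : Euc n ≃ₗᵢ[ℝ] Euc n) :
    sphMap θ '' cap L u r =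
      cap (L.map (θ.toLinearEquiv : Euc n →ₗ[ℝ] Euc n)) (sphMap θ u) r := by
  have hmem : ∀ w : Euc n, θ w ∈ (L.map (θ.toLinearEquiv : Euc n →ₗ[ℝ] Euc n))ᗮ ↔ w ∈ Lᗮ := by
    intro w
    constructor
    · intro h v hv
      rw [← θ.inner_map_map]
      exact h _ ⟨v, hv, rfl⟩
    · rintro h _ ⟨v, hv, rfl⟩
      exact (θ.inner_map_map v w).trans (h v hv)
  ext z
  constructor
  · rintro ⟨w, ⟨hw, hwr⟩, rfl⟩
    refine ⟨(hmem _).2 hw, ?_⟩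
    change ‖θ (w : Euc n) - θ (u : Euc n)‖ < r
    rwa [← map_sub, θ.norm_map]
  · rintro ⟨hz, hzr⟩
    have hz' : sphMap θ (sphMap θ.symm z) = z := Subtype.ext (θ.apply_symm_apply _)
    refine ⟨sphMap θ.symm z, ⟨(hmem _).1 ?_, ?_⟩, hz'⟩
    · change θ (θ.symm (z : Euc n)) ∈ _
      rw [θ.apply_symm_apply]
      exact hz
    · rw [← θ.norm_map, map_sub]
      change ‖θ (θ.symm (z : Euc n)) - θ (u : Euc n)‖ < r
      rw [θ.apply_symm_apply]
      exact hzr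

theorem relBall_subset_of_mem_deep {F : Set (Euc n)} {x : Euc n} {r : ℝ} (hx : x ∈ deep F r) :
    relBall (dirSpace F) x r ⊆ F := by
  rintro y ⟨hy, hyr⟩
  simpa using hx _ hy hyr

/-! ### The values of `Γ` on products of balls and caps -/

variable {Γ : LocalMap n p}

/-- Rigid motions transport the value of `Γ` at products of relative balls and caps. -/
theorem LocalMap.eval_ball_transport (htrans : IsTranslationInvariant Γ) (hrot : IsSOCovariant Γ)
    (hloc : IsLocallyDefined Γ) {F F' : Set (Euc n)} (hF : IsPolytope F) (hF' : IsPolytope F')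
    {x x' : Euc n} {u u' : Sph n} {r : ℝ} (hx : x ∈ deep F r) (hx' : x' ∈ deep F' r)
    {θ : Euc n ≃ₗᵢ[ℝ] Euc n} (hθ : IsRotation θ)
    (hL : (dirSpace F).map (θ.toLinearEquiv : Euc n →ₗ[ℝ] Euc n) = dirSpace F')
    (hu : θ u = u') :
    Γ.eval F' (relBall (dirSpace F') x' r ×ˢ cap (dirSpace F') u' r) =
      (Γ.eval F (relBall (dirSpace F) x r ×ˢ cap (dirSpace F) u r)).rotate θ := by
  have hm : MeasurableSet (relBall (dirSpace F) x r ×ˢ cap (dirSpace F) u r) :=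
    (measurableSet_relBall _ _ _).prod (measurableSet_cap _ _ _)
  have hm' : MeasurableSet (relBall (dirSpace F') x' r ×ˢ cap (dirSpace F') u' r) :=
    (measurableSet_relBall _ _ _).prod (measurableSet_cap _ _ _)
  rw [Γ.eval_eq hF hm, ← hrot _ _ θ hθ, ← htrans _ _ (x' - θ x)]
  have hu' : sphMap θ u = u' := Subtype.ext hu
  have hset : ((BorelSet.rotate ⟨_, hm⟩ θ).translate (x' - θ x)).1 =
      relBall (dirSpace F') x' r ×ˢ cap (dirSpace F') u' r := by
    rw [← hL, ← hu', ← image_cap, ← image_relBall, Set.prod_image_image_eq]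
    exact Set.image_image _ _ _
  have hset' : (BorelSet.rotate ⟨_, hm⟩ θ).translate (x' - θ x) = ⟨_, hm'⟩ := Subtype.ext hset
  rw [hset', ← Γ.eval_eq (Polytope.translate (Polytope.rotate ⟨F, hF⟩ θ) (x' - θ x)).2 hm']
  -- The moved copy of `F` and `F'` are different polytopes, but both normal bundles contain the
  -- product of ball and cap.
  refine eval_congr hloc hF' (Polytope.translate (Polytope.rotate ⟨F, hF⟩ θ) (x' - θ x)).2 ?_ ?_
  · exact (Set.prod_mono (relBall_subset_of_mem_deep hx') fun v hv => hv.1).trans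
      (prod_normalSphere_subset_normalBundle F')
  · rintro ⟨y, v⟩ ⟨hy, hv⟩
    rw [mem_normalBundle_iff]
    have himg : y ∈ (fun z => θ z + (x' - θ x)) '' F := by
      rw [← hL, ← image_relBall _ x] at hy
      exact Set.image_mono (relBall_subset_of_mem_deep hx) hy
    have hval : (Polytope.translate (Polytope.rotate ⟨F, hF⟩ θ) (x' - θ x)).1 =
        (fun z => θ z + (x' - θ x)) '' F := Set.image_image _ _ _
    rw [hval]
    refine ⟨himg, ?_⟩
    obtain ⟨w, hw, rfl⟩ := himg
    rintro _ ⟨z, hz, rfl⟩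
    have h1 : θ z + (x' - θ x) - (θ w + (x' - θ x)) = θ (z - w) := by rw [map_sub]; abel
    simp only
    rw [h1]
    refine (hv.1 _ ?_).le
    rw [← hL]
    exact ⟨z - w, sub_mem_dirSpace hw hz, rfl⟩

theorem rotate_smul_sum {ι : Type*} (s : Finset ι) (a : ι → ℝ) (T : ι → SymTensor n p)
    (θ : Euc n ≃ₗᵢ[ℝ] Euc n) :
    (∑ i ∈ s, a i • T i).rotate θ = ∑ i ∈ s, a i • (T i).rotate θ := by
  refine diag_ext fun x => ?_
  rw [diag_rotate, map_sum, map_sum, Finset.sum_apply, Finset.sum_apply]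
  rfl

/-- On products of relative balls and caps, `Γ` is a combination of kernels with coefficients that
only depend on the radius. -/
theorem LocalMap.exists_eval_ball_eq (hn : 2 ≤ n) {k : ℕ} (hk : k < n)
    (htrans : IsTranslationInvariant Γ) (hrot : IsSOCovariant Γ)
    (hloc : IsLocallyDefined Γ) (r : ℝ) :
    ∃ a : (Submodule ℝ (Euc n) → Euc n → SymTensor n p) → ℝ,
      ∀ (F : Set (Euc n)) (x : Euc n) (u : Sph n), IsPolytope F →
        Module.finrank ℝ (dirSpace F) = k → x ∈ deep F r → u ∈ normalSphere (dirSpace F) →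
        Γ.eval F (relBall (dirSpace F) x r ×ˢ cap (dirSpace F) u r) =
          ∑ E ∈ (kernels_finite n p k).toFinset, a E • E (dirSpace F) u := by
  -- The coefficients are read off at one reference configuration and transported to all others; if
  -- none exists, any coefficients do.
  by_cases h : ∃ (F : Set (Euc n)) (x : Euc n) (u : Sph n), IsPolytope F ∧
        Module.finrank ℝ (dirSpace F) = k ∧ x ∈ deep F r ∧ u ∈ normalSphere (dirSpace F)
  swap
  · push Not at h
    exact ⟨0, fun F x u h1 h2 h3 h4 => absurd h4 (h F x u h1 h2 h3)⟩
  obtain ⟨F, x, u, hF, hFk, hx, hu⟩ := h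
  have hu1 : ‖(u : Euc n)‖ = 1 := by simp
  -- Transport of the reference configuration to itself.
  have hinv : IsStabilizerInvariant (dirSpace F) (u : Euc n)
      (Γ.eval F (relBall (dirSpace F) x r ×ˢ cap (dirSpace F) u r)) := fun θ hθ hL hθu =>
    (eval_ball_transport htrans hrot hloc hF hF hx hx hθ hL hθu).symm
  have hmem := hinv.mem_span_kernels hn hk hFk hu hu1
  rw [← (kernels_finite n p k).coe_toFinset] at hmem
  obtain ⟨a, ha⟩ := (Submodule.mem_span_image_finset_iff_exists_fun' ℝ).1 hmem
  refine ⟨a, fun F' x' u' hF' hFk' hx' hu' => ?_⟩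
  obtain ⟨θ, hθ, hL, hθu⟩ := exists_rotation hn (by omega) (hFk.trans hFk'.symm) hu hu' hu1
    (by simp)
  rw [eval_ball_transport htrans hrot hloc hF hF' hx hx' hθ hL hθu, ← ha, rotate_smul_sum]
  refine Finset.sum_congr rfl fun E hE => ?_
  rw [Set.Finite.mem_toFinset] at hE
  rw [← kernels_equivariant hE hFk _ hθ, hL, hθu]

/-! ### Hausdorff measure of faces and spheres -/

open scoped NNReal ENNReal

theorem hausdorff_image_le {X Y : Type*} [EMetricSpace X] [MeasurableSpace X] [BorelSpace X]
    [EMetricSpace Y] [MeasurableSpace Y] [BorelSpace Y] {K : ℝ≥0} {f : X → Y} {s : Set X}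
    (hf : LipschitzOnWith K f s) (d : ℕ) : μHE[d] (f '' s) ≤ (K : ℝ≥0∞) ^ d * μHE[d] s := by
  simp only [Measure.euclideanHausdorffMeasure_def, Measure.smul_apply, ENNReal.smul_def,
    smul_eq_mul]
  rw [mul_left_comm]
  gcongr
  exact_mod_cast hf.hausdorffMeasure_image_le (d := d) (Nat.cast_nonneg d)

/-- The embedding of `L` onto its translate through `x`. -/
def translateMap (L : Submodule ℝ (Euc n)) (x : Euc n) (v : L) : Euc n := x + (v : Euc n)

theorem isometry_translateMap (L : Submodule ℝ (Euc n)) (x : Euc n) :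
    Isometry (translateMap L x) :=
  Isometry.of_dist_eq fun v w => by
    rw [translateMap, translateMap, dist_add_left]
    rfl

theorem hausdorff_image_translateMap {L : Submodule ℝ (Euc n)} {k : ℕ}
    (hL : Module.finrank ℝ L = k) (x : Euc n) (A : Set L) :
    μHE[k] (translateMap L x '' A) = volume A := by
  rw [(isometry_translateMap L x).euclideanHausdorffMeasure_image, ← hL,
    InnerProductSpace.euclideanHausdorffMeasure_eq_volume]

theorem relBall_eq_image (L : Submodule ℝ (Euc n)) (x : Euc n) (r : ℝ) :
    relBall L x r = translateMap L x '' Metric.ball 0 r := by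
  ext y
  constructor
  · rintro ⟨h, h'⟩
    exact ⟨⟨y - x, h⟩, mem_ball_zero_iff.2 h', add_sub_cancel x y⟩
  · rintro ⟨v, hv, rfl⟩
    rw [mem_ball_zero_iff] at hv
    refine ⟨?_, ?_⟩
    · rw [translateMap, add_sub_cancel_left]
      exact v.2
    · rw [translateMap, add_sub_cancel_left]
      exact hv

theorem hausdorff_relBall_pos {L : Submodule ℝ (Euc n)} {k : ℕ} (hL : Module.finrank ℝ L = k)
    (x : Euc n) {r : ℝ} (hr : 0 < r) : 0 < μHE[k] (relBall L x r) := by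
  rw [relBall_eq_image, hausdorff_image_translateMap hL]
  exact Metric.measure_ball_pos _ _ hr

theorem hausdorff_relBall_lt_top {L : Submodule ℝ (Euc n)} {k : ℕ} (hL : Module.finrank ℝ L = k)
    (x : Euc n) (r : ℝ) : μHE[k] (relBall L x r) < ∞ := by
  rw [relBall_eq_image, hausdorff_image_translateMap hL]
  exact measure_ball_lt_top

theorem hausdorff_polytope_lt_top {F : Set (Euc n)} {k : ℕ} (hF : IsPolytope F)
    (hk : Module.finrank ℝ (dirSpace F) = k) : μHE[k] F < ∞ := by
  obtain ⟨x, hx⟩ := hF.nonempty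
  obtain ⟨R, hR⟩ := hF.isCompact.isBounded.subset_ball x
  refine lt_of_le_of_lt (measure_mono fun y hy => ?_) (hausdorff_relBall_lt_top hk x R)
  exact ⟨sub_mem_dirSpace hx hy, mem_ball_iff_norm.1 (hR hy)⟩

theorem hausdorff_diff_relInt {F : Set (Euc n)} {k : ℕ} (hF : IsPolytope F)
    (hk : Module.finrank ℝ (dirSpace F) = k) : μHE[k] (F \ relInt F) = 0 := by
  obtain ⟨x, hx⟩ := hF.nonempty
  have hsub : F \ relInt F ⊆ translateMap (dirSpace F) x '' frontier (sectionAt F x) := by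
    rintro y ⟨hy, hy'⟩
    have h : x + (y - x) = y := add_sub_cancel x y
    refine ⟨⟨y - x, sub_mem_dirSpace hx hy⟩, ⟨subset_closure ?_, fun hint => hy' ?_⟩, h⟩
    · change x + (y - x) ∈ F
      rwa [h]
    · rw [mem_interior_sectionAt] at hint
      rwa [← h]
  refine measure_mono_null hsub ?_
  rw [hausdorff_image_translateMap hk]
  exact (convex_sectionAt hF.convex x).addHaar_frontier volume

theorem isometry_sphMap (θ : Euc n ≃ₗᵢ[ℝ] Euc n) : Isometry (sphMap θ) :=
  Isometry.of_dist_eq fun u v => θ.dist_map u v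

/-- The orthogonal projection to `perp L u` is 1-Lipschitz and maps the cap onto a set that contains
a ball of dimension `n - k - 1`. -/
theorem hausdorff_cap_pos {L : Submodule ℝ (Euc n)} {k : ℕ} (hL : Module.finrank ℝ L = k)
    {u : Sph n} (hu : u ∈ normalSphere L) {r : ℝ} (hr : 0 < r) :
    0 < μHE[n - k - 1] (cap L u r) := by
  have hu1 : ‖(u : Euc n)‖ = 1 := by simp
  have hd : Module.finrank ℝ (perp L (u : Euc n)) = n - k - 1 := by
    have := finrank_perp (L := L) hu hu1
    omega
  have hρ : 0 < min r 1 / 2 := by positivity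
  have hLip : LipschitzWith 1 (perp L (u : Euc n)).starProjection :=
    Submodule.lipschitzWith_starProjection _
  -- The point of the sphere over `w` is `w + c • u` with `c = √(1 - ‖w‖ ^ 2)`. Its distance to `u`
  -- is at most `‖w‖ + (1 - c) ≤ 2 ‖w‖ < r`.
  have hball : relBall (perp L (u : Euc n)) 0 (min r 1 / 2) ⊆
      (perp L (u : Euc n)).starProjection '' (Subtype.val '' cap L u r) := by
    rintro w ⟨hw, hwr⟩
    rw [sub_zero] at hw hwr
    have hwr' : ‖w‖ < r / 2 := hwr.trans_le (by gcongr; exact min_le_left _ _)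
    have hw1 : ‖w‖ < 1 / 2 := hwr.trans_le (by gcongr; exact min_le_right _ _)
    have hw0 := norm_nonneg w
    have hwm := mem_perp.1 hw
    have hpos : 0 ≤ 1 - ‖w‖ ^ 2 := by nlinarith
    have hs := Real.sq_sqrt hpos
    have hs0 := Real.sqrt_nonneg (1 - ‖w‖ ^ 2)
    set c := Real.sqrt (1 - ‖w‖ ^ 2)
    have hc1 : c ≤ 1 := by nlinarith [sq_nonneg ‖w‖]
    have hc2 : 1 - c ≤ ‖w‖ := by nlinarith
    have hnorm : ‖w + c • (u : Euc n)‖ = 1 := by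
      rw [← sq_eq_sq₀ (norm_nonneg _) zero_le_one, norm_add_sq_real, inner_smul_right, hwm.2,
        norm_smul, hu1, Real.norm_eq_abs, mul_one, sq_abs, hs]
      ring
    have hproj : (perp L (u : Euc n)).starProjection (w + c • (u : Euc n)) = w := by
      rw [map_add, map_smul, Submodule.starProjection_eq_self_iff.2 hw,
        (Submodule.starProjection_apply_eq_zero_iff _).2, smul_zero, add_zero]
      intro y hy
      exact (mem_perp.1 hy).2
    refine ⟨w + c • (u : Euc n), ⟨⟨w + c • (u : Euc n), by simpa using hnorm⟩, ⟨?_, ?_⟩, rfl⟩,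
      hproj⟩
    · exact Lᗮ.add_mem hwm.1 (Lᗮ.smul_mem _ hu)
    · change ‖w + c • (u : Euc n) - u‖ < r
      have h1 : w + c • (u : Euc n) - u = w - (1 - c) • (u : Euc n) := by
        rw [sub_smul, one_smul]
        abel
      have h2 : ‖(1 - c) • (u : Euc n)‖ = 1 - c := by
        rw [norm_smul, hu1, Real.norm_eq_abs, abs_of_nonneg (by linarith), mul_one]
      rw [h1]
      refine (norm_sub_le _ _).trans_lt ?_
      rw [h2]
      linarith
  have h1 := hausdorff_relBall_pos hd 0 hρ
  have h2 := h1.trans_le ((measure_mono hball).trans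
    (hausdorff_image_le (hLip.lipschitzOnWith) (n - k - 1)))
  rw [ENNReal.coe_one, one_pow, one_mul, isometry_subtype_coe.euclideanHausdorffMeasure_image] at h2
  exact h2

/-- The cap is contained in the radial projection of a ball in the tangent space at `u`. That
projection is 2-Lipschitz there, as all points `u + w` have norm at least one. -/
theorem hausdorff_cap_one_lt_top {L : Submodule ℝ (Euc n)} {k : ℕ} (hL : Module.finrank ℝ L = k)
    {u : Sph n} (hu : u ∈ normalSphere L) : μHE[n - k - 1] (cap L u 1) < ∞ := by
  have hu1 : ‖(u : Euc n)‖ = 1 := by simp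
  have hd : Module.finrank ℝ (perp L (u : Euc n)) = n - k - 1 := by
    have := finrank_perp (L := L) hu hu1
    omega
  have hge : ∀ w ∈ relBall (perp L (u : Euc n)) 0 3, 1 ≤ ‖(u : Euc n) + w‖ := by
    rintro w ⟨hw, -⟩
    rw [sub_zero] at hw
    have h := norm_add_sq_real (u : Euc n) w
    rw [real_inner_comm, (mem_perp.1 hw).2, hu1] at h
    nlinarith [norm_nonneg ((u : Euc n) + w), sq_nonneg ‖w‖]
  have hLip : LipschitzOnWith 2 (fun w => ‖(u : Euc n) + w‖⁻¹ • ((u : Euc n) + w))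
      (relBall (perp L (u : Euc n)) 0 3) := by
    refine LipschitzOnWith.of_dist_le_mul fun x hx y hy => ?_
    have hx1 := hge x hx
    have hy1 := hge y hy
    rw [dist_eq_norm, dist_eq_norm]
    have hxy : x - y = (u + x) - (u + y) := by abel
    rw [hxy]
    generalize (u : Euc n) + x = a at *
    generalize (u : Euc n) + y = b at *
    have h1 : ‖a‖⁻¹ • a - ‖b‖⁻¹ • b = ‖a‖⁻¹ • (a - b) + (‖a‖⁻¹ - ‖b‖⁻¹) • b := by
      rw [smul_sub, sub_smul]
      abel
    have ha0 : 0 < ‖a‖ := by linarith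
    have hb0 : 0 < ‖b‖ := by linarith
    have h2 : ‖a‖⁻¹ ≤ 1 := inv_le_one_of_one_le₀ hx1
    have h3 : ‖(‖a‖⁻¹ - ‖b‖⁻¹) • b‖ ≤ ‖a - b‖ := by
      rw [norm_smul, Real.norm_eq_abs, inv_sub_inv ha0.ne' hb0.ne', abs_div, abs_mul, abs_norm,
        abs_norm, div_mul_eq_mul_div, mul_div_mul_right _ _ hb0.ne', abs_sub_comm]
      refine (div_le_self (abs_nonneg _) hx1).trans (abs_norm_sub_norm_le a b)
    rw [h1]
    refine (norm_add_le _ _).trans ?_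
    rw [norm_smul, norm_inv, norm_norm]
    have h4 : ‖a‖⁻¹ * ‖a - b‖ ≤ 1 * ‖a - b‖ := by gcongr
    have h5 : ((2 : ℝ≥0) : ℝ) = 2 := rfl
    rw [h5]
    linarith
  have hsub : Subtype.val '' cap L u 1 ⊆ (fun w => ‖(u : Euc n) + w‖⁻¹ • ((u : Euc n) + w)) ''
      relBall (perp L (u : Euc n)) 0 3 := by
    rintro _ ⟨v, ⟨hv, hvu⟩, rfl⟩
    have hv1 : ‖(v : Euc n)‖ = 1 := by simp
    have h1 := norm_sub_sq_real (v : Euc n) u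
    rw [hv1, hu1] at h1
    -- This accounts for the radius `3`: the preimage `c⁻¹ • v - u` has norm at most `c⁻¹ + 1 < 3`.
    have hc : 1 / 2 < ⟪(v : Euc n), (u : Euc n)⟫ := by
      nlinarith [norm_nonneg ((v : Euc n) - u)]
    set c := ⟪(v : Euc n), (u : Euc n)⟫
    have hc0 : 0 < c := by linarith
    have hcc : c⁻¹ < 2 := by
      rw [inv_lt_comm₀ hc0 two_pos]
      linarith
    refine ⟨c⁻¹ • (v : Euc n) - u, ⟨?_, ?_⟩, ?_⟩
    · rw [sub_zero, mem_perp]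
      refine ⟨Lᗮ.sub_mem (Lᗮ.smul_mem _ hv) hu, ?_⟩
      rw [inner_sub_left, inner_smul_left, real_inner_self_eq_norm_sq, hu1]
      change c⁻¹ * c - 1 ^ 2 = 0
      rw [inv_mul_cancel₀ hc0.ne']
      norm_num
    · rw [sub_zero]
      refine (norm_sub_le _ _).trans_lt ?_
      rw [norm_smul, hv1, hu1, norm_inv, Real.norm_eq_abs, abs_of_pos hc0]
      linarith
    · simp only [add_sub_cancel]
      rw [norm_smul, hv1, mul_one, norm_inv, Real.norm_eq_abs, abs_of_pos hc0, inv_inv, smul_smul,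
        mul_inv_cancel₀ hc0.ne', one_smul]
  have h1 := (measure_mono hsub).trans (hausdorff_image_le hLip (n - k - 1))
  rw [isometry_subtype_coe.euclideanHausdorffMeasure_image] at h1
  refine h1.trans_lt (ENNReal.mul_lt_top ?_ (hausdorff_relBall_lt_top hd 0 3))
  exact ENNReal.pow_lt_top ENNReal.coe_lt_top

theorem hausdorff_normalSphere_lt_top {L : Submodule ℝ (Euc n)} {k : ℕ}
    (hL : Module.finrank ℝ L = k) : μHE[n - k - 1] (normalSphere L) < ∞ := by
  have hcomp : IsCompact (normalSphere L) := (isClosed_normalSphere L).isCompact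
  refine hcomp.induction_on (p := fun s => μHE[n - k - 1] (s ∩ normalSphere L) < ∞) ?_ ?_ ?_ ?_
    |>.trans_le' ?_
  · simp
  · exact fun s t hst ht => (measure_mono (Set.inter_subset_inter_left _ hst)).trans_lt ht
  · intro s t hs ht
    rw [Set.union_inter_distrib_right]
    exact (measure_union_le _ _).trans_lt (ENNReal.add_lt_top.2 ⟨hs, ht⟩)
  · intro u hu
    refine ⟨Metric.ball u 1, mem_nhdsWithin_of_mem_nhds (Metric.ball_mem_nhds _ one_pos), ?_⟩
    refine (measure_mono ?_).trans_lt (hausdorff_cap_one_lt_top hL hu)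
    rintro v ⟨hv, hv'⟩
    exact ⟨hv', by rwa [Metric.mem_ball, Subtype.dist_eq, dist_eq_norm] at hv⟩
  · rw [Set.inter_self]

/-- The product measure of a relative ball and a cap depends only on the radius. -/
theorem exists_ball_volume (hn : 2 ≤ n) {k : ℕ} (hk : k < n) {r : ℝ} (hr : 0 < r) :
    ∃ V : ℝ, 0 < V ∧ ∀ (L : Submodule ℝ (Euc n)) (x : Euc n) (u : Sph n),
      Module.finrank ℝ L = k → u ∈ normalSphere L →
      (μHE[k] (relBall L x r) * μHE[n - k - 1] (cap L u r)).toReal = V := by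
  by_cases h : ∃ (L : Submodule ℝ (Euc n)) (u : Sph n),
      Module.finrank ℝ L = k ∧ u ∈ normalSphere L
  swap
  · push Not at h
    exact ⟨1, one_pos, fun L x u h1 h2 => absurd h2 (h L u h1)⟩
  obtain ⟨L, u, hL, hu⟩ := h
  refine ⟨(μHE[k] (relBall L 0 r) * μHE[n - k - 1] (cap L u r)).toReal, ?_, ?_⟩
  · refine ENNReal.toReal_pos (ENNReal.mul_pos (hausdorff_relBall_pos hL 0 hr).ne'
      (hausdorff_cap_pos hL hu hr).ne').ne' (ENNReal.mul_lt_top (hausdorff_relBall_lt_top hL 0 r)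
      ((measure_mono fun v hv => hv.1).trans_lt (hausdorff_normalSphere_lt_top hL))).ne
  · intro L' x' u' hL' hu'
    obtain ⟨θ, -, hθL, hθu⟩ := exists_rotation hn (by omega) (hL.trans hL'.symm) hu hu'
      (by simp) (by simp)
    have hu'' : sphMap θ u = u' := Subtype.ext hθu
    have hiso : Isometry (fun z => θ z + (x' - θ 0)) :=
      Isometry.of_dist_eq fun a b => by rw [dist_add_right, θ.dist_map]
    rw [← hθL, ← hu'', ← image_cap, ← image_relBall L 0, hiso.euclideanHausdorffMeasure_image,
      (isometry_sphMap θ).euclideanHausdorffMeasure_image]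

/-! ### Smoothing of measures -/

open Filter Topology

/-- The averages of `φ` over small balls, integrated against `ν`, converge to `∫ φ dν`. -/
theorem tendsto_integral_ball_average {X : Type*} [PseudoMetricSpace X] [SecondCountableTopology X]
    [MeasurableSpace X] [BorelSpace X] (m ν : Measure X) [IsFiniteMeasure m] [IsFiniteMeasure ν]
    {φ : X → ℝ} (hφ : Continuous φ) {C : ℝ} (hC : ∀ z, |φ z| ≤ C) {Z : Set X}
    (hm : ∀ᵐ z ∂m, z ∈ Z) (hν : ∀ᵐ z ∂ν, z ∈ Z) {r V : ℕ → ℝ} (hr : Tendsto r atTop (𝓝 0))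
    (hr0 : ∀ j, 0 < r j) (hV : ∀ j, 0 < V j)
    (hball : ∀ᶠ j in atTop, ∀ z ∈ Z, ∀ z' ∈ Z, dist z z' < r j → φ z' ≠ 0 →
      m.real (Metric.ball z (r j)) = V j) :
    Tendsto (fun j => (V j)⁻¹ * ∫ z', φ z' * ν.real (Metric.ball z' (r j)) ∂m) atTop
      (𝓝 (∫ z, φ z ∂ν)) := by
  have hC0 : ∀ z : X, 0 ≤ C := fun z => (abs_nonneg _).trans (hC z)
  let U : ℕ → Set (X × X) := fun j => {q | dist q.1 q.2 < r j}
  have hU : ∀ j, MeasurableSet (U j) := fun j =>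
    (isOpen_lt (by fun_prop) continuous_const).measurableSet
  have hint : ∀ j, Integrable (fun q : X × X => (U j).indicator (fun q => φ q.2) q) (ν.prod m) := by
    intro j
    refine Integrable.of_bound (C := C) ?_ (Eventually.of_forall fun q => ?_)
    · exact ((hφ.comp continuous_snd).measurable.indicator (hU j)).aestronglyMeasurable
    · by_cases hq : q ∈ U j
      · rw [Set.indicator_of_mem hq]
        exact hC _
      · rw [Set.indicator_of_notMem hq, norm_zero]
        exact hC0 q.1
  -- Fubini moves the average from `ν` to `φ`.
  have hswap : ∀ j, ∫ z', φ z' * ν.real (Metric.ball z' (r j)) ∂m =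
      ∫ z, ∫ z', (U j).indicator (fun q => φ q.2) (z, z') ∂m ∂ν := by
    intro j
    rw [integral_integral_swap (hint j)]
    refine integral_congr_ae (Eventually.of_forall fun z' => ?_)
    have h1 : ∀ z, (U j).indicator (fun q => φ q.2) (z, z') =
        (Metric.ball z' (r j)).indicator (fun _ => φ z') z := fun z => rfl
    simp only [h1]
    rw [integral_indicator Metric.isOpen_ball.measurableSet, setIntegral_const, smul_eq_mul,
      mul_comm]
  have havg : ∀ j z, ∫ z', (U j).indicator (fun q => φ q.2) (z, z') ∂m =
      ∫ z' in Metric.ball z (r j), φ z' ∂m := by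
    intro j z
    have h1 : ∀ z', (U j).indicator (fun q => φ q.2) (z, z') =
        (Metric.ball z (r j)).indicator φ z' := fun z' => by
      simp only [Set.indicator, U, Metric.mem_ball, Set.mem_ofPred_eq, dist_comm z z']
    simp only [h1]
    rw [integral_indicator Metric.isOpen_ball.measurableSet]
  have hmain : ∀ j, (∀ z ∈ Z, ∀ z' ∈ Z, dist z z' < r j → φ z' ≠ 0 →
      m.real (Metric.ball z (r j)) = V j) → ∀ z ∈ Z, ∀ ε : ℝ,
      (∀ z', dist z' z < r j → |φ z' - φ z| ≤ ε) →
      |(V j)⁻¹ * (∫ z' in Metric.ball z (r j), φ z' ∂m) - φ z| ≤ ε := by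
    intro j hj z hz ε hε
    have hε0 : 0 ≤ ε := (abs_nonneg _).trans (hε z (by rw [dist_self]; exact hr0 j))
    -- If `φ` is nonzero somewhere on `Z` in the ball, the ball has mass `V j` and the expression is
    -- a true average. Otherwise both the integral and `φ z` vanish, so the mass of the ball is
    -- irrelevant.
    by_cases h : ∃ z' ∈ Z, dist z z' < r j ∧ φ z' ≠ 0
    · obtain ⟨z', hz', hd, hne⟩ := h
      have hmz := hj z hz z' hz' hd hne
      have hi : IntegrableOn φ (Metric.ball z (r j)) m :=
        (Integrable.of_bound (C := C) hφ.aestronglyMeasurable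
          (Eventually.of_forall hC)).integrableOn
      have h1 : (V j)⁻¹ * (∫ z' in Metric.ball z (r j), φ z' ∂m) - φ z =
          (V j)⁻¹ * ∫ z' in Metric.ball z (r j), (φ z' - φ z) ∂m := by
        rw [integral_sub hi (integrable_const _), setIntegral_const, hmz, smul_eq_mul, mul_sub,
          inv_mul_cancel_left₀ (hV j).ne']
      rw [h1, abs_mul, abs_of_pos (inv_pos.2 (hV j)), inv_mul_le_iff₀ (hV j)]
      have h2 := norm_setIntegral_le_of_norm_le_const (μ := m) (s := Metric.ball z (r j))
        (f := fun z' => φ z' - φ z) (C := ε) (measure_lt_top _ _) (fun z' hz' => hε z' hz')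
      rw [hmz] at h2
      rw [mul_comm]
      exact h2
    · push Not at h
      have h0 : φ z = 0 := h z hz (by rw [dist_self]; exact hr0 j)
      have h1 : ∫ z' in Metric.ball z (r j), φ z' ∂m = 0 := by
        refine setIntegral_eq_zero_of_ae_eq_zero ?_
        filter_upwards [hm] with z' hz' hb
        exact h z' hz' (by rw [dist_comm]; exact hb)
      rw [h0, h1, mul_zero, sub_zero, abs_zero]
      exact hε0
  have hrw : ∀ j, (V j)⁻¹ * ∫ z', φ z' * ν.real (Metric.ball z' (r j)) ∂m =
      ∫ z, (V j)⁻¹ * ∫ z' in Metric.ball z (r j), φ z' ∂m ∂ν := by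
    intro j
    rw [hswap, integral_const_mul]
    simp only [havg]
  simp only [hrw]
  refine tendsto_integral_filter_of_dominated_convergence (fun _ => 3 * C)
    (Eventually.of_forall fun j => ?_) ?_ (integrable_const _) ?_
  · have := (hint j).integral_prod_left.aestronglyMeasurable
    simp only [havg] at this
    exact this.const_mul _
  · filter_upwards [hball] with j hj
    filter_upwards [hν] with z hz
    have h1 := hmain j hj z hz (2 * C) fun z' _ => by
      have := abs_sub (φ z') (φ z)
      linarith [hC z, hC z']
    have h2 := abs_sub_abs_le_abs_sub ((V j)⁻¹ * (∫ z' in Metric.ball z (r j), φ z' ∂m)) (φ z)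
    rw [Real.norm_eq_abs]
    linarith [hC z]
  · filter_upwards [hν] with z hz
    rw [Metric.tendsto_nhds]
    intro ε hε
    obtain ⟨δ, hδ, hδ'⟩ := Metric.continuous_iff.1 hφ z (ε / 2) (half_pos hε)
    filter_upwards [hball, hr.eventually_lt_const hδ] with j hj hjδ
    rw [Real.dist_eq]
    refine (hmain j hj z hz (ε / 2) fun z' hz' => ?_).trans_lt (half_lt_self hε)
    have := hδ' z' (hz'.trans hjδ)
    rw [Real.dist_eq] at this
    exact this.le

/-- Measures are determined by the integrals of bounded continuous functions; a version for
differences of measures. -/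
theorem measure_sub_eq_setIntegral {X : Type*} [PseudoMetricSpace X] [MeasurableSpace X]
    [BorelSpace X] (ν₁ ν₂ m : Measure X) [IsFiniteMeasure ν₁] [IsFiniteMeasure ν₂]
    [IsFiniteMeasure m] {g : X → ℝ} (hgm : Measurable g) (hg : Integrable g m)
    (h : ∀ ψ : BoundedContinuousFunction X ℝ,
      ∫ z, ψ z ∂ν₁ - ∫ z, ψ z ∂ν₂ = ∫ z, ψ z * g z ∂m)
    {η : Set X} (hη : MeasurableSet η) : ν₁.real η - ν₂.real η = ∫ z in η, g z ∂m := by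
  have hpm : Measurable fun z => (g z).toNNReal := hgm.real_toNNReal
  have hnm : Measurable fun z => (-g z).toNNReal := hgm.neg.real_toNNReal
  let p : Measure X := m.withDensity fun z => ((g z).toNNReal : ENNReal)
  let q : Measure X := m.withDensity fun z => ((-g z).toNNReal : ENNReal)
  have : IsFiniteMeasure p := isFiniteMeasure_withDensity_ofReal hg.2
  have : IsFiniteMeasure q := isFiniteMeasure_withDensity_ofReal hg.neg.2
  have hsub : ∀ z, ((g z).toNNReal : ℝ) - ((-g z).toNNReal : ℝ) = g z := fun z => by
    rw [Real.coe_toNNReal', Real.coe_toNNReal', max_zero_sub_eq_self]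
  have hpi : Integrable (fun z => ((g z).toNNReal : ℝ)) m := hg.real_toNNReal
  have hni : Integrable (fun z => ((-g z).toNNReal : ℝ)) m := hg.neg.real_toNNReal
  -- Sorting by sign gives an equation between finite positive measures, to which uniqueness by
  -- bounded continuous functions applies.
  have key : ν₁ + q = ν₂ + p := by
    refine ext_of_forall_integral_eq_of_IsFiniteMeasure fun ψ => ?_
    rw [integral_add_measure (ψ.integrable _) (ψ.integrable _),
      integral_add_measure (ψ.integrable _) (ψ.integrable _),
      integral_withDensity_eq_integral_smul hpm, integral_withDensity_eq_integral_smul hnm]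
    have h1 : ∫ z, (g z).toNNReal • ψ z ∂m - ∫ z, (-g z).toNNReal • ψ z ∂m =
        ∫ z, ψ z * g z ∂m := by
      rw [← integral_sub]
      · refine integral_congr_ae (Eventually.of_forall fun z => ?_)
        simp only [NNReal.smul_def, smul_eq_mul]
        rw [← sub_mul, hsub, mul_comm]
      · exact hpi.mul_bdd (c := ‖ψ‖) ψ.continuous.aestronglyMeasurable
          (Eventually.of_forall ψ.norm_coe_le_norm)
      · exact hni.mul_bdd (c := ‖ψ‖) ψ.continuous.aestronglyMeasurable
          (Eventually.of_forall ψ.norm_coe_le_norm)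
    linarith [h ψ]
  have hval : ∀ {f : X → NNReal}, Measurable f → (m.withDensity fun z => (f z : ENNReal)).real η =
      ∫ z in η, (f z : ℝ) ∂m := by
    intro f hf
    have h1 := setIntegral_withDensity_eq_setIntegral_smul (μ := m) hf (fun _ => (1 : ℝ)) hη
    rw [setIntegral_const] at h1
    simpa [NNReal.smul_def] using h1
  have hreal : ν₁.real η + q.real η = ν₂.real η + p.real η := by
    rw [← measureReal_add_apply, ← measureReal_add_apply, key]
  have h2 : p.real η - q.real η = ∫ z in η, g z ∂m := by
    rw [hval hpm, hval hnm, ← integral_sub hpi.integrableOn hni.integrableOn]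
    exact integral_congr_ae (Eventually.of_forall hsub)
  linarith

/-! ### Kernel representation of the contribution of a face, against test functions -/

open Filter Topology SymTensor

/-- The product of the volume on `F` and on its sphere of normal vectors. -/
def faceMeasure (k : ℕ) (F : Set (Euc n)) : Measure (Sig n) :=
  ((μHE[k] : Measure (Euc n)).restrict F).prod
    ((μHE[n - k - 1] : Measure (Sph n)).restrict (normalSphere (dirSpace F)))

/-- The product of a face and its sphere of normal vectors. -/
def faceBundle (F : Set (Euc n)) : Set (Sig n) := F ×ˢ normalSphere (dirSpace F)

theorem measurableSet_faceBundle {F : Set (Euc n)} (hF : IsPolytope F) :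
    MeasurableSet (faceBundle F) :=
  hF.isCompact.isClosed.measurableSet.prod (isClosed_normalSphere _).measurableSet

theorem isFiniteMeasure_hausdorff_face {F : Set (Euc n)} {k : ℕ} (hF : IsPolytope F)
    (hk : Module.finrank ℝ (dirSpace F) = k) :
    IsFiniteMeasure ((μHE[k] : Measure (Euc n)).restrict F) :=
  ⟨by rw [Measure.restrict_apply_univ]; exact hausdorff_polytope_lt_top hF hk⟩

theorem isFiniteMeasure_hausdorff_normalSphere {L : Submodule ℝ (Euc n)} {k : ℕ}
    (hk : Module.finrank ℝ L = k) :
    IsFiniteMeasure ((μHE[n - k - 1] : Measure (Sph n)).restrict (normalSphere L)) :=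
  ⟨by rw [Measure.restrict_apply_univ]; exact hausdorff_normalSphere_lt_top hk⟩

theorem isFiniteMeasure_faceMeasure {F : Set (Euc n)} {k : ℕ} (hF : IsPolytope F)
    (hk : Module.finrank ℝ (dirSpace F) = k) : IsFiniteMeasure (faceMeasure k F) := by
  have := isFiniteMeasure_hausdorff_face hF hk
  have := isFiniteMeasure_hausdorff_normalSphere hk
  rw [faceMeasure]
  infer_instance

theorem ae_mem_faceBundle {F : Set (Euc n)} {k : ℕ} (hF : IsPolytope F)
    (hk : Module.finrank ℝ (dirSpace F) = k) : ∀ᵐ z ∂faceMeasure k F, z ∈ faceBundle F := by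
  have := isFiniteMeasure_hausdorff_face hF hk
  have := isFiniteMeasure_hausdorff_normalSphere hk
  have h1 : ∀ᵐ z ∂faceMeasure k F, z.1 ∈ F :=
    Measure.quasiMeasurePreserving_fst.ae (ae_restrict_mem hF.isCompact.isClosed.measurableSet)
  have h2 : ∀ᵐ z ∂faceMeasure k F, z.2 ∈ normalSphere (dirSpace F) :=
    Measure.quasiMeasurePreserving_snd.ae
      (ae_restrict_mem (isClosed_normalSphere (dirSpace F)).measurableSet)
  filter_upwards [h1, h2] with z hz1 hz2 using ⟨hz1, hz2⟩

/-- The distance on `Sig n` is the maximum of the two distances, so metric balls are products. -/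
theorem ball_inter_faceBundle {F : Set (Euc n)} {z : Sig n} {r : ℝ} (hz : z ∈ faceBundle F)
    (hdeep : z.1 ∈ deep F r) : Metric.ball z r ∩ faceBundle F =
      relBall (dirSpace F) z.1 r ×ˢ cap (dirSpace F) z.2 r := by
  ext ⟨y, v⟩
  simp only [Set.mem_inter_iff, Metric.mem_ball, Prod.dist_eq, max_lt_iff, faceBundle,
    Set.mem_prod, Subtype.dist_eq, dist_eq_norm]
  constructor
  · rintro ⟨⟨h1, h2⟩, h3, h4⟩
    exact ⟨⟨sub_mem_dirSpace hz.1 h3, h1⟩, h4, h2⟩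
  · rintro ⟨h1, h2⟩
    exact ⟨⟨h1.2, h2.2⟩, relBall_subset_of_mem_deep hdeep h1, h2.1⟩

theorem faceMeasure_ball {F : Set (Euc n)} {k : ℕ} (hF : IsPolytope F)
    (hk : Module.finrank ℝ (dirSpace F) = k) {z : Sig n} {r : ℝ} (hz : z ∈ faceBundle F)
    (hdeep : z.1 ∈ deep F r) : (faceMeasure k F).real (Metric.ball z r) =
      (μHE[k] (relBall (dirSpace F) z.1 r) * μHE[n - k - 1] (cap (dirSpace F) z.2 r)).toReal := by
  have := isFiniteMeasure_hausdorff_face hF hk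
  have := isFiniteMeasure_hausdorff_normalSphere hk
  have h' : Metric.ball z r = Metric.ball z.1 r ×ˢ Metric.ball z.2 r := (ball_prod_same _ _ _).symm
  rw [measureReal_def, faceMeasure, h', Measure.prod_prod,
    Measure.restrict_apply Metric.isOpen_ball.measurableSet,
    Measure.restrict_apply Metric.isOpen_ball.measurableSet]
  have h1 : Metric.ball z.1 r ∩ F = relBall (dirSpace F) z.1 r := by
    ext y
    simp only [Set.mem_inter_iff, Metric.mem_ball, dist_eq_norm]
    exact ⟨fun hy => ⟨sub_mem_dirSpace hz.1 hy.2, hy.1⟩,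
      fun hy => ⟨hy.2, relBall_subset_of_mem_deep hdeep hy⟩⟩
  have h2 : Metric.ball z.2 r ∩ normalSphere (dirSpace F) = cap (dirSpace F) z.2 r := by
    ext v
    simp only [Set.mem_inter_iff, Metric.mem_ball, Subtype.dist_eq, dist_eq_norm]
    exact ⟨fun hv => ⟨hv.2, hv.1⟩, fun hv => ⟨hv.2, hv.1⟩⟩
  rw [h1, h2]

/-- `ν₁ - ν₂` is the component at `x` of the restriction of `Γ(F, ·)` to the bundle of `F`. -/
structure IsDecomposition (Γ : LocalMap n p) (F : Set (Euc n)) (x : Euc n)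
    (ν₁ ν₂ : Measure (Sig n)) : Prop where
  finite₁ : IsFiniteMeasure ν₁
  finite₂ : IsFiniteMeasure ν₂
  mem₁ : ∀ᵐ z ∂ν₁, z ∈ faceBundle F
  mem₂ : ∀ᵐ z ∂ν₂, z ∈ faceBundle F
  eval : ∀ η, MeasurableSet η →
    ν₁.real η - ν₂.real η = diag (Γ.eval F (η ∩ faceBundle F)) x

/-- Jordan decomposition of the scalar signed measure obtained by evaluating the diagonal at `x`,
restricted to the bundle of `F`. -/
theorem exists_isDecomposition {Γ : LocalMap n p} (hmeas : IsMeasureValued Γ) {F : Set (Euc n)}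
    (hF : IsPolytope F) (x : Euc n) : ∃ ν₁ ν₂, IsDecomposition Γ F x ν₁ ν₂ := by
  obtain ⟨μ, hμ⟩ := hmeas ⟨F, hF⟩
  have hZ := measurableSet_faceBundle hF
  let f : SymTensor n p →+ ℝ := (diagCLM x).toLinearMap.toAddMonoidHom
  have hf : Continuous f := (diagCLM x).continuous
  let s : SignedMeasure (Sig n) := μ.mapRange f hf
  let J := s.toJordanDecomposition
  have hJ : J.toSignedMeasure = s := s.toSignedMeasure_toJordanDecomposition
  refine ⟨J.posPart.restrict (faceBundle F), J.negPart.restrict (faceBundle F), inferInstance,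
    inferInstance, ae_restrict_mem hZ, ae_restrict_mem hZ, fun η hη => ?_⟩
  rw [measureReal_restrict_apply hη, measureReal_restrict_apply hη, Γ.eval_eq hF (hη.inter hZ),
    hμ ⟨_, hη.inter hZ⟩]
  have h1 : s (η ∩ faceBundle F) = diag (μ (η ∩ faceBundle F)) x := rfl
  rw [← h1, ← hJ, JordanDecomposition.toSignedMeasure, _root_.sub_apply,
    Measure.toSignedMeasure_apply_measurable (hη.inter hZ),
    Measure.toSignedMeasure_apply_measurable (hη.inter hZ)]

/-- A face with a test function supported away from its relative boundary. -/
structure TestDatum (Γ : LocalMap n p) (k : ℕ) where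
  F : Set (Euc n)
  isPolytope : IsPolytope F
  finrank_eq : Module.finrank ℝ (dirSpace F) = k
  x : Euc n
  φ : Sig n → ℝ
  continuous : Continuous φ
  C : ℝ
  le_C : ∀ z, |φ z| ≤ C
  ρ : ℝ
  ρ_pos : 0 < ρ
  deep : ∀ z, φ z ≠ 0 → z.1 ∈ F → z.1 ∈ deep F ρ
  ν₁ : Measure (Sig n)
  ν₂ : Measure (Sig n)
  decomposition : IsDecomposition Γ F x ν₁ ν₂

theorem exists_kernel_bound {k : ℕ} {E : Submodule ℝ (Euc n) → Euc n → SymTensor n p}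
    (hE : E ∈ kernels n p k) (L : Submodule ℝ (Euc n)) (x : Euc n) :
    ∃ B : ℝ, ∀ u : Sph n, |diag (E L u) x| ≤ B := by
  have hc : Continuous fun u : Sph n => |diag (E L u) x| :=
    (((diagCLM x).continuous.comp (kernels_continuous hE L)).comp continuous_subtype_val).abs
  obtain ⟨B, hB⟩ := (isCompact_range hc).bddAbove
  exact ⟨B, fun u => hB ⟨u, rfl⟩⟩

theorem continuous_diag_kernel {k : ℕ} {E : Submodule ℝ (Euc n) → Euc n → SymTensor n p}
    (hE : E ∈ kernels n p k) (L : Submodule ℝ (Euc n)) (x : Euc n) :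
    Continuous fun z : Sig n => diag (E L z.2) x :=
  (((diagCLM x).continuous.comp (kernels_continuous hE L)).comp continuous_subtype_val).comp
    continuous_snd

variable {Γ : LocalMap n p} {k : ℕ}

/-- The integral of a test function against a kernel. -/
def TestDatum.kernelIntegral (E : Submodule ℝ (Euc n) → Euc n → SymTensor n p)
    (t : TestDatum Γ k) : ℝ :=
  ∫ z, t.φ z * diag (E (dirSpace t.F) z.2) t.x ∂faceMeasure k t.F

theorem TestDatum.integrable (t : TestDatum Γ k)
    {E : Submodule ℝ (Euc n) → Euc n → SymTensor n p} (hE : E ∈ kernels n p k) :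
    Integrable (fun z => t.φ z * diag (E (dirSpace t.F) z.2) t.x) (faceMeasure k t.F) := by
  have := isFiniteMeasure_faceMeasure t.isPolytope t.finrank_eq
  obtain ⟨B, hB⟩ := exists_kernel_bound hE (dirSpace t.F) t.x
  refine Integrable.of_bound (C := t.C * B)
    (t.continuous.mul (continuous_diag_kernel hE _ _)).aestronglyMeasurable
    (Eventually.of_forall fun z => ?_)
  rw [norm_mul, Real.norm_eq_abs, Real.norm_eq_abs]
  exact mul_le_mul (t.le_C z) (hB z.2) (abs_nonneg _) ((abs_nonneg _).trans (t.le_C z))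

theorem integrable_mul_ball {X : Type*} [PseudoMetricSpace X] [SecondCountableTopology X]
    [MeasurableSpace X] [BorelSpace X] (m ν : Measure X) [IsFiniteMeasure m] [IsFiniteMeasure ν]
    {φ : X → ℝ} (hφ : Continuous φ) {C : ℝ} (hC : ∀ z, |φ z| ≤ C) (r : ℝ) :
    Integrable (fun z => φ z * ν.real (Metric.ball z r)) m := by
  have hm : Measurable fun z => ν (Metric.ball z r) := by
    have hU : MeasurableSet {q : X × X | dist q.2 q.1 < r} :=
      (isOpen_lt (by fun_prop) continuous_const).measurableSet
    exact measurable_measure_prodMk_left hU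
  refine Integrable.of_bound (C := C * ν.real Set.univ)
    (hφ.measurable.mul hm.ennreal_toReal).aestronglyMeasurable (Eventually.of_forall fun z => ?_)
  rw [norm_mul, Real.norm_eq_abs, Real.norm_eq_abs, abs_of_nonneg measureReal_nonneg]
  exact mul_le_mul (hC z) (measureReal_mono (Set.subset_univ _)) measureReal_nonneg
    ((abs_nonneg _).trans (hC z))

theorem deep_mono {F : Set (Euc n)} {r r' : ℝ} (h : r ≤ r') : deep F r' ⊆ deep F r :=
  fun _ hx v hv hvr => hx v hv (hvr.trans_le h)

theorem mem_deep_of_dist_lt {F : Set (Euc n)} {r r' : ℝ} {y y' : Euc n} (hy : y ∈ F) (hy' : y' ∈ F)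
    (hd : y' ∈ deep F (r + r')) (h : dist y y' < r') : y ∈ deep F r := by
  intro v hv hvr
  have h1 : y + v = y' + ((y - y') + v) := by abel
  rw [h1]
  refine hd _ (Submodule.add_mem _ (sub_mem_dirSpace hy' hy) hv) ((norm_add_le _ _).trans_lt ?_)
  rw [dist_eq_norm] at h
  linarith

/-- The coefficients `a j / V j` of the approximants depend on the radius only, but are not shown to
converge. Instead the function of the test datum converges pointwise within a finite-dimensional
space of functions, which is closed. The datum includes the face and the component `x`, so the
resulting constants serve all of them. -/
theorem exists_test_coefficients (hn : 2 ≤ n) (hk : k < n)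
    (htrans : IsTranslationInvariant Γ) (hrot : IsSOCovariant Γ)
    (hloc : IsLocallyDefined Γ) :
    ∃ c : (Submodule ℝ (Euc n) → Euc n → SymTensor n p) → ℝ, ∀ t : TestDatum Γ k,
      ∫ z, t.φ z ∂t.ν₁ - ∫ z, t.φ z ∂t.ν₂ =
        ∑ E ∈ (kernels_finite n p k).toFinset, c E * t.kernelIntegral E := by
  have hr0 : ∀ j : ℕ, (0 : ℝ) < 1 / ((j : ℝ) + 1) := fun j => Nat.one_div_pos_of_nat
  have hr := tendsto_one_div_add_atTop_nhds_zero_nat (𝕜 := ℝ)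
  choose V hV hVeq using fun j : ℕ => exists_ball_volume hn hk (hr0 j)
  choose a ha using fun j : ℕ =>
    LocalMap.exists_eval_ball_eq hn hk htrans hrot hloc (1 / ((j : ℝ) + 1))
  let W : Submodule ℝ (TestDatum Γ k → ℝ) := Submodule.span ℝ
    ((fun E t => t.kernelIntegral E) '' ((kernels_finite n p k).toFinset : Set _))
  have hWfin : FiniteDimensional ℝ W :=
    FiniteDimensional.span_of_finite ℝ ((Finset.finite_toSet _).image _)
  have hWclosed : IsClosed (W : Set (TestDatum Γ k → ℝ)) := W.closed_of_finiteDimensional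
  have hmem : (fun t : TestDatum Γ k => ∫ z, t.φ z ∂t.ν₁ - ∫ z, t.φ z ∂t.ν₂) ∈ W := by
    refine hWclosed.mem_of_tendsto (b := atTop) (f := fun (j : ℕ) (t : TestDatum Γ k) =>
      ∑ E ∈ (kernels_finite n p k).toFinset, ((V j)⁻¹ * a j E) * t.kernelIntegral E) ?_
      (Eventually.of_forall fun j => ?_)
    · rw [tendsto_pi_nhds]
      intro t
      have := t.decomposition.finite₁
      have := t.decomposition.finite₂
      have := isFiniteMeasure_faceMeasure t.isPolytope t.finrank_eq
      have hZ := ae_mem_faceBundle t.isPolytope t.finrank_eq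
      have hsmall : ∀ᶠ j : ℕ in atTop, 1 / ((j : ℝ) + 1) < t.ρ / 2 :=
        hr.eventually_lt_const (half_pos t.ρ_pos)
      have hball : ∀ᶠ j : ℕ in atTop, ∀ z ∈ faceBundle t.F, ∀ z' ∈ faceBundle t.F,
          dist z z' < 1 / ((j : ℝ) + 1) → t.φ z' ≠ 0 →
          (faceMeasure k t.F).real (Metric.ball z (1 / ((j : ℝ) + 1))) = V j := by
        filter_upwards [hsmall] with j hj z hz z' hz' hd hne
        have hdeep : z.1 ∈ deep t.F (1 / ((j : ℝ) + 1)) := by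
          refine mem_deep_of_dist_lt hz.1 hz'.1 (deep_mono (by linarith) (t.deep z' hne hz'.1))
            (lt_of_le_of_lt ?_ hd)
          exact le_max_left _ _
        rw [faceMeasure_ball t.isPolytope t.finrank_eq hz hdeep]
        exact hVeq j _ _ _ t.finrank_eq hz.2
      have h1 := tendsto_integral_ball_average (faceMeasure k t.F) t.ν₁ t.continuous t.le_C hZ
        t.decomposition.mem₁ hr hr0 hV hball
      have h2 := tendsto_integral_ball_average (faceMeasure k t.F) t.ν₂ t.continuous t.le_C hZ
        t.decomposition.mem₂ hr hr0 hV hball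
      refine (h1.sub h2).congr' ?_
      filter_upwards [hsmall] with j hj
      rw [← mul_sub, ← integral_sub (integrable_mul_ball _ _ t.continuous t.le_C _)
        (integrable_mul_ball _ _ t.continuous t.le_C _)]
      -- On the bundle, `ν₁ - ν₂` of a small ball is a component of `Γ` on a product of ball and cap
      -- wherever `φ` is nonzero; there the kernel expansion with coefficients `a j` applies.
      have h3 : ∫ z, (t.φ z * t.ν₁.real (Metric.ball z (1 / ((j : ℝ) + 1))) -
            t.φ z * t.ν₂.real (Metric.ball z (1 / ((j : ℝ) + 1)))) ∂faceMeasure k t.F =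
          ∫ z, ∑ E ∈ (kernels_finite n p k).toFinset,
            a j E * (t.φ z * diag (E (dirSpace t.F) z.2) t.x) ∂faceMeasure k t.F := by
        refine integral_congr_ae ?_
        filter_upwards [hZ] with z hz
        rw [← mul_sub, t.decomposition.eval _ Metric.isOpen_ball.measurableSet]
        by_cases hne : t.φ z = 0
        · simp [hne]
        · have hdeep : z.1 ∈ deep t.F (1 / ((j : ℝ) + 1)) :=
            deep_mono (by linarith [t.ρ_pos]) (t.deep z hne hz.1)
          rw [ball_inter_faceBundle hz hdeep,
            ha j t.F z.1 z.2 t.isPolytope t.finrank_eq hdeep hz.2, map_sum, Finset.sum_apply,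
            Finset.mul_sum]
          refine Finset.sum_congr rfl fun E _ => ?_
          rw [map_smul, Pi.smul_apply, smul_eq_mul]
          ring
      rw [h3, integral_finsetSum, Finset.mul_sum]
      · refine Finset.sum_congr rfl fun E _ => ?_
        rw [integral_const_mul, mul_assoc]
        rfl
      · intro E hE
        exact (t.integrable ((Set.Finite.mem_toFinset _).1 hE)).const_mul _
    · have : (fun t : TestDatum Γ k => ∑ E ∈ (kernels_finite n p k).toFinset,
          ((V j)⁻¹ * a j E) * t.kernelIntegral E) = ∑ E ∈ (kernels_finite n p k).toFinset,
          ((V j)⁻¹ * a j E) • fun t : TestDatum Γ k => t.kernelIntegral E := by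
        funext t
        rw [Finset.sum_apply]
        rfl
      rw [this]
      exact Submodule.sum_mem _ fun E hE => Submodule.smul_mem _ _
        (Submodule.subset_span ⟨E, hE, rfl⟩)
  obtain ⟨c, hc⟩ := (Submodule.mem_span_image_finset_iff_exists_fun' ℝ).1 hmem
  refine ⟨c, fun t => ?_⟩
  have := congrFun hc t
  rw [Finset.sum_apply] at this
  exact this.symm

/-! ### Kernel representation of the contribution of a face -/

open Filter Topology SymTensor

/-- Continuous cutoff functions exhausting the relative interior of `F`. -/
theorem exists_cutoff (F : Set (Euc n)) : ∃ χ : ℕ → Euc n → ℝ,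
    (∀ j, Continuous (χ j)) ∧ (∀ j y, |χ j y| ≤ 1) ∧
    (∀ j y, χ j y ≠ 0 → y ∈ F → y ∈ deep F (1 / ((j : ℝ) + 1))) ∧
    ∀ y ∈ F, Tendsto (fun j => χ j y) atTop (𝓝 ((relInt F).indicator (fun _ => 1) y)) := by
  have hδ : ∀ j : ℕ, (0 : ℝ) < 1 / ((j : ℝ) + 1) := fun j => Nat.one_div_pos_of_nat
  let D : Set (Euc n) := (affineSpan ℝ F : Set (Euc n)) \ F
  have hD : ∀ y ∈ F, ∀ v ∈ dirSpace F, y + v ∉ F → y + v ∈ D := fun y hy v hv h =>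
    ⟨by
      have := AffineSubspace.vadd_mem_of_mem_direction hv (subset_affineSpan ℝ F hy)
      rwa [vadd_eq_add, add_comm] at this, h⟩
  -- `T j` is `1` within distance `1 / (j + 1)` of the complement `D` of `F` in its affine hull, and
  -- `0` beyond twice that distance. The cutoff is `1 - T j`.
  let T : ∀ j : ℕ, BoundedContinuousFunction (Euc n) NNReal := fun j =>
    thickenedIndicator (hδ j) (Metric.thickening (1 / ((j : ℝ) + 1)) D)
  have hone : ∀ (j : ℕ) (y : Euc n), y ∈ Metric.thickening (1 / ((j : ℝ) + 1)) D →
      (1 : ℝ) - (T j y : ℝ) = 0 := by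
    intro j y hy
    rw [show T j y = 1 from thickenedIndicator_one (hδ j) _ hy, NNReal.coe_one, sub_self]
  have hdeep : ∀ (j : ℕ) (y : Euc n), (1 : ℝ) - (T j y : ℝ) ≠ 0 → y ∈ F →
      y ∈ deep F (1 / ((j : ℝ) + 1)) := by
    intro j y hne hy v hv hvr
    by_contra hout
    exact hne (hone j y (Metric.mem_thickening_iff.2 ⟨y + v, hD y hy v hv hout,
      by simpa using hvr⟩))
  refine ⟨fun j y => 1 - (T j y : ℝ), fun j => ?_, fun j y => ?_, hdeep, fun y hy => ?_⟩
  · exact continuous_const.sub (NNReal.continuous_coe.comp (T j).continuous)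
  · have h1 : (T j y : ℝ) ≤ 1 := NNReal.coe_le_one.2 (thickenedIndicator_le_one (hδ j) _ y)
    have h0 : (0 : ℝ) ≤ T j y := (T j y).2
    rw [abs_le]
    constructor <;> linarith
  · by_cases hint : y ∈ relInt F
    · rw [Set.indicator_of_mem hint]
      obtain ⟨r, hr, h⟩ := hint
      have hout : y ∉ Metric.thickening r D := by
        intro hmem
        obtain ⟨d, hd, hdist⟩ := Metric.mem_thickening_iff.1 hmem
        refine hd.2 ?_
        have h1 : d - y ∈ dirSpace F :=
          AffineSubspace.vsub_mem_direction hd.1 (subset_affineSpan ℝ F hy)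
        have := h (d - y) h1 (by rwa [← dist_eq_norm, dist_comm])
        rwa [add_sub_cancel] at this
      refine tendsto_const_nhds.congr' ?_
      filter_upwards [(tendsto_one_div_add_atTop_nhds_zero_nat (𝕜 := ℝ)).eventually_lt_const
        (half_pos hr)] with j hj
      have h2 : T j y = 0 := thickenedIndicator_zero (hδ j) _ fun hmem =>
        hout (Metric.thickening_mono (by linarith) D
          (Metric.thickening_thickening_subset _ _ D hmem))
      rw [h2, NNReal.coe_zero, sub_zero]
    · rw [Set.indicator_of_notMem hint]
      -- On the relative boundary every cutoff is zero: a nonzero value would make the point deep,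
      -- hence relatively interior.
      refine tendsto_const_nhds.congr fun j => ?_
      by_contra hne
      replace hne := Ne.symm hne
      refine hint ?_
      exact ⟨_, hδ j, hdeep j y hne hy⟩

theorem tendsto_integral_cutoff {F : Set (Euc n)} (hF : IsClosed F) {χ : ℕ → Euc n → ℝ}
    (hχ : ∀ j, Continuous (χ j)) (hχ1 : ∀ j y, |χ j y| ≤ 1)
    (hlim : ∀ y ∈ F, Tendsto (fun j => χ j y) atTop (𝓝 ((relInt F).indicator (fun _ => 1) y)))
    {m : Measure (Sig n)} (hm : ∀ᵐ z ∂m, z.1 ∈ F) {g : Sig n → ℝ} (hg : Integrable g m) :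
    Tendsto (fun j => ∫ z, χ j z.1 * g z ∂m) atTop
      (𝓝 (∫ z in Prod.fst ⁻¹' relInt F, g z ∂m)) := by
  have hA : MeasurableSet (Prod.fst ⁻¹' relInt F : Set (Sig n)) :=
    measurable_fst (measurableSet_relInt hF)
  rw [← integral_indicator hA]
  refine tendsto_integral_of_dominated_convergence (fun z => ‖g z‖)
    (fun j => (((hχ j).comp continuous_fst).aestronglyMeasurable).mul hg.1) hg.norm
    (fun j => Eventually.of_forall fun z => ?_) ?_
  · rw [norm_mul, Real.norm_eq_abs]
    exact mul_le_of_le_one_left (norm_nonneg _) (hχ1 j z.1)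
  · filter_upwards [hm] with z hz
    have := (hlim z.1 hz).mul_const (g z)
    convert this using 2
    by_cases h : z.1 ∈ relInt F
    · rw [Set.indicator_of_mem h, Set.indicator_of_mem (s := Prod.fst ⁻¹' relInt F) h, one_mul]
    · rw [Set.indicator_of_notMem h, Set.indicator_of_notMem (s := Prod.fst ⁻¹' relInt F) h,
        zero_mul]

theorem integrable_diag_kernel {k : ℕ} {E : Submodule ℝ (Euc n) → Euc n → SymTensor n p}
    (hE : E ∈ kernels n p k) (L : Submodule ℝ (Euc n)) (x : Euc n) (m : Measure (Sig n))
    [IsFiniteMeasure m] : Integrable (fun z : Sig n => diag (E L z.2) x) m := by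
  obtain ⟨B, hB⟩ := exists_kernel_bound hE L x
  exact Integrable.of_bound (C := B) (continuous_diag_kernel hE L x).aestronglyMeasurable
    (Eventually.of_forall fun z => hB z.2)

/-- The identity for test functions is applied to a bounded continuous function times a cutoff. In
the limit it becomes an identity of integrals over the bundle above `relInt F`, which determines the
measures. -/
theorem exists_coefficients {Γ : LocalMap n p} {k : ℕ} (hn : 2 ≤ n) (hk : k < n)
    (hmeas : IsMeasureValued Γ) (htrans : IsTranslationInvariant Γ) (hrot : IsSOCovariant Γ)
    (hloc : IsLocallyDefined Γ) :
    ∃ c : (Submodule ℝ (Euc n) → Euc n → SymTensor n p) → ℝ, ∀ (F : Set (Euc n)) (x : Euc n)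
      (η : Set (Sig n)), IsPolytope F → Module.finrank ℝ (dirSpace F) = k → MeasurableSet η →
      η ⊆ relInt F ×ˢ normalSphere (dirSpace F) →
      diag (Γ.eval F η) x = ∑ E ∈ (kernels_finite n p k).toFinset,
        c E * ∫ z in η, diag (E (dirSpace F) z.2) x ∂faceMeasure k F := by
  obtain ⟨c, hc⟩ := exists_test_coefficients hn hk htrans hrot hloc
  refine ⟨c, fun F x η hF hFk hη hsub => ?_⟩
  obtain ⟨ν₁, ν₂, hν⟩ := exists_isDecomposition hmeas hF x
  obtain ⟨χ, hχ, hχ1, hχdeep, hlim⟩ := exists_cutoff F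
  have := hν.finite₁
  have := hν.finite₂
  have := isFiniteMeasure_faceMeasure hF hFk
  have hFc := hF.isCompact.isClosed
  let A : Set (Sig n) := Prod.fst ⁻¹' relInt F
  have hA : MeasurableSet A := measurable_fst (measurableSet_relInt hFc)
  let g : Sig n → ℝ := fun z => ∑ E ∈ (kernels_finite n p k).toFinset,
    c E * diag (E (dirSpace F) z.2) x
  have hgi : ∀ E ∈ (kernels_finite n p k).toFinset,
      Continuous fun z : Sig n => diag (E (dirSpace F) z.2) x := fun E hE =>
    continuous_diag_kernel ((Set.Finite.mem_toFinset _).1 hE) _ _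
  have hgc : Continuous g := continuous_finsetSum _ fun E hE => continuous_const.mul (hgi E hE)
  have hint : ∀ E ∈ (kernels_finite n p k).toFinset, ∀ m : Measure (Sig n), IsFiniteMeasure m →
      Integrable (fun z : Sig n => diag (E (dirSpace F) z.2) x) m := fun E hE m _ =>
    integrable_diag_kernel ((Set.Finite.mem_toFinset _).1 hE) _ _ _
  have hψint : ∀ E ∈ (kernels_finite n p k).toFinset, ∀ m : Measure (Sig n), IsFiniteMeasure m →
      ∀ ψ : BoundedContinuousFunction (Sig n) ℝ,
      Integrable (fun z : Sig n => ψ z * diag (E (dirSpace F) z.2) x) m := by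
    intro E hE m hm ψ
    exact (hint E hE m hm).bdd_mul (c := ‖ψ‖) ψ.continuous.aestronglyMeasurable
      (Eventually.of_forall ψ.norm_coe_le_norm)
  have key : ∀ ψ : BoundedContinuousFunction (Sig n) ℝ,
      ∫ z, ψ z ∂ν₁.restrict A - ∫ z, ψ z ∂ν₂.restrict A =
        ∫ z, ψ z * g z ∂(faceMeasure k F).restrict A := by
    intro ψ
    have h1 := tendsto_integral_cutoff hFc hχ hχ1 hlim (hν.mem₁.mono fun z hz => hz.1)
      (ψ.integrable ν₁)
    have h2 := tendsto_integral_cutoff hFc hχ hχ1 hlim (hν.mem₂.mono fun z hz => hz.1)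
      (ψ.integrable ν₂)
    have h3 : Tendsto (fun j => ∑ E ∈ (kernels_finite n p k).toFinset,
        c E * ∫ z, χ j z.1 * (ψ z * diag (E (dirSpace F) z.2) x) ∂faceMeasure k F) atTop
        (𝓝 (∑ E ∈ (kernels_finite n p k).toFinset,
          c E * ∫ z in A, ψ z * diag (E (dirSpace F) z.2) x ∂faceMeasure k F)) :=
      tendsto_finsetSum _ fun E hE => (tendsto_integral_cutoff hFc hχ hχ1 hlim
        ((ae_mem_faceBundle hF hFk).mono fun z hz => hz.1)
        (hψint E hE _ inferInstance ψ)).const_mul _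
    have h4 : ∫ z, ψ z * g z ∂(faceMeasure k F).restrict A =
        ∑ E ∈ (kernels_finite n p k).toFinset,
          c E * ∫ z in A, ψ z * diag (E (dirSpace F) z.2) x ∂faceMeasure k F := by
      simp only [g, Finset.mul_sum]
      rw [integral_finsetSum]
      · refine Finset.sum_congr rfl fun E _ => ?_
        rw [← integral_const_mul]
        refine integral_congr_ae (Eventually.of_forall fun z => ?_)
        change ψ z * (c E * _) = c E * (ψ z * _)
        ring
      · intro E hE
        have := (hψint E hE ((faceMeasure k F).restrict A) inferInstance ψ).const_mul (c E)
        refine this.congr (Eventually.of_forall fun z => ?_)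
        change c E * (ψ z * _) = ψ z * (c E * _)
        ring
    rw [h4]
    refine tendsto_nhds_unique ((h1.sub h2).congr fun j => ?_) h3
    have := hc
      { F := F, isPolytope := hF, finrank_eq := hFk, x := x
        φ := fun z => χ j z.1 * ψ z
        continuous := ((hχ j).comp continuous_fst).mul ψ.continuous
        C := ‖ψ‖
        le_C := fun z => by
          rw [abs_mul]
          exact (mul_le_of_le_one_left (abs_nonneg _) (hχ1 j z.1)).trans (ψ.norm_coe_le_norm z)
        ρ := 1 / ((j : ℝ) + 1)
        ρ_pos := Nat.one_div_pos_of_nat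
        deep := fun z hz hzF => hχdeep j z.1 (left_ne_zero_of_mul hz) hzF
        ν₁ := ν₁, ν₂ := ν₂, decomposition := hν }
    simpa only [TestDatum.kernelIntegral, mul_assoc] using this
  have hgint : Integrable g ((faceMeasure k F).restrict A) :=
    integrable_finsetSum _ fun E hE => (hint E hE _ inferInstance).const_mul _
  have hηA : η ∩ A = η := Set.inter_eq_left.2 fun z hz => (hsub hz).1
  have hηZ : η ∩ faceBundle F = η :=
    Set.inter_eq_left.2 fun z hz => ⟨relInt_subset F (hsub hz).1, (hsub hz).2⟩
  have h := measure_sub_eq_setIntegral (ν₁.restrict A) (ν₂.restrict A)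
    ((faceMeasure k F).restrict A) hgc.measurable hgint key hη
  rw [measureReal_restrict_apply hη, measureReal_restrict_apply hη, Measure.restrict_restrict hη,
    hηA, hν.eval η hη, hηZ] at h
  rw [h, integral_finsetSum _ fun E hE =>
    (hint E hE ((faceMeasure k F).restrict η) inferInstance).const_mul (c E)]
  exact Finset.sum_congr rfl fun E _ => integral_const_mul _ _

/-! ### Mappings given by kernels -/

open Filter Topology SymTensor

/-- The relative boundary of `F` is a null set, so integrating over `F` or over its relative
interior makes no difference. -/
theorem restrict_prod_restrict_eq {k : ℕ} {P F : Set (Euc n)} (hF : IsPolytope F) (hFP : F ⊆ P)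
    (hFk : Module.finrank ℝ (dirSpace F) = k) :
    ((μHE[k] : Measure (Euc n)).restrict F).prod
      ((μHE[n - k - 1] : Measure (Sph n)).restrict (unitNormals P F)) =
      (faceMeasure k F).restrict (cell P F) := by
  have := isFiniteMeasure_hausdorff_face hF hFk
  have := isFiniteMeasure_hausdorff_normalSphere hFk
  have hFm := hF.isCompact.isClosed.measurableSet
  have h1 : ((μHE[k] : Measure (Euc n)).restrict F).restrict (relInt F) =
      (μHE[k] : Measure (Euc n)).restrict F := by
    rw [Measure.restrict_restrict (measurableSet_relInt hF.isCompact.isClosed),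
      Set.inter_eq_left.2 (relInt_subset F)]
    refine Measure.restrict_congr_set (ae_eq_set.2 ⟨?_, hausdorff_diff_relInt hF hFk⟩)
    rw [Set.sdiff_eq_empty.2 (relInt_subset F), measure_empty]
  have h2 : ((μHE[n - k - 1] : Measure (Sph n)).restrict (normalSphere (dirSpace F))).restrict
      (unitNormals P F) = (μHE[n - k - 1] : Measure (Sph n)).restrict (unitNormals P F) := by
    rw [Measure.restrict_restrict (isClosed_unitNormals P F).measurableSet,
      Set.inter_eq_left.2 (unitNormals_subset_normalSphere hFP)]
  rw [faceMeasure, cell, ← Measure.prod_restrict, h1, h2]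

/-- Iterated integrals of a function of the second variable, seen through coordinates. -/
theorem coordinate_integral_integral {X Y Z V : Type*} [MeasurableSpace X] [TopologicalSpace X]
    [SecondCountableTopology X] [OpensMeasurableSpace X]
    [TopologicalSpace Y] [CompactSpace Y] [MeasurableSpace Y] [OpensMeasurableSpace Y]
    [SecondCountableTopology Y]
    [NormedAddCommGroup V] [NormedSpace ℝ V] [FiniteDimensional ℝ V]
    (μ : Measure X) (ν : Measure Y) [IsFiniteMeasure μ] [IsFiniteMeasure ν]
    (f : V →ₗ[ℝ] (Z → ℝ)) (hf : Function.Injective f) {h : Y → V}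
    (hh : ∀ z, Continuous fun y => f (h y) z) {η : Set (X × Y)} (hη : MeasurableSet η) (z : Z) :
    f (∫ x, ∫ y, η.indicator (fun w => h w.2) (x, y) ∂ν ∂μ) z =
      ∫ w in η, f (h w.2) z ∂μ.prod ν := by
  have hcont : Continuous h :=
    (isClosedEmbedding_of_injective_linearMap f hf).isEmbedding.continuous_iff.2 (continuous_pi hh)
  have hc : Continuous fun w : X × Y => h w.2 := hcont.comp continuous_snd
  obtain ⟨B, hB⟩ := (isCompact_range hcont.norm).bddAbove
  have hint : Integrable (fun w : X × Y => h w.2) (μ.prod ν) :=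
    Integrable.of_bound (C := B) hc.aestronglyMeasurable
      (Eventually.of_forall fun w => hB ⟨w.2, rfl⟩)
  have : CompleteSpace V := FiniteDimensional.complete ℝ V
  rw [← integral_prod (f := η.indicator fun w : X × Y => h w.2) (hint.indicator hη),
    integral_indicator hη]
  exact ((((LinearMap.proj z).comp f).toContinuousLinearMap).integral_comp_comm
    hint.integrableOn).symm

theorem diag_faceIntegral {k : ℕ} {P F : Set (Euc n)} (hF : IsPolytope F) (hFP : F ⊆ P)
    (hFk : Module.finrank ℝ (dirSpace F) = k) {η : Set (Sig n)} (hη : MeasurableSet η)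
    {h : Euc n → SymTensor n p} (hh : Continuous h) (x : Euc n) :
    diag (faceIntegral k P F η (fun _ u => h u)) x =
      ∫ z in η ∩ cell P F, diag (h z.2) x ∂faceMeasure k F := by
  have := isFiniteMeasure_hausdorff_face hF hFk
  have := isFiniteMeasure_hausdorff_normalSphere hFk
  have : IsFiniteMeasure ((μHE[n - k - 1] : Measure (Sph n)).restrict (unitNormals P F)) :=
    isFiniteMeasure_of_le _
      (Measure.restrict_mono (unitNormals_subset_normalSphere hFP) le_rfl)
  have h1 := coordinate_integral_integral (V := SymTensor n p)
    ((μHE[k] : Measure (Euc n)).restrict F)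
    ((μHE[n - k - 1] : Measure (Sph n)).restrict (unitNormals P F)) diag diag_injective
    (h := fun u : Sph n => h u)
    (fun y => ((diagCLM y).continuous.comp hh).comp continuous_subtype_val) hη x
  rw [restrict_prod_restrict_eq hF hFP hFk, Measure.restrict_restrict hη] at h1
  exact h1

/-- The mapping with kernel `E` supported by `k`-faces. -/
def kernelMap (k : ℕ) (E : Submodule ℝ (Euc n) → Euc n → SymTensor n p) : LocalMap n p :=
  fun P η => ∑ᶠ F ∈ faces k P.1, faceIntegral k P.1 F η.1 (fun _ u => E (dirSpace F) u)

theorem diag_finsum_faces {k : ℕ} (P : Polytope n) (f : Set (Euc n) → SymTensor n p) (x : Euc n) :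
    diag (∑ᶠ F ∈ faces k P.1, f F) x = ∑ F ∈ (faces_finite k P.2).toFinset, diag (f F) x := by
  rw [finsum_mem_eq_finite_toFinset_sum _ (faces_finite k P.2), map_sum, Finset.sum_apply]

theorem diag_kernelMap {k : ℕ} {E : Submodule ℝ (Euc n) → Euc n → SymTensor n p}
    (hE : ∀ L, Continuous (E L)) (P : Polytope n) (η : BorelSet n) (x : Euc n) :
    diag (kernelMap k E P η) x = ∑ F ∈ (faces_finite k P.2).toFinset,
      ∫ z in η.1 ∩ cell P.1 F, diag (E (dirSpace F) z.2) x ∂faceMeasure k F := by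
  rw [kernelMap, diag_finsum_faces]
  refine Finset.sum_congr rfl fun F hF => ?_
  replace hF := (Set.Finite.mem_toFinset _).1 hF
  exact diag_faceIntegral (P.2.of_mem_faces hF) hF.2.1.subset hF.2.2 η.2 (hE _) x

theorem vecPow_zero_right (x : Euc n) : vecPow x 0 = vecPow 0 0 :=
  diag_ext fun y => by rw [diag_vecPow, diag_vecPow, pow_zero, pow_zero]

theorem sphereArea_ne_zero {d : ℕ} (hd : 0 < d) : sphereArea d ≠ 0 := by
  have h : (0 : ℝ) < (d : ℝ) / 2 := by positivity
  have := Real.Gamma_pos_of_pos h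
  have := Real.pi_pos
  rw [sphereArea]
  positivity

/-- The computation common to the three families: on diagonals, the factor from `Q^m` and the factor
`A` depending on the face only are scalars that can be moved under the integral. -/
theorem diag_metricPowMul {k q' : ℕ} {A : Submodule ℝ (Euc n) → SymTensor n q}
    {h : Submodule ℝ (Euc n) → Euc n → SymTensor n q'} (hh : ∀ L, Continuous (h L))
    {E : Submodule ℝ (Euc n) → Euc n → SymTensor n p} (hE : ∀ L, Continuous (E L)) (m : ℕ)
    (hEh : ∀ L u x, diag (E L u) x = (‖x‖ ^ 2) ^ m * (diag (A L) x * diag (h L u) x))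
    (P : Polytope n) (η : BorelSet n) (x : Euc n) :
    (‖x‖ ^ 2) ^ m * diag (∑ᶠ F ∈ faces k P.1, (A (dirSpace F)).mul
      (faceIntegral k P.1 F η.1 (fun _ u => h (dirSpace F) u))) x =
      diag (kernelMap k E P η) x := by
  rw [diag_kernelMap hE, diag_finsum_faces, Finset.mul_sum]
  refine Finset.sum_congr rfl fun F hF => ?_
  replace hF := (Set.Finite.mem_toFinset _).1 hF
  rw [diag_mul, diag_faceIntegral (P.2.of_mem_faces hF) hF.2.1.subset hF.2.2 η.2 (hh _),
    ← integral_const_mul, ← integral_const_mul]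
  simp only [hEh]

theorem metricPowMul_phi {k m j s : ℕ} (h : 2 * m + (2 * j + (0 + s)) = p) :
    metricPowMul m h (phi n k 0 s j) =
      ((s.factorial : ℝ) * sphereArea (n - k + s))⁻¹ • kernelMap k (stdKernel m j s h) := by
  funext P η
  refine diag_ext fun x => ?_
  have hE : ∀ L : Submodule ℝ (Euc n), Continuous (stdKernel (n := n) m j s h L) := fun L =>
    continuous_of_diag fun x => by simp only [diag_stdKernel]; fun_prop
  have hh : ∀ _ : Submodule ℝ (Euc n), Continuous fun u : Euc n =>
      (vecPow (0 : Euc n) 0).mul (vecPow u s) := fun L =>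
    continuous_of_diag fun x => by simp only [diag_mul, diag_vecPow]; fun_prop
  rw [Pi.smul_apply, Pi.smul_apply, map_smul, Pi.smul_apply,
    ← diag_metricPowMul (A := fun L => (metricTensorOf L).pow j) hh hE m]
  · simp only [metricPowMul, phi, diag_cast, diag_mul, diag_pow, diag_metricTensor, map_smul,
      Pi.smul_apply, vecPow_zero_right, Nat.factorial_zero, Nat.cast_one, one_mul, smul_eq_mul]
    ring
  · intro L u x
    rw [diag_stdKernel, diag_pow, diag_metricTensorOf, diag_mul, diag_vecPow, diag_vecPow]
    ring

theorem metricPowMul_phiTilde3 {m j s : ℕ} (h : 2 * m + (2 * j + 1 + (0 + (1 + s))) = p) :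
    metricPowMul m h (phiTilde3 0 s j) = kernelMap 1 (edgeKernel m j s h) := by
  funext P η
  refine diag_ext fun x => ?_
  have hE : ∀ L : Submodule ℝ (Euc 3), Continuous (edgeKernel m j s h L) := fun L =>
    continuous_of_diag fun x => by simp only [diag_edgeKernel, inner_cross3]; fun_prop
  have hh : ∀ L : Submodule ℝ (Euc 3), Continuous fun u : Euc 3 =>
      (vecPow (0 : Euc 3) 0).mul ((vec (cross3 (unitVec L) u)).mul (vecPow u s)) := fun L =>
    continuous_of_diag fun x => by
      simp only [diag_mul, diag_vecPow, diag_vec, inner_cross3]; fun_prop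
  rw [← diag_metricPowMul (A := fun L => ((metricTensorOf L).pow j).mul (vec (unitVec L))) hh hE m]
  · simp only [metricPowMul, phiTilde3, diag_cast, diag_mul, diag_pow, diag_metricTensor,
      vecPow_zero_right]
    -- `edgeVec F` is by definition the unit vector chosen in `dirSpace F`.
    rfl
  · intro L u x
    rw [diag_edgeKernel, diag_mul, diag_pow, diag_metricTensorOf, diag_mul, diag_mul, diag_vecPow,
      diag_vecPow, diag_vec, diag_vec]
    ring

theorem metricPowMul_phiTilde2 {k m s : ℕ} (h : 2 * m + (0 + (1 + s)) = p) :
    metricPowMul m h (phiTilde2 k 0 s) = kernelMap k (planeKernel m s h) := by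
  funext P η
  refine diag_ext fun x => ?_
  have hE : ∀ L : Submodule ℝ (Euc 2), Continuous (planeKernel m s h L) := fun L =>
    continuous_of_diag fun x => by simp only [diag_planeKernel, inner_rot2]; fun_prop
  have hh : ∀ _ : Submodule ℝ (Euc 2), Continuous fun u : Euc 2 =>
      (vecPow (0 : Euc 2) 0).mul ((vec (rot2 u)).mul (vecPow u s)) := fun L =>
    continuous_of_diag fun x => by
      simp only [diag_mul, diag_vecPow, diag_vec, inner_rot2]; fun_prop
  rw [← diag_metricPowMul (A := fun _ => vecPow 0 0) hh hE m]
  · simp only [metricPowMul, phiTilde2, diag_cast, diag_mul, diag_pow, diag_metricTensor,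
      vecPow_zero_right, diag_finsum_faces, diag_vecPow, pow_zero, one_mul]
  · intro L u x
    rw [diag_planeKernel, diag_mul, diag_mul, diag_vecPow, diag_vecPow, diag_vec]
    ring

theorem kernelMap_mem_span {k : ℕ} (hk : k < n)
    {E : Submodule ℝ (Euc n) → Euc n → SymTensor n p} (hE : E ∈ kernels n p k) :
    kernelMap k E ∈ Submodule.span ℝ (standardMaps n p ∪ additionalMaps n p) := by
  rcases hE with ⟨m, j, s, h, hj, rfl⟩ | hE
  -- The normalization of `phi` can be inverted because `k < n` keeps the index `n - k + s`
  -- positive.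
  · have hC : (s.factorial : ℝ) * sphereArea (n - k + s) ≠ 0 :=
      mul_ne_zero (by positivity) (sphereArea_ne_zero (by omega))
    have := Submodule.smul_mem (Submodule.span ℝ (standardMaps n p ∪ additionalMaps n p))
      ((s.factorial : ℝ) * sphereArea (n - k + s))
      (Submodule.subset_span (Or.inl ⟨k, m, s, j, h, hk, hj, rfl⟩))
    rwa [metricPowMul_phi, smul_inv_smul₀ hC] at this
  · refine addKernels_cases (C := fun n E => k < n →
      kernelMap k E ∈ Submodule.span ℝ (standardMaps n p ∪ additionalMaps n p)) hE ?_ ?_ hk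
    · rintro rfl m j s h -
      rw [← metricPowMul_phiTilde3]
      exact Submodule.subset_span (Or.inr ⟨m, s, j, h, rfl⟩)
    · intro m s h hk
      rw [← metricPowMul_phiTilde2]
      exact Submodule.subset_span (Or.inr ⟨k, m, s, h, hk, rfl⟩)

theorem mem_span_maps (hn : 2 ≤ n) {Γ : LocalMap n p} (hmeas : IsMeasureValued Γ)
    (htrans : IsTranslationInvariant Γ) (hrot : IsSOCovariant Γ) (hloc : IsLocallyDefined Γ) :
    Γ ∈ Submodule.span ℝ (standardMaps n p ∪ additionalMaps n p) := by
  -- The condition `k < n` is placed inside the existential, so that coefficients can be chosen for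
  -- all `k` at once.
  have hc : ∀ k, ∃ c : (Submodule ℝ (Euc n) → Euc n → SymTensor n p) → ℝ, k < n →
      ∀ (F : Set (Euc n)) (x : Euc n) (η : Set (Sig n)), IsPolytope F →
      Module.finrank ℝ (dirSpace F) = k → MeasurableSet η →
      η ⊆ relInt F ×ˢ normalSphere (dirSpace F) →
      diag (Γ.eval F η) x = ∑ E ∈ (kernels_finite n p k).toFinset,
        c E * ∫ z in η, diag (E (dirSpace F) z.2) x ∂faceMeasure k F := by
    intro k
    by_cases hk : k < n
    · obtain ⟨c, hc⟩ := exists_coefficients hn hk hmeas htrans hrot hloc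
      exact ⟨c, fun _ => hc⟩
    · exact ⟨0, fun h => absurd h hk⟩
  choose c hc using hc
  have hΓ : Γ = ∑ k ∈ Finset.range n, ∑ E ∈ (kernels_finite n p k).toFinset,
      c k E • kernelMap k E := by
    funext P η
    refine diag_ext fun x => ?_
    rw [Γ.eq_sum_faces hmeas hloc]
    simp only [Finset.sum_apply, map_sum, Pi.smul_apply, map_smul, smul_eq_mul]
    refine Finset.sum_congr rfl fun k hk => ?_
    replace hk := Finset.mem_range.1 hk
    have h1 : ∀ F ∈ (faces_finite k P.2).toFinset, diag (Γ.eval F (η.1 ∩ cell P.1 F)) x =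
        ∑ E ∈ (kernels_finite n p k).toFinset,
          c k E * ∫ z in η.1 ∩ cell P.1 F, diag (E (dirSpace F) z.2) x ∂faceMeasure k F := by
      intro F hF
      replace hF := (Set.Finite.mem_toFinset _).1 hF
      have hFP := P.2.of_mem_faces hF
      exact hc k hk F x _ hFP hF.2.2 (η.2.inter (measurableSet_cell hFP.isCompact.isClosed))
        fun z hz => ⟨hz.2.1, unitNormals_subset_normalSphere hF.2.1.subset hz.2.2⟩
    rw [Finset.sum_congr rfl h1, Finset.sum_comm]
    refine Finset.sum_congr rfl fun E hE => ?_
    rw [diag_kernelMap fun L => kernels_continuous ((Set.Finite.mem_toFinset _).1 hE) L,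
      Finset.mul_sum]
  rw [hΓ]
  exact Submodule.sum_mem _ fun k hk => Submodule.sum_mem _ fun E hE => Submodule.smul_mem _ _
    (kernelMap_mem_span (Finset.mem_range.1 hk) ((Set.Finite.mem_toFinset _).1 hE))

end LocalTensor

end

theorem theorem3 (n p : ℕ) (hn : 2 ≤ n) (Γ : LocalTensor.LocalMap n p)
    (hmeas : LocalTensor.IsMeasureValued Γ)
    (htrans : LocalTensor.IsTranslationInvariant Γ)
    (hrot : LocalTensor.IsSOCovariant Γ)
    (hloc : LocalTensor.IsLocallyDefined Γ) :
    Γ ∈ Submodule.span ℝ (LocalTensor.standardMaps n p ∪ LocalTensor.additionalMaps n p) :=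
  LocalTensor.mem_span_maps hn hmeas htrans hrot hloc
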